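/- **Setting.** Fix integers $k,\ell\ge 1$. Let $G$ be the square lattice with black vertices $\mathrm b_{x,y}$ and white vertices $\mathrm w_{x,y}$, $(x,y)\in\mathbb Z^2$, in which $\mathrm w_{x,y}$ is joined to $\mathrm b_{x,y}$, $\mathrm b_{x,y+1}$, $\mathrm b_{x+1,y+1}$, $\mathrm b_{x+1,y}$ by an edge called West, South, East, North, respectively. Let $\sigma(e)=-1$ on North edges and $\sigma(e)=1$ on all others. Let $\nu>0$ be an edge weight function on $G$ that is invariant under translation of the labels by $(\ell,0)$ and $(0,k)$, and let $G_1=(B_1,W_1,E_1)$ be the quotient of $G$ by these translations, a graph on the torus (with parallel edges if $k=1$ or $\ell=1$). A dimer cover of a graph is a set of edges that covers every vertex exactly once. For $e\in E_1$ let $e\wedge\gamma_u=1$ if $e$ is a South or East edge at some $\mathrm w_{i,k-1}$ and $0$ otherwise; let $e\wedge\gamma_v=1$ if $e$ is a North or East edge at some $\mathrm w_{\ell-1,j}$ and $0$ otherwise. A dimer cover $\mathcal D$ of $G_1$ has energy and slope $$\mathcal E(\mathcal D)=\sum_{e\in\mathcal D}\log\nu(e),\qquad \mu(\mathcal D)=\sum_{e\in\mathcal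 D}(-e\wedge\gamma_u,\;e\wedge\gamma_v)\in\mathbb Z^2 .$$ Let $\mathcal N$ be the set of slopes of dimer covers of $G_1$, and for $\mu\in\mathcal N$ let $\mathcal E^*(\mu)=\max\{\mathcal E(\mathcal D):\mu(\mathcal D)=\mu\}$ be the tropical surface tension. It is *strictly concave at* $\mu\in\mathcal N$ if $\mathcal E^*(\mu)>\sum_{i=1}^n t_i\,\mathcal E^*(\mu_i)$ whenever $t_i\in(0,1)$, $\mu_i\in\mathcal N\setminus\{\mu\}$, $\sum_i t_i=1$ and $\sum_i t_i\mu_i=\mu$. The tropical curve $\mathcal A_t$ is the set of $(x,y)\in\mathbb R^2$ at which the maximum $P_t(x,y)=\max_{\mu\in\mathcal N}\{\mu_1x+\mu_2y+\mathcal E^*(\mu)\}$ is not uniquely attained, and the interior of $\mathcal A_{t,\mu}$ is the component of $\mathbb R^2\setminus\mathcal A_t$ on which this maximum is attained at $\mu$. For a weight function $c\ge0$ on $E_1$ (extended periodically to $G$), put $$K^{c}_{\tilde{\mathrm w}\tilde{\mathrm b}}=\mathbf 1_{\tilde{\mathrm w}\tilde{\mathrm b}\in G}\,c(\tilde{\mathrm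 w}\tilde{\mathrm b})\,\sigma(\tilde{\mathrm w}\tilde{\mathrm b}),\qquad K_1^{c}(z,w)_{\mathrm w\mathrm b}=\sum_{e=\mathrm w\mathrm b\in E_1}c(e)\,\sigma(e)\,\frac{w^{e\wedge\gamma_v}}{z^{e\wedge\gamma_u}},$$ and, for $r,s>0$ and $0\le i,i'<\ell$, $0\le j,j'<k$, $$L^{c,r,s}_{\mathrm b_{\ell m+i,kn+j}\,\mathrm w_{\ell m'+i',kn'+j'}}=\frac1{(2\pi\mathrm i)^2}\int_{|z|=r}\int_{|w|=s}\bigl(K_1^{c}(z,w)^{-1}\bigr)_{\mathrm b_{i,j}\mathrm w_{i',j'}}\frac{z^{n'-n}}{w^{m'-m}}\frac{dw}{w}\frac{dz}{z}.$$ For $\beta>0$ and $(x,y)\in\mathbb R^2$, the Gibbs measure $\mathbb P_{\beta,(x,y)}$ is the probability measure on dimer covers $\mathcal D$ of $G$ such that, for all pairwise distinct edges $e_s=\mathrm w_s\mathrm b_s$ of $G$, $s=1,\dots,p$, $$\mathbb P_{\beta,(x,y)}[e_1,\dots,e_p\in\mathcal D]=\det\bigl(K_{\mathrm w_{s'}\mathrm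 b_{s'}}\,L_{\mathrm b_s\mathrm w_{s'}}\bigr)_{1\le s,s'\le p},\qquad K=K^{\nu^\beta},\ L=L^{\nu^\beta,\,e^{\beta x},\,e^{\beta y}} .$$ For $\mu\in\mathcal N$ let $E_{1,\mu}\subset E_1$ be the set of edges that lie in at least one dimer cover $\mathcal D$ of $G_1$ with $\mu(\mathcal D)=\mu$ and $\mathcal E(\mathcal D)=\mathcal E^*(\mu)$, and let $G_\mu\subset G$ be the subgraph with all vertices of $G$ whose edges are those that project into $E_{1,\mu}$. **Theorem.** Let $\mu\in\mathcal N$ and assume that $\mathcal E^*$ is strictly concave at $\mu$. Then there is a unique probability measure $\mathbb P_\mu$ on dimer covers $\mathcal D$ of $G_\mu$ (with the $\sigma$-algebra generated by the events $\{e\in\mathcal D\}$) such that, for all pairwise distinct edges $e_s=\mathrm w_s\mathrm b_s$ of $G_\mu$, $s=1,\dots,p$, $$\mathbb P_\mu[e_1,\dots,e_p\in\mathcal D]=\det\bigl(K_{\mathrm w_{s'}\mathrm b_{s'}}\,L_{\mathrm b_s\mathrm w_{s'}}\bigr)_{1\le s,s'\le p},\qquad K=K^{\mathbf 1_{E_{1,\mu}}},\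 L=L^{\mathbf 1_{E_{1,\mu}},\,1,\,1} .$$ Moreover, for every $(x,y)$ in the interior of $\mathcal A_{t,\mu}$, the measure $\mathbb P_{\beta,(x,y)}$ exists and is unique for all sufficiently large $\beta$, and for all edges $e_1,\dots,e_p$ of $G$ there is an $\varepsilon>0$ such that, as $\beta\to\infty$, $$\mathbb P_{\beta,(x,y)}[e_1,\dots,e_p\in\mathcal D]=\mathbb P_\mu[e_1,\dots,e_p\in\mathcal D]+\mathcal O(e^{-\varepsilon\beta}).$$ -/

import Mathlib

namespace TropicalDimer

/-- The four types of edges of the rotated square lattice. -/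
inductive Dir
  | west
  | south
  | east
  | north
  deriving DecidableEq

instance : Fintype Dir where
  elems := {Dir.west, Dir.south, Dir.east, Dir.north}
  complete := by intro d; cases d <;> simp

/-- An edge is given by its white endpoint together with its type.  With `X = Y = ℤ` these are the
edges of the lattice `G`; with `X = ℤ/ℓ`, `Y = ℤ/k` they are the edges of the torus graph `G₁`
(which has parallel edges when `k = 1` or `ℓ = 1`).  Black and white vertices are both labelled by
`X × Y`. -/
abbrev Edge (X Y : Type) : Type := (X × Y) × Dir

/-- The label of the black endpoint minus the label of the white endpoint. -/
def Dir.shift {X Y : Type} [Zero X] [One X] [Zero Y] [One Y] : Dir → X × Y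
  | .west => (0, 0)
  | .south => (0, 1)
  | .east => (1, 1)
  | .north => (1, 0)

/-- The white endpoint `w_{x,y}` of an edge. -/
def Edge.white {X Y : Type} (e : Edge X Y) : X × Y := e.1

/-- The black endpoint of an edge: `b_{x,y}`, `b_{x,y+1}`, `b_{x+1,y+1}`, `b_{x+1,y}` for the West,
South, East, North edge at `w_{x,y}`. -/
def Edge.black {X Y : Type} [AddMonoidWithOne X] [AddMonoidWithOne Y] (e : Edge X Y) : X × Y :=
  e.1 + e.2.shift

/-- The Kasteleyn sign: `-1` on North edges and `1` otherwise. -/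
def Dir.sign : Dir → ℂ
  | .north => -1
  | _ => 1

/-- `D` is a dimer cover (perfect matching) of the graph with all vertices and edge set `E`. -/
def IsDimerCover {X Y : Type} [AddMonoidWithOne X] [AddMonoidWithOne Y]
    (E D : Set (Edge X Y)) : Prop :=
  D ⊆ E ∧ (∀ v : X × Y, ∃! e : Edge X Y, e ∈ D ∧ Edge.white e = v) ∧
    ∀ v : X × Y, ∃! e : Edge X Y, e ∈ D ∧ Edge.black e = v

/-- Edges of the lattice `G`. -/
abbrev LatticeEdge : Type := Edge ℤ ℤ

/-- Edges of the torus graph `G₁`, with horizontal period `ℓ` and vertical period `k`. -/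
abbrev TorusEdge (k ℓ : ℕ) : Type := Edge (ZMod ℓ) (ZMod k)

/-- The projection from the edges of `G` to the edges of `G₁`. -/
def proj (k ℓ : ℕ) (e : LatticeEdge) : TorusEdge k ℓ :=
  (((e.1.1 : ZMod ℓ), (e.1.2 : ZMod k)), e.2)

/-- `e ∧ γ_u`: equal to `1` if the edge joins `w_{i',k-1}` to some `b_{i,0}` across the horizontal
loop `γ_u` (note that `-1 : ZMod k` is the class of `k - 1`), and `0` otherwise. -/
def crossU {k ℓ : ℕ} (e : TorusEdge k ℓ) : ℤ :=
  if e.1.2 = -1 ∧ (e.2 = Dir.south ∨ e.2 = Dir.east) then 1 else 0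

/-- `e ∧ γ_v`: equal to `1` if the edge joins `w_{ℓ-1,j}` to some `b_{0,j'}` across the vertical
loop `γ_v`, and `0` otherwise. -/
def crossV {k ℓ : ℕ} (e : TorusEdge k ℓ) : ℤ :=
  if e.1.1 = -1 ∧ (e.2 = Dir.north ∨ e.2 = Dir.east) then 1 else 0

/-- The slope of a set of edges of `G₁`. -/
def slope {k ℓ : ℕ} (D : Finset (TorusEdge k ℓ)) : ℤ × ℤ :=
  (∑ e ∈ D, -crossU e, ∑ e ∈ D, crossV e)

/-- The energy of a set of edges of `G₁`. -/
noncomputable def energy {k ℓ : ℕ} (ν : TorusEdge k ℓ → ℝ) (D : Finset (TorusEdge k ℓ)) : ℝ :=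
  ∑ e ∈ D, Real.log (ν e)

/-- The dimer covers of `G₁`. -/
def torusCovers (k ℓ : ℕ) : Set (Finset (TorusEdge k ℓ)) :=
  {D | IsDimerCover Set.univ (D : Set (TorusEdge k ℓ))}

/-- The set `𝒩` of all slopes of dimer covers of `G₁`. -/
def slopes (k ℓ : ℕ) : Set (ℤ × ℤ) := slope '' torusCovers k ℓ

/-- The tropical surface tension `ℰ*(μ)`, for `μ ∈ 𝒩`: the maximal energy of a dimer cover of `G₁`
with slope `μ` (a supremum over a finite nonempty set). -/
noncomputable def surfaceTension {k ℓ : ℕ} (ν : TorusEdge k ℓ → ℝ) (μ : ℤ × ℤ) : ℝ :=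
  sSup (energy ν '' {D | D ∈ torusCovers k ℓ ∧ slope D = μ})

/-- Strict concavity of `ℰ*` at `μ`.  Only slopes `μ_i ≠ μ` enter, since the combinations with all
`μ_i` equal to `μ` always give an equality. -/
def StrictlyConcaveAt {k ℓ : ℕ} (ν : TorusEdge k ℓ → ℝ) (μ : ℤ × ℤ) : Prop :=
  ∀ (n : ℕ) (t : Fin n → ℝ) (m : Fin n → ℤ × ℤ),
    (∀ i, t i ∈ Set.Ioo (0 : ℝ) 1) → (∀ i, m i ∈ slopes k ℓ ∧ m i ≠ μ) → ∑ i, t i = 1 →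
    ∑ i, t i * ((m i).1 : ℝ) = μ.1 → ∑ i, t i * ((m i).2 : ℝ) = μ.2 →
    ∑ i, t i * surfaceTension ν (m i) < surfaceTension ν μ

/-- The affine function `μ₁ x + μ₂ y + ℰ*(μ)`. -/
noncomputable def tropicalMonomial {k ℓ : ℕ} (ν : TorusEdge k ℓ → ℝ) (μ : ℤ × ℤ) (q : ℝ × ℝ) : ℝ :=
  μ.1 * q.1 + μ.2 * q.2 + surfaceTension ν μ

/-- The tropical characteristic polynomial `P_t` (a maximum over the finite nonempty set `𝒩`). -/
noncomputable def tropicalPolynomial {k ℓ : ℕ} (ν : TorusEdge k ℓ → ℝ) (q : ℝ × ℝ) : ℝ :=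
  sSup ((fun μ => tropicalMonomial ν μ q) '' slopes k ℓ)

/-- The tropical curve `𝒜_t`: the points where the maximum defining `P_t` is not uniquely
attained. -/
def tropicalCurve {k ℓ : ℕ} (ν : TorusEdge k ℓ → ℝ) : Set (ℝ × ℝ) :=
  {q | ∃ μ ∈ slopes k ℓ, ∃ μ' ∈ slopes k ℓ, μ ≠ μ' ∧
    tropicalMonomial ν μ q = tropicalPolynomial ν q ∧
    tropicalMonomial ν μ' q = tropicalPolynomial ν q}

/-- The component of the complement of `𝒜_t` that corresponds to the slope `μ`, that is, the
interior of the boundary curve `𝒜_{t,μ}`. -/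
def componentInterior {k ℓ : ℕ} (ν : TorusEdge k ℓ → ℝ) (μ : ℤ × ℤ) : Set (ℝ × ℝ) :=
  {q | q ∉ tropicalCurve ν ∧ tropicalMonomial ν μ q = tropicalPolynomial ν q}

/-- `D` is a maximizer with slope `μ`. -/
def IsMaximizer {k ℓ : ℕ} (ν : TorusEdge k ℓ → ℝ) (μ : ℤ × ℤ) (D : Finset (TorusEdge k ℓ)) : Prop :=
  D ∈ torusCovers k ℓ ∧ slope D = μ ∧ energy ν D = surfaceTension ν μ

/-- The edge set `E_{1,μ}` of `G_{1,μ}`: the edges of `G₁` in at least one maximizer with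
slope `μ`. -/
def maximizerEdges {k ℓ : ℕ} (ν : TorusEdge k ℓ → ℝ) (μ : ℤ × ℤ) : Set (TorusEdge k ℓ) :=
  {e | ∃ D, IsMaximizer ν μ D ∧ e ∈ D}

/-- The edge set `E_μ` of `G_μ`, the periodic lift of `G_{1,μ}` to the plane. -/
def liftedMaximizerEdges {k ℓ : ℕ} (ν : TorusEdge k ℓ → ℝ) (μ : ℤ × ℤ) : Set LatticeEdge :=
  {e | proj k ℓ e ∈ maximizerEdges ν μ}

/-- The weights `ν(e)^β`. -/
noncomputable def boltzmannWeight {k ℓ : ℕ} (ν : TorusEdge k ℓ → ℝ) (β : ℝ) (e : TorusEdge k ℓ) :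
    ℝ :=
  ν e ^ β

/-- The uniform weights on a set of edges of `G₁`, extended by `0`. -/
noncomputable def uniformWeight {k ℓ : ℕ} (S : Set (TorusEdge k ℓ)) (e : TorusEdge k ℓ) : ℝ :=
  S.indicator 1 e

/-- The Kasteleyn matrix on the plane, for weights `c` on `G₁` extended periodically; rows are white
vertices and columns are black vertices (there is at most one nonzero summand). -/
noncomputable def kasteleynPlane {k ℓ : ℕ} (c : TorusEdge k ℓ → ℝ) (w b : ℤ × ℤ) : ℂ :=
  ∑ d : Dir, if Edge.black ((w, d) : LatticeEdge) = b then
    (c (proj k ℓ (w, d)) : ℂ) * d.sign else 0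

/-- The magnetically altered Kasteleyn matrix on the torus; rows are white vertices and columns are
black vertices, and an entry is summed over all edges of `G₁` joining the two vertices. -/
noncomputable def kasteleynTorus {k ℓ : ℕ} (c : TorusEdge k ℓ → ℝ) (z w : ℂ) :
    Matrix (ZMod ℓ × ZMod k) (ZMod ℓ × ZMod k) ℂ :=
  Matrix.of fun wh bl => ∑ d : Dir, if Edge.black ((wh, d) : TorusEdge k ℓ) = bl then
    (c (wh, d) : ℂ) * d.sign * w ^ crossV ((wh, d) : TorusEdge k ℓ) /
      z ^ crossU ((wh, d) : TorusEdge k ℓ) else 0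

/-- The inverse Kasteleyn matrix on the plane, given by a double contour integral over `|z| = r`,
`|w| = s`.  A vertex with label `(ℓ m + i, k n + j)`, `0 ≤ i < ℓ`, `0 ≤ j < k`, lies in the cell
`(m, n)`. -/
noncomputable def inverseKasteleyn {k ℓ : ℕ} [NeZero k] [NeZero ℓ] (c : TorusEdge k ℓ → ℝ)
    (r s : ℝ) (b w : ℤ × ℤ) : ℂ :=
  1 / (2 * (Real.pi : ℂ) * Complex.I) ^ 2 *
    ∮ ζ in C(0, r), ∮ ω in C(0, s),
      (kasteleynTorus c ζ ω)⁻¹ ((b.1 : ZMod ℓ), (b.2 : ZMod k)) ((w.1 : ZMod ℓ), (w.2 : ZMod k)) *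
        (ζ ^ (w.2 / (k : ℤ) - b.2 / (k : ℤ)) / ω ^ (w.1 / (ℓ : ℤ) - b.1 / (ℓ : ℤ))) / ω / ζ

/-- The dimer covers of the subgraph of `G` with edge set `E`, with the `σ`-algebra generated by
the events that a given edge is covered. -/
abbrev DimerCover (E : Set LatticeEdge) : Type := {D : Set LatticeEdge // IsDimerCover E D}

/-- The event that all the edges `e_1, …, e_p` are covered. -/
def covered {E : Set LatticeEdge} {p : ℕ} (e : Fin p → LatticeEdge) : Set (DimerCover E) :=
  {D | ∀ s, e s ∈ D.1}

/-- `P` is a probability measure on the dimer covers of `(G, E)` whose correlation functions of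
pairwise distinct edges are the determinants built from `K` and `Kinv`. -/
def IsDeterminantal (E : Set LatticeEdge) (K Kinv : ℤ × ℤ → ℤ × ℤ → ℂ)
    (P : MeasureTheory.Measure (DimerCover E)) : Prop :=
  MeasureTheory.IsProbabilityMeasure P ∧
    ∀ (p : ℕ) (e : Fin p → LatticeEdge), Function.Injective e → (∀ s, e s ∈ E) →
      ((P.real (covered e) : ℝ) : ℂ) =
        Matrix.det (Matrix.of fun s s' : Fin p =>
          K (Edge.white (e s')) (Edge.black (e s')) *
            Kinv (Edge.black (e s)) (Edge.white (e s')))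

/-- `P` is the Gibbs measure `ℙ_{β,(x,y)}` on dimer covers of `G`. -/
def IsGibbsMeasure {k ℓ : ℕ} [NeZero k] [NeZero ℓ] (ν : TorusEdge k ℓ → ℝ) (β : ℝ) (q : ℝ × ℝ)
    (P : MeasureTheory.Measure (DimerCover Set.univ)) : Prop :=
  IsDeterminantal Set.univ (kasteleynPlane (boltzmannWeight ν β))
    (inverseKasteleyn (boltzmannWeight ν β) (Real.exp (β * q.1)) (Real.exp (β * q.2))) P

/-- `P` is the zero-temperature measure `ℙ_μ` on dimer covers of `G_μ`. -/
def IsZeroTemperatureMeasure {k ℓ : ℕ} [NeZero k] [NeZero ℓ] (ν : TorusEdge k ℓ → ℝ) (μ : ℤ × ℤ)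
    (P : MeasureTheory.Measure (DimerCover (liftedMaximizerEdges ν μ))) : Prop :=
  IsDeterminantal (liftedMaximizerEdges ν μ)
    (kasteleynPlane (uniformWeight (maximizerEdges ν μ)))
    (inverseKasteleyn (uniformWeight (maximizerEdges ν μ)) 1 1) P

end TropicalDimer

open TropicalDimer

/-!
The zero-temperature limit is a statement about a change of gauge.

For a point `q` of the component of the complement of the tropical curve with slope `μ`, the dimer
covers of the torus that maximize energy plus slope paired with `q` are exactly the maximizers of
slope `μ`. Finding a cover of maximal weight is an assignment problem, and linear programming duality
with strict complementarity (`exists_strict_potential`, obtained from Birkhoff's theorem and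
shortest walks) gives potentials on the vertices which dominate the weights of all edges and are tight
exactly on the edges of maximizers (`exists_potential_tight_iff`). Multiplying the rows and columns
of the Kasteleyn matrix by exponentials of these potentials, and moving the contours to the unit
torus, changes no correlation (`edgeDet_gauge`), and turns the Boltzmann weights into weights that
converge exponentially fast to the indicator function of the edges of maximizers
(`exists_isBigO_gaugedWeight_sub`). The correlations are Lipschitz in the weights wherever the
Kasteleyn determinant has no zeros on the unit torus (`isBigO_edgeDet_sub`). At the limiting weights
it has none: every dimer cover by tight edges has slope `μ`, and by the Kasteleyn sign rule
(`sign_mul_prod_sign`, `det_kasteleynTorus`) the sign of a term of the determinant depends only on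
its slope, so that the determinant is a monomial with a nonzero coefficient
(`det_kasteleynTorus_uniformWeight_ne_zero`).

This needs a point `q`. Strict concavity at `μ` says that the point of the graph of the surface
tension over `μ` lies strictly above the convex hull of the other points, and a separating plane,
tilted slightly if it is vertical, is such a point
(`StrictlyConcaveAt.nonempty_componentInterior`).

The measures themselves exist whenever the weights are nonnegative and the Kasteleyn determinant
does not vanish on the unit torus (`exists_isDeterminantal`). On the torus with periods multiplied by
an even number, the partition function restricted to given edges is a signed combination of four
Kasteleyn determinants, with periodic and antiperiodic boundary conditions. Each ratio of determinants
is a small determinant of a Green function that is a Riemann sum for the contour integral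
(`inv_kasteleynTorus_cover`, `tendsto_discreteGreen`), so all four have the same limit. The
Boltzmann measures on growing tori then converge on the compact space of configurations
(`exists_measure_of_tendsto`). A measure is determined by its correlations, as the cylinder events
form a π-system (`measure_ext_of_covered`).
-/

namespace TropicalDimer

open Finset

/-! ### Inversions of a permutation modulo two -/

section Inversions

variable {V : Type*} [Fintype V] {N : ℕ}

/-- The number of inversions modulo 2 of a permutation, counted on the pairs in `S × T` with
respect to the linear order carried over from `Fin N`. -/
def inversionParity (E : V ≃ Fin N) (π : Equiv.Perm V) (S T : Finset V) : ZMod 2 :=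
  ∑ u ∈ S, ∑ v ∈ T, if E u < E v ∧ E (π v) < E (π u) then 1 else 0

theorem neg_one_pow_eq_of_cast_eq {R : Type*} [Monoid R] [HasDistribNeg R] {m n : ℕ}
    (h : (m : ZMod 2) = n) : (-1 : R) ^ m = (-1) ^ n := by
  refine neg_one_pow_congr ?_
  rw [even_iff_two_dvd, even_iff_two_dvd, ← ZMod.natCast_eq_zero_iff, ← ZMod.natCast_eq_zero_iff, h]

theorem sign_eq_of_inversionParity [DecidableEq V] (E : V ≃ Fin N) (π : Equiv.Perm V) {n : ℕ}
    (h : inversionParity E π univ univ = n) : Equiv.Perm.sign π = (-1) ^ n := by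
  rw [← Equiv.Perm.sign_permCongr E π, Equiv.Perm.sign_eq_prod_prod_Ioi]
  have h1 : ∀ i : Fin N, ∏ j ∈ Ioi i, (if (E.permCongr π) i < (E.permCongr π) j then (1 : ℤˣ)
      else -1) = ∏ j : Fin N, if i < j ∧ (E.permCongr π) j < (E.permCongr π) i then -1 else 1 := by
    intro i
    rw [← Finset.prod_filter_mul_prod_filter_not univ (fun j => i < j)]
    rw [show (univ.filter fun j => i < j) = Ioi i by ext; simp]
    rw [Finset.prod_congr rfl (g := fun j => if i < j ∧ (E.permCongr π) j < (E.permCongr π) i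
      then (-1 : ℤˣ) else 1)]
    · rw [Finset.prod_eq_one (s := univ.filter fun j => ¬ i < j), mul_one]
      intro j hj
      rw [if_neg]
      simp at hj
      intro h
      exact absurd h.1 (not_lt.mpr hj)
    · intro j hj
      have hij : i < j := by simpa using hj
      have hne : (E.permCongr π) i ≠ (E.permCongr π) j := fun h => hij.ne ((E.permCongr π).injective h)
      by_cases hlt : (E.permCongr π) i < (E.permCongr π) j
      · rw [if_pos hlt, if_neg (fun h => lt_asymm hlt h.2)]
      · rw [if_neg hlt, if_pos ⟨hij, lt_of_le_of_ne (not_lt.mp hlt) hne.symm⟩]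
  simp_rw [h1]
  rw [← Finset.prod_product', Finset.prod_ite]
  simp only [prod_const, one_pow, mul_one]
  apply neg_one_pow_eq_of_cast_eq
  rw [← h, inversionParity, ← Finset.sum_product']
  rw [← Finset.sum_boole]
  refine (Fintype.sum_equiv (E.prodCongr E) _ _ ?_).symm
  rintro ⟨u, v⟩
  simp [Equiv.permCongr_apply]

theorem sum_lt_eq (E : V ≃ Fin N) (u : V) :
    (∑ v : V, if E u < E v then (1 : ZMod 2) else 0) = N + 1 + (E u : ℕ) := by
  rw [Fintype.sum_equiv E _ (fun j => if E u < j then (1 : ZMod 2) else 0) (fun _ => rfl)]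
  rw [Finset.sum_boole, show (univ.filter fun j => E u < j) = Ioi (E u) by ext; simp, Fin.card_Ioi]
  have h := (E u).2
  have : (N : ZMod 2) = ((N - 1 - (E u : ℕ) : ℕ) : ZMod 2) + 1 + ((E u : ℕ) : ZMod 2) := by
    have : N = (N - 1 - (E u : ℕ)) + 1 + (E u : ℕ) := by omega
    conv_lhs => rw [this]
    push_cast
    rfl
  rw [this]
  generalize ((N - 1 - (E u : ℕ) : ℕ) : ZMod 2) = a
  generalize ((E u : ℕ) : ZMod 2) = b
  revert a b; decide

/-- Inversions between a set and its complement can be read off from the total displacement of the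
set: this is what makes the sign of a permutation computable from local data. -/
theorem inversionParity_compl [DecidableEq V] (E : V ≃ Fin N) (π : Equiv.Perm V) (R : Finset V) :
    inversionParity E π R Rᶜ + inversionParity E π Rᶜ R =
      ∑ u ∈ R, (((E u : ℕ) : ZMod 2) + ((E (π u) : ℕ) : ZMod 2)) := by
  have key : ∀ u v : V, (if E u < E v ∧ E (π v) < E (π u) then (1 : ZMod 2) else 0) +
      (if E v < E u ∧ E (π u) < E (π v) then (1 : ZMod 2) else 0) =
      (if E u < E v then 1 else 0) + (if E (π u) < E (π v) then 1 else 0) := by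
    intro u v
    by_cases huv : u = v
    · subst huv; simp
    have h1 : E u ≠ E v := fun h => huv (E.injective h)
    have h2 : E (π u) ≠ E (π v) := fun h => huv (π.injective (E.injective h))
    rcases lt_or_gt_of_ne h1 with h1 | h1 <;> rcases lt_or_gt_of_ne h2 with h2 | h2 <;>
      simp [h1, h2, h1.not_gt, h2.not_gt] <;> decide
  have e1 : inversionParity E π R Rᶜ + inversionParity E π Rᶜ R =
      ∑ u ∈ R, ∑ v ∈ Rᶜ, ((if E u < E v then (1 : ZMod 2) else 0) +
        (if E (π u) < E (π v) then 1 else 0)) := by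
    unfold inversionParity
    rw [Finset.sum_comm (s := Rᶜ), ← Finset.sum_add_distrib]
    refine Finset.sum_congr rfl fun u _ => ?_
    rw [← Finset.sum_add_distrib]
    exact Finset.sum_congr rfl fun v _ => key u v
  have e2 : ∑ u ∈ R, ∑ v ∈ R, ((if E u < E v then (1 : ZMod 2) else 0) +
        (if E (π u) < E (π v) then 1 else 0)) = 0 := by
    rw [← Finset.sum_product']
    refine Finset.sum_involution (fun p _ => (p.2, p.1)) ?_ ?_ ?_ ?_
    · rintro ⟨u, v⟩ -
      have h := key u v
      have h' := key v u
      rw [add_comm] at h'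
      simp only
      rw [← h, ← h', CharTwo.add_self_eq_zero]
    · rintro ⟨u, v⟩ - hne heq
      simp only [Prod.mk.injEq] at heq
      simp [heq.1] at hne
    · rintro ⟨u, v⟩ h
      simpa [and_comm] using h
    · simp
  rw [e1]
  refine (zero_add _).symm.trans ?_
  refine (congrArg (· + _) e2.symm).trans ?_
  rw [← Finset.sum_add_distrib]
  refine Finset.sum_congr rfl fun u _ => ?_
  rw [Finset.sum_add_sum_compl, Finset.sum_add_distrib, sum_lt_eq,
    Equiv.sum_comp π (fun v => if E (π u) < E v then (1 : ZMod 2) else 0), sum_lt_eq]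
  generalize ((E u : ℕ) : ZMod 2) = a
  generalize ((E (π u) : ℕ) : ZMod 2) = b
  generalize (N : ZMod 2) = c
  revert a b c; decide

/-- The sign of a permutation from the inversions within `R` and within its complement, and the
displacement of `R`. It is applied with `R` the horizontal steps of a dimer cover: two horizontal
steps, or two steps that are not, are inverted only when one of them wraps around the torus. -/
theorem inversionParity_univ [DecidableEq V] (E : V ≃ Fin N) (π : Equiv.Perm V) (R : Finset V) :
    inversionParity E π univ univ =
      ∑ u ∈ R, (((E u : ℕ) : ZMod 2) + ((E (π u) : ℕ) : ZMod 2)) +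
        (inversionParity E π R R + inversionParity E π Rᶜ Rᶜ) := by
  rw [← inversionParity_compl]
  unfold inversionParity
  have : ∀ u, (∑ v, if E u < E v ∧ E (π v) < E (π u) then (1 : ZMod 2) else 0) =
    (∑ v ∈ R, if E u < E v ∧ E (π v) < E (π u) then (1 : ZMod 2) else 0) +
    (∑ v ∈ Rᶜ, if E u < E v ∧ E (π v) < E (π u) then (1 : ZMod 2) else 0) :=
    fun u => (Finset.sum_add_sum_compl R _).symm
  simp_rw [this]
  rw [← Finset.sum_add_sum_compl R, Finset.sum_add_distrib, Finset.sum_add_distrib]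
  ring

end Inversions

/-! ### The Kasteleyn sign rule on the torus -/

section Sign

/-- Adding `1` to a residue wraps around exactly at `-1`. -/
theorem val_add_one_add {n : ℕ} [NeZero n] (a : ZMod n) :
    (a + 1).val + (if a = -1 then n else 0) = a.val + 1 := by
  have hn : 0 < n := Nat.pos_of_ne_zero (NeZero.ne n)
  have ha := a.val_lt
  by_cases h : a.val + 1 < n
  · have h1 : (a + 1).val = a.val + 1 := by
      have : a + 1 = ((a.val + 1 : ℕ) : ZMod n) := by simp
      rw [this, ZMod.val_natCast_of_lt h]
    rw [if_neg, h1, add_zero]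
    rintro rfl
    simp at h1
  · have h2 : a.val + 1 = n := by omega
    have h3 : a + 1 = 0 := by
      have : a + 1 = ((a.val + 1 : ℕ) : ZMod n) := by simp
      rw [this, h2, ZMod.natCast_self]
    rw [if_pos (eq_neg_of_add_eq_zero_left h3), h3, ZMod.val_zero, h2, zero_add]

theorem val_le_val_neg_one {n : ℕ} [NeZero n] (a : ZMod n) : a.val ≤ (-1 : ZMod n).val := by
  have h := val_add_one_add (-1 : ZMod n)
  have ha := a.val_lt
  simp at h
  omega

/-- The residues modulo `n` as `Fin n`, in the order of their least nonnegative representatives. -/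
def zmodEquivFin (n : ℕ) [NeZero n] : ZMod n ≃ Fin n where
  toFun a := ⟨a.val, a.val_lt⟩
  invFun i := (i.val : ZMod n)
  left_inv a := by simp
  right_inv i := by ext; simp [ZMod.val_cast_of_lt i.2]

variable {k ℓ : ℕ} [NeZero k] [NeZero ℓ]

/-- The lexicographic enumeration of the vertices of the torus. -/
def torusEnum (k ℓ : ℕ) [NeZero k] [NeZero ℓ] : ZMod ℓ × ZMod k ≃ Fin (ℓ * k) :=
  ((zmodEquivFin ℓ).prodCongr (zmodEquivFin k)).trans finProdFinEquiv

theorem torusEnum_val (v : ZMod ℓ × ZMod k) :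
    (torusEnum k ℓ v : ℕ) = v.2.val + k * v.1.val := rfl

theorem torusEnum_lt_iff (u v : ZMod ℓ × ZMod k) :
    torusEnum k ℓ u < torusEnum k ℓ v ↔
      u.1.val < v.1.val ∨ (u.1 = v.1 ∧ u.2.val < v.2.val) := by
  rw [Fin.lt_def, torusEnum_val, torusEnum_val]
  have hu := u.2.val_lt
  have hv := v.2.val_lt
  rcases lt_trichotomy u.1.val v.1.val with h | h | h
  · simp only [h, true_or, iff_true]
    nlinarith [Nat.mul_le_mul_left k (Nat.succ_le_of_lt h)]
  · have h' : u.1 = v.1 := ZMod.val_injective _ h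
    simp [h']
  · have h' : u.1 ≠ v.1 := fun e => by rw [e] at h; exact lt_irrefl _ h
    simp only [h.not_gt, h', false_and, or_self, iff_false, not_lt]
    nlinarith [Nat.mul_le_mul_left k (Nat.succ_le_of_lt h)]

/-- A common step `+ 1` reverses the order of two residues exactly when the larger one wraps. -/
theorem val_lt_and_add_one_lt_iff {n : ℕ} [NeZero n] {a b : ZMod n} (hab : a ≠ b) :
    (a.val < b.val ∧ (b + 1).val < (a + 1).val) ↔ b = -1 := by
  have h1 := val_add_one_add a
  have h2 := val_add_one_add b
  have h3 := val_le_val_neg_one a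
  have hne : a.val ≠ b.val := fun h => hab (ZMod.val_injective _ h)
  constructor
  · rintro ⟨h4, h5⟩
    by_contra hb
    rw [if_neg hb] at h2
    omega
  · rintro rfl
    rw [if_neg hab] at h1
    rw [neg_add_cancel, ZMod.val_zero]
    omega

/-- Steps of size at most one that do not collide reverse the order of two residues exactly when the
larger one wraps. -/
theorem val_lt_and_lt_iff {n : ℕ} [NeZero n] {a b : ZMod n} (p q : Prop) [Decidable p] [Decidable q]
    (hab : a ≠ b) (hpq : a + (if p then 1 else 0) ≠ b + (if q then 1 else 0)) :
    (a.val < b.val ∧ (b + (if q then 1 else 0)).val < (a + (if p then 1 else 0)).val) ↔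
      b = -1 ∧ q := by
  have h1 := val_add_one_add a
  have h2 := val_add_one_add b
  have h3 := val_le_val_neg_one a
  have hne : a.val ≠ b.val := fun h => hab (ZMod.val_injective _ h)
  by_cases hq : q
  · by_cases hp : p
    · simpa [hq, hp] using val_lt_and_add_one_lt_iff hab
    · simp only [hp, hq, if_true, if_false, add_zero, and_true] at hpq ⊢
      constructor
      · rintro ⟨h4, h5⟩
        by_contra hb
        rw [if_neg hb] at h2
        omega
      · rintro rfl
        rw [neg_add_cancel] at hpq ⊢
        have : a.val ≠ 0 := fun h => hpq ((ZMod.val_eq_zero a).mp h)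
        rw [ZMod.val_zero]
        omega
  · simp only [hq, if_false, add_zero, and_false, iff_false, not_and, not_lt]
    intro h4
    by_cases hp : p
    · simp only [hp, if_true]
      split_ifs at h1 <;> omega
    · simp only [hp, if_false, add_zero]
      omega

/-- `d` moves its black endpoint to the next column. -/
def Dir.IsHorizontal (d : Dir) : Prop := d = Dir.north ∨ d = Dir.east

/-- `d` moves its black endpoint to the next row. -/
def Dir.IsVertical (d : Dir) : Prop := d = Dir.south ∨ d = Dir.east

instance : DecidablePred Dir.IsHorizontal := fun d => by unfold Dir.IsHorizontal; infer_instance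
instance : DecidablePred Dir.IsVertical := fun d => by unfold Dir.IsVertical; infer_instance

theorem Dir.shift_eq {X Y : Type} [Zero X] [One X] [Zero Y] [One Y] (d : Dir) :
    (d.shift : X × Y) = (if d.IsHorizontal then 1 else 0, if d.IsVertical then 1 else 0) := by
  cases d <;> simp [Dir.shift, Dir.IsHorizontal, Dir.IsVertical]

variable {π : Equiv.Perm (ZMod ℓ × ZMod k)} {d : ZMod ℓ × ZMod k → Dir}

/-- Flux conservation: the number of horizontal steps out of a column does not depend on the
column. -/
theorem card_horizontal_column (hπ : ∀ v, π v = v + (d v).shift) (x : ZMod ℓ) :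
    #{v | (d v).IsHorizontal ∧ v.1 = x} = #{v | (d v).IsHorizontal ∧ v.1 = -1} := by
  have step : ∀ x : ZMod ℓ, #{v | (d v).IsHorizontal ∧ v.1 = x + 1} =
      #{v | (d v).IsHorizontal ∧ v.1 = x} := by
    intro x
    have e1 : #{v : ZMod ℓ × ZMod k | v.1 = x + 1} = #{v : ZMod ℓ × ZMod k | (π v).1 = x + 1} := by
      refine (Finset.card_bij (fun v _ => π v) ?_ ?_ ?_).symm
      · intro v hv; simpa using hv
      · intro u _ v _ h; exact π.injective h
      · intro v hv; exact ⟨π.symm v, by simpa using hv, by simp⟩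
    have e2 : #{v : ZMod ℓ × ZMod k | (π v).1 = x + 1} =
        #{v | (d v).IsHorizontal ∧ v.1 = x} + #{v | ¬ (d v).IsHorizontal ∧ v.1 = x + 1} := by
      rw [← Finset.card_filter_add_card_filter_not (fun v => (d v).IsHorizontal)]
      congr 2
      · ext v
        simp only [hπ, Dir.shift_eq, mem_filter, mem_univ, true_and, Prod.fst_add]
        constructor
        · rintro ⟨h1, h2⟩; rw [if_pos h2] at h1; exact ⟨h2, add_right_cancel h1⟩
        · rintro ⟨h1, h2⟩; rw [if_pos h1, h2]; exact ⟨rfl, h1⟩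
      · ext v
        simp only [hπ, Dir.shift_eq, mem_filter, mem_univ, true_and, Prod.fst_add]
        constructor
        · rintro ⟨h1, h2⟩; rw [if_neg h2, add_zero] at h1; exact ⟨h2, h1⟩
        · rintro ⟨h1, h2⟩; rw [if_neg h1, h2, add_zero]; exact ⟨rfl, h1⟩
    have e3 : #{v : ZMod ℓ × ZMod k | v.1 = x + 1} =
        #{v | (d v).IsHorizontal ∧ v.1 = x + 1} + #{v | ¬ (d v).IsHorizontal ∧ v.1 = x + 1} := by
      rw [← Finset.card_filter_add_card_filter_not (fun v => (d v).IsHorizontal)]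
      simp only [Finset.filter_filter, and_comm]
    omega
  have all : ∀ n : ℕ, #{v | (d v).IsHorizontal ∧ v.1 = -1 + (n : ZMod ℓ)} =
      #{v | (d v).IsHorizontal ∧ v.1 = -1} := by
    intro n
    induction n with
    | zero => simp
    | succ n ih => rw [← ih, Nat.cast_succ, ← add_assoc, step]
  have := all (x + 1).val
  simpa using this

/-- Two horizontal steps are inverted either within a column, by a step that wraps vertically, or
between columns, by a step that wraps horizontally. -/
theorem horizontal_inversion_iff (hπ : ∀ v, π v = v + (d v).shift) {u v : ZMod ℓ × ZMod k}
    (hu : (d u).IsHorizontal) (hv : (d v).IsHorizontal) :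
    (torusEnum k ℓ u < torusEnum k ℓ v ∧ torusEnum k ℓ (π v) < torusEnum k ℓ (π u)) ↔
      (u.1 = v.1 ∧ u ≠ v ∧ v.2 = -1 ∧ (d v).IsVertical) ∨ (u.1 ≠ -1 ∧ v.1 = -1) := by
  by_cases huv : u = v
  · subst huv; simp
  have hne := fun h => huv (π.injective h)
  rw [torusEnum_lt_iff, torusEnum_lt_iff]
  rw [hπ, hπ, Dir.shift_eq, Dir.shift_eq, if_pos hu, if_pos hv] at hne ⊢
  by_cases h1 : u.1 = v.1
  · have h2 : u.2 ≠ v.2 := fun h => huv (Prod.ext h1 h)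
    simp only [Prod.fst_add, Prod.snd_add, h1, lt_irrefl, true_and, false_or, ne_eq, huv,
      not_false_eq_true]
    rw [val_lt_and_lt_iff _ _ h2 (fun h => hne (Prod.ext (by simp [h1]) (by simpa using h)))]
    tauto
  · simp only [Prod.fst_add, h1, false_and, or_false, add_left_inj, false_or]
    rw [show (v.1 = u.1) ↔ False from ⟨fun h => h1 h.symm, False.elim⟩]
    simp only [false_and, or_false]
    rw [val_lt_and_add_one_lt_iff h1]
    exact ⟨fun h => ⟨fun h' => h1 (h'.trans h.symm), h⟩, fun h => h.2⟩

/-- Two steps that are not horizontal are inverted only within a column, by a step that wraps. -/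
theorem not_horizontal_inversion_iff (hπ : ∀ v, π v = v + (d v).shift) {u v : ZMod ℓ × ZMod k}
    (hu : ¬ (d u).IsHorizontal) (hv : ¬ (d v).IsHorizontal) :
    (torusEnum k ℓ u < torusEnum k ℓ v ∧ torusEnum k ℓ (π v) < torusEnum k ℓ (π u)) ↔
      (u.1 = v.1 ∧ u ≠ v ∧ v.2 = -1 ∧ (d v).IsVertical) := by
  by_cases huv : u = v
  · subst huv; simp
  have hne := fun h => huv (π.injective h)
  rw [torusEnum_lt_iff, torusEnum_lt_iff]
  rw [hπ, hπ, Dir.shift_eq, Dir.shift_eq, if_neg hu, if_neg hv] at hne ⊢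
  by_cases h1 : u.1 = v.1
  · have h2 : u.2 ≠ v.2 := fun h => huv (Prod.ext h1 h)
    simp only [Prod.fst_add, Prod.snd_add, h1, lt_irrefl, true_and, false_or, ne_eq, huv,
      not_false_eq_true]
    rw [val_lt_and_lt_iff _ _ h2 (fun h => hne (Prod.ext (by simp [h1]) (by simpa using h)))]
  · simp only [Prod.fst_add, add_zero, h1, false_and, or_false, iff_false, not_and]
    rw [show (v.1 = u.1) ↔ False from ⟨fun h => h1 h.symm, False.elim⟩]
    simp only [false_and, or_false]
    omega

omit [NeZero k] [NeZero ℓ] in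
theorem crossU_eq (v : ZMod ℓ × ZMod k) (d : Dir) :
    crossU (v, d) = if v.2 = -1 ∧ d.IsVertical then 1 else 0 := rfl

omit [NeZero k] [NeZero ℓ] in
theorem crossV_eq (v : ZMod ℓ × ZMod k) (d : Dir) :
    crossV (v, d) = if v.1 = -1 ∧ d.IsHorizontal then 1 else 0 := rfl

theorem sum_crossV (d : ZMod ℓ × ZMod k → Dir) :
    ∑ v, crossV (v, d v) = (#{v | (d v).IsHorizontal ∧ v.1 = -1} : ℕ) := by
  simp [crossV_eq, Finset.sum_boole, and_comm]

theorem sum_crossU (d : ZMod ℓ × ZMod k → Dir) :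
    ∑ v, crossU (v, d v) = (#{v | (d v).IsHorizontal ∧ v.2 = -1 ∧ (d v).IsVertical} : ℕ) +
      (#{v | ¬ (d v).IsHorizontal ∧ v.2 = -1 ∧ (d v).IsVertical} : ℕ) := by
  simp only [crossU_eq, Finset.sum_boole]
  rw [← Finset.card_filter_add_card_filter_not (fun v => (d v).IsHorizontal)]
  simp [Finset.filter_filter, and_comm]

theorem card_horizontal (hπ : ∀ v, π v = v + (d v).shift) :
    #{v | (d v).IsHorizontal} = ℓ * #{v | (d v).IsHorizontal ∧ v.1 = -1} := by
  rw [Finset.card_eq_sum_card_fiberwise (f := Prod.fst) (t := (univ : Finset (ZMod ℓ)))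
    (fun _ _ => by simp)]
  simp only [Finset.filter_filter, card_horizontal_column hπ, sum_const, card_univ, ZMod.card,
    smul_eq_mul]

omit [NeZero k] [NeZero ℓ] in
/-- Sum over pairs in a class all of whose columns have `r` elements, where the inner sum counts
the other elements of the column of each `v` with property `p`. -/
theorem sum_sum_same_column (S : Finset (ZMod ℓ × ZMod k)) (r : ℕ)
    (hr : ∀ x, #{v ∈ S | v.1 = x} = r) (p : ZMod ℓ × ZMod k → Prop) [DecidablePred p] :
    (∑ u ∈ S, ∑ v ∈ S, if u.1 = v.1 ∧ u ≠ v ∧ p v then (1 : ZMod 2) else 0) =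
      (r + 1) * #{v ∈ S | p v} := by
  rw [Finset.sum_comm]
  have : ∀ v ∈ S, (∑ u ∈ S, if u.1 = v.1 ∧ u ≠ v ∧ p v then (1 : ZMod 2) else 0) =
      (r + 1) * if p v then 1 else 0 := by
    intro v hv
    by_cases hp : p v
    · simp only [hp, and_true, if_true, mul_one, Finset.sum_boole]
      have h : #{u ∈ S | u.1 = v.1 ∧ u ≠ v} + 1 = r := by
        rw [← hr v.1, ← Finset.card_erase_add_one (s := {u ∈ S | u.1 = v.1}) (a := v) (by simp [hv])]
        congr 2
        ext u; simp; tauto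
      rw [← h]
      push_cast
      rw [add_assoc, CharTwo.add_self_eq_zero, add_zero]
    · simp [hp]
  rw [Finset.sum_congr rfl this, ← Finset.mul_sum, Finset.sum_boole]

theorem prod_sign_eq (d : ZMod ℓ × ZMod k → Dir) :
    ∏ v, (d v).sign = (-1) ^ #{v | d v = Dir.north} := by
  have : ∀ v, (d v).sign = if d v = Dir.north then -1 else 1 := by
    intro v; cases d v <;> simp [Dir.sign]
  simp_rw [this]
  rw [Finset.prod_ite]
  simp

/-- The enumeration of the black endpoint of a horizontal edge, modulo 2. -/
theorem torusEnum_add_torusEnum (hπ : ∀ v, π v = v + (d v).shift) {u : ZMod ℓ × ZMod k}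
    (hu : (d u).IsHorizontal) :
    (((torusEnum k ℓ u : ℕ) : ZMod 2) + ((torusEnum k ℓ (π u) : ℕ) : ZMod 2)) =
      k + k * ℓ * (if u.1 = -1 then 1 else 0) + (if d u = Dir.east then 1 else 0) +
        k * (if u.2 = -1 ∧ (d u).IsVertical then 1 else 0) := by
  rw [torusEnum_val, torusEnum_val, hπ, Dir.shift_eq, if_pos hu]
  simp only [Prod.fst_add, Prod.snd_add]
  have h1 := congrArg (Nat.cast : ℕ → ZMod 2) (val_add_one_add u.1)
  have h2 := congrArg (Nat.cast : ℕ → ZMod 2) (val_add_one_add u.2)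
  have h3 : (d u).IsVertical ↔ d u = Dir.east := by
    rcases hu with h | h <;> simp [h, Dir.IsVertical]
  have h4 : ∀ a b c : ZMod 2, a + b = c → a = c + b := by decide
  push_cast at h1 h2 ⊢
  rw [h4 _ _ _ h1]
  simp only [h3]
  by_cases hd : d u = Dir.east
  · simp only [hd, if_true, and_true]
    rw [h4 _ _ _ h2]
    split_ifs <;> generalize (u.1.val : ZMod 2) = a <;> generalize (u.2.val : ZMod 2) = b <;>
      generalize (k : ZMod 2) = c <;> generalize (ℓ : ZMod 2) = e <;> revert a b c e <;> decide
  · simp only [hd, if_false, and_false, add_zero, mul_zero]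
    split_ifs <;> generalize (u.1.val : ZMod 2) = a <;> generalize (u.2.val : ZMod 2) = b <;>
      generalize (k : ZMod 2) = c <;> generalize (ℓ : ZMod 2) = e <;> revert a b c e <;> decide

/-- **Kasteleyn's sign rule on the torus.**  The product of the sign of the permutation defined by
a dimer cover and of the Kasteleyn signs of its edges depends only on the slope of the cover
modulo 2. -/
theorem sign_mul_prod_sign (hπ : ∀ v, π v = v + (d v).shift) (n : ℕ)
    (hn : (n : ZMod 2) = (∑ v, crossV (v, d v) : ℤ) + (∑ v, crossU (v, d v) : ℤ) +
      (∑ v, crossV (v, d v) : ℤ) * (∑ v, crossU (v, d v) : ℤ) +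
        k * (∑ v, crossU (v, d v) : ℤ)) :
    ((Equiv.Perm.sign π : ℤ) : ℂ) * ∏ v, (d v).sign = (-1) ^ n := by
  rw [sum_crossV, sum_crossU] at hn
  -- `r` and `wR + wT` are the two crossing numbers, where `wR` counts the vertical crossings by
  -- horizontal steps (the set `R`) and `wT` those by the other steps.
  set r := #{v | (d v).IsHorizontal ∧ v.1 = -1} with hr
  set wR := #{v | (d v).IsHorizontal ∧ v.2 = -1 ∧ (d v).IsVertical} with hwR
  set wT := #{v | ¬ (d v).IsHorizontal ∧ v.2 = -1 ∧ (d v).IsVertical} with hwT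
  set R : Finset (ZMod ℓ × ZMod k) := {v | (d v).IsHorizontal} with hR
  have hRc : Rᶜ = ({v | ¬ (d v).IsHorizontal} : Finset (ZMod ℓ × ZMod k)) := by
    ext v; simp [hR]
  have hcol : ∀ x, #{v ∈ R | v.1 = x} = r := fun x => by
    rw [hR, Finset.filter_filter]; exact card_horizontal_column hπ x
  have hcolc : ∀ x, #{v ∈ Rᶜ | v.1 = x} = k - r := fun x => by
    have h := Finset.card_filter_add_card_filter_not (s := ({v | v.1 = x} : Finset (ZMod ℓ × ZMod k)))
      (fun v => (d v).IsHorizontal)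
    have h2 : #({v | v.1 = x} : Finset (ZMod ℓ × ZMod k)) = k := by
      rw [show ({v | v.1 = x} : Finset (ZMod ℓ × ZMod k)) = {x} ×ˢ univ by ext; simp [-singleton_product]]
      simp [ZMod.card]
    rw [← hcol x, hRc, hR]
    simp only [Finset.filter_filter] at h ⊢
    simp only [and_comm] at h ⊢
    omega
  have hrk : r ≤ k := by
    rw [hr]
    calc _ ≤ #({(-1 : ZMod ℓ)} ×ˢ (univ : Finset (ZMod k))) :=
          Finset.card_le_card (fun v => by simp [-singleton_product])
      _ = k := by simp [ZMod.card]
  have hcard : #R = ℓ * r := card_horizontal hπ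
  have hE : #R = #{v | d v = Dir.north} + #{v | d v = Dir.east} := by
    rw [← Finset.card_union_of_disjoint, ← Finset.filter_or]
    · rfl
    · rw [Finset.disjoint_filter]; intro v _ h; simp [h]
  have e0 : ∑ u ∈ R, (((torusEnum k ℓ u : ℕ) : ZMod 2) + ((torusEnum k ℓ (π u) : ℕ) : ZMod 2)) =
      #R * k + k * ℓ * r + #{v | d v = Dir.east} + k * wR := by
    rw [Finset.sum_congr rfl fun u hu => torusEnum_add_torusEnum hπ (by simpa [hR] using hu)]
    rw [Finset.sum_add_distrib, Finset.sum_add_distrib, Finset.sum_add_distrib, Finset.sum_const,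
      ← Finset.mul_sum, ← Finset.mul_sum, Finset.sum_boole, Finset.sum_boole, Finset.sum_boole,
      hcol, nsmul_eq_mul, hwR, hR]
    simp only [Finset.filter_filter]
    congr 5
    ext v
    simp [Dir.IsHorizontal]
    tauto
  have e1 : inversionParity (torusEnum k ℓ) π R R = (r + 1) * wR + r * (ℓ * r + r) := by
    unfold inversionParity
    have h1 : ∀ u ∈ R, ∀ v ∈ R, (if torusEnum k ℓ u < torusEnum k ℓ v ∧
        torusEnum k ℓ (π v) < torusEnum k ℓ (π u) then (1 : ZMod 2) else 0) =
        (if u.1 = v.1 ∧ u ≠ v ∧ v.2 = -1 ∧ (d v).IsVertical then 1 else 0) +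
        (if ¬ u.1 = -1 then 1 else 0) * (if v.1 = -1 then 1 else 0) := by
      intro u hu v hv
      rw [if_congr (horizontal_inversion_iff hπ (by simpa [hR] using hu) (by simpa [hR] using hv))
        rfl rfl]
      by_cases h1 : u.1 = v.1
      · by_cases h2 : v.1 = -1 <;> simp [h1, h2]
      · by_cases h2 : v.1 = -1 <;> by_cases h3 : u.1 = -1 <;> simp [h1, h2, h3]
    rw [Finset.sum_congr rfl fun u hu => Finset.sum_congr rfl fun v hv => h1 u hu v hv]
    simp only [Finset.sum_add_distrib]
    rw [sum_sum_same_column R r hcol (fun v => v.2 = -1 ∧ (d v).IsVertical),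
      ← Finset.sum_mul_sum, Finset.sum_boole, Finset.sum_boole, hcol, hR,
      Finset.filter_filter, ← hwR, ← hR]
    have h2 := Finset.card_filter_add_card_filter_not (s := R) (fun v => v.1 = -1)
    rw [hcol, hcard] at h2
    have h3 := congrArg (Nat.cast : ℕ → ZMod 2) h2
    push_cast at h3
    rw [← h3]
    generalize (#{v ∈ R | ¬ v.1 = -1} : ZMod 2) = a
    generalize (r : ZMod 2) = b
    generalize (wR : ZMod 2) = c
    revert a b c; decide
  have e2 : inversionParity (torusEnum k ℓ) π Rᶜ Rᶜ = (k + r + 1) * wT := by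
    unfold inversionParity
    have h1 : ∀ u ∈ Rᶜ, ∀ v ∈ Rᶜ, (if torusEnum k ℓ u < torusEnum k ℓ v ∧
        torusEnum k ℓ (π v) < torusEnum k ℓ (π u) then (1 : ZMod 2) else 0) =
        (if u.1 = v.1 ∧ u ≠ v ∧ v.2 = -1 ∧ (d v).IsVertical then 1 else 0) := by
      intro u hu v hv
      rw [if_congr (not_horizontal_inversion_iff hπ (by simpa [hR] using hu)
        (by simpa [hR] using hv)) rfl rfl]
    rw [Finset.sum_congr rfl fun u hu => Finset.sum_congr rfl fun v hv => h1 u hu v hv]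
    rw [sum_sum_same_column Rᶜ (k - r) hcolc (fun v => v.2 = -1 ∧ (d v).IsVertical), hRc,
      Finset.filter_filter, ← hwT]
    congr 2
    rw [Nat.cast_sub hrk, CharTwo.sub_eq_add]
  rw [prod_sign_eq]
  have hinv : inversionParity (torusEnum k ℓ) π univ univ =
      ((n + #{v | d v = Dir.north} : ℕ) : ZMod 2) := by
    rw [inversionParity_univ (torusEnum k ℓ) π R, e0, e1, e2]
    have h3 := congrArg (Nat.cast : ℕ → ZMod 2) hE
    rw [hcard] at h3 ⊢
    push_cast at h3 hn ⊢
    rw [hn]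
    have h4 : ∀ a b c : ZMod 2, c = a + b → b = c + a := by decide
    rw [h4 _ _ _ h3]
    -- what remains is a polynomial identity over `ZMod 2`
    generalize (#{v | d v = Dir.north} : ZMod 2) = a
    generalize (r : ZMod 2) = b
    generalize (wR : ZMod 2) = c
    generalize (wT : ZMod 2) = e
    generalize (k : ZMod 2) = f
    generalize (ℓ : ZMod 2) = g
    revert a b c e f g; decide
  rw [sign_eq_of_inversionParity _ _ hinv]
  push_cast
  rw [pow_add, mul_assoc, ← pow_add, ← two_mul, pow_mul]
  simp

end Sign

/-! ### The Kasteleyn determinant and its minors -/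

section Determinant

/-- Replacing some rows of an invertible matrix changes the determinant by the factor given by the
small matrix of products of the new rows with the columns of the inverse. -/
theorem det_eq_det_mul_det_of_rows {n : Type*} [Fintype n] [DecidableEq n] {R : Type*} [CommRing R]
    (A A' : Matrix n n R) (hA : IsUnit A.det) {p : ℕ} (i : Fin p → n) (hi : Function.Injective i)
    (h : ∀ w, w ∉ Set.range i → A' w = A w) :
    A'.det = A.det * (Matrix.of fun s t : Fin p => (A' * A⁻¹ : Matrix n n R) (i s) (i t)).det := by
  classical
  have h1 : A'.det = A.det * (A' * A⁻¹).det := by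
    rw [Matrix.det_mul, mul_left_comm, Matrix.det_nonsing_inv, Ring.mul_inverse_cancel _ hA, mul_one]
  rw [h1]
  congr 1
  have hrow : ∀ w, w ∉ Set.range i → ∀ v, (A' * A⁻¹) w v = (1 : Matrix n n R) w v := by
    intro w hw v
    rw [← Matrix.mul_nonsing_inv A hA]
    simp only [Matrix.mul_apply, h w hw]
  rw [Matrix.twoBlockTriangular_det (A' * A⁻¹) (fun w => w ∈ Set.range i)]
  · have h2 : Matrix.toSquareBlockProp (A' * A⁻¹) (fun w => ¬ w ∈ Set.range i) = 1 := by
      ext ⟨a, ha⟩ ⟨b, hb⟩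
      rw [Matrix.toSquareBlockProp_def, Matrix.of_apply, hrow a ha, Matrix.one_apply, Matrix.one_apply]
      simp
    rw [h2, Matrix.det_one, mul_one]
    let f : Fin p ≃ {w // w ∈ Set.range i} := Equiv.ofInjective i hi
    have h3 := Matrix.det_submatrix_equiv_self f
      (Matrix.toSquareBlockProp (A' * A⁻¹) (fun w => w ∈ Set.range i))
    rw [show (Matrix.toSquareBlockProp (A' * A⁻¹) (fun w => w ∈ Set.range i)).submatrix f f =
      Matrix.of fun s t : Fin p => (A' * A⁻¹ : Matrix n n R) (i s) (i t) from rfl] at h3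
    rw [h3]
    convert rfl
  · intro a ha b hb
    rw [hrow a ha, Matrix.one_apply_ne]
    rintro rfl
    exact ha hb

variable {k ℓ : ℕ} [NeZero k] [NeZero ℓ]

/-- A choice `d` of an edge at every white vertex of the torus is a dimer cover when its black
endpoints are a bijective image of the white vertices. -/
def IsCoverFun (d : ZMod ℓ × ZMod k → Dir) : Prop :=
  Function.Bijective fun v => v + (d v).shift

noncomputable instance : DecidablePred (IsCoverFun (k := k) (ℓ := ℓ)) := Classical.decPred _

/-- The permutation of vertex labels that takes white vertices to their partners. -/
noncomputable def IsCoverFun.perm {d : ZMod ℓ × ZMod k → Dir} (h : IsCoverFun d) :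
    Equiv.Perm (ZMod ℓ × ZMod k) := Equiv.ofBijective _ h

/-- Expansion of a determinant of Kasteleyn type over dimer covers. -/
theorem det_eq_sum_coverFun (κ : ZMod ℓ × ZMod k → Dir → ℂ) :
    (Matrix.of fun v b : ZMod ℓ × ZMod k => ∑ d : Dir, if v + d.shift = b then κ v d else 0).det =
      ∑ d : ZMod ℓ × ZMod k → Dir, if h : IsCoverFun d then
        ((Equiv.Perm.sign h.perm : ℤ) : ℂ) * ∏ v, κ v (d v) else 0 := by
  rw [← Matrix.det_transpose, Matrix.det_apply']
  simp only [Matrix.transpose_apply, Matrix.of_apply]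
  simp_rw [Finset.prod_univ_sum, Fintype.piFinset_univ, Finset.mul_sum]
  rw [Finset.sum_comm]
  refine Finset.sum_congr rfl fun d _ => ?_
  simp_rw [Finset.prod_ite_zero]
  by_cases h : IsCoverFun d
  · rw [dif_pos h, Finset.sum_eq_single h.perm]
    · rw [if_pos]
      intro v _; rfl
    · intro π _ hne
      rw [if_neg, mul_zero]
      intro h'
      apply hne
      ext1 v
      exact (h' v (mem_univ v)).symm
    · simp
  · rw [dif_neg h]
    refine Finset.sum_eq_zero fun π _ => ?_
    rw [if_neg, mul_zero]
    intro h'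
    apply h
    have : (fun v => v + (d v).shift) = π := funext fun v => h' v (mem_univ v)
    rw [IsCoverFun, this]
    exact π.bijective

/-- The weighted number of dimer covers of the torus. -/
noncomputable def partitionFunction (c : TorusEdge k ℓ → ℝ) : ℝ :=
  ∑ d : ZMod ℓ × ZMod k → Dir, if IsCoverFun d then ∏ v, c (v, d v) else 0

omit [NeZero k] [NeZero ℓ] in
theorem crossU_nonneg (e : TorusEdge k ℓ) : 0 ≤ crossU e := by
  unfold crossU; split_ifs <;> simp

omit [NeZero k] [NeZero ℓ] in
theorem crossV_nonneg (e : TorusEdge k ℓ) : 0 ≤ crossV e := by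
  unfold crossV; split_ifs <;> simp

/-- The Kasteleyn determinant as a sum over dimer covers: the sign of each term depends only on the
slope. -/
theorem det_kasteleynTorus (c : TorusEdge k ℓ → ℝ) (z w : ℂ) (hz : z ≠ 0) (hw : w ≠ 0) :
    (kasteleynTorus c z w).det = ∑ d : ZMod ℓ × ZMod k → Dir, if IsCoverFun d then
      (-1) ^ ((∑ v, crossV (v, d v)).natAbs + (∑ v, crossU (v, d v)).natAbs +
        (∑ v, crossV (v, d v)).natAbs * (∑ v, crossU (v, d v)).natAbs +
          k * (∑ v, crossU (v, d v)).natAbs) *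
      (w ^ (∑ v, crossV (v, d v)) / z ^ (∑ v, crossU (v, d v))) *
      ((∏ v, c (v, d v) : ℝ) : ℂ) else 0 := by
  refine (det_eq_sum_coverFun (fun v d => (c (v, d) : ℂ) * d.sign *
    w ^ crossV ((v, d) : TorusEdge k ℓ) / z ^ crossU ((v, d) : TorusEdge k ℓ))).trans ?_
  refine Finset.sum_congr rfl fun d _ => ?_
  by_cases h : IsCoverFun d
  · rw [dif_pos h, if_pos h]
    rw [← sign_mul_prod_sign (π := h.perm) (d := d) (fun v => rfl)]
    · rw [Finset.prod_div_distrib, Finset.prod_mul_distrib, Finset.prod_mul_distrib]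
      have zp : ∀ (x : ℂ) (hx : x ≠ 0) (s : Finset (ZMod ℓ × ZMod k)) (f : ZMod ℓ × ZMod k → ℤ),
          ∏ v ∈ s, x ^ f v = x ^ ∑ v ∈ s, f v := by
        intro x hx s f
        classical
        induction s using Finset.induction_on with
        | empty => simp
        | insert a s ha ih => rw [Finset.prod_insert ha, Finset.sum_insert ha, ih, zpow_add₀ hx]
      rw [zp w hw, zp z hz]
      push_cast
      ring
    · have e : ∀ x : ℤ, 0 ≤ x → ((x.natAbs : ℕ) : ZMod 2) = (x : ZMod 2) := by
        intro x hx
        lift x to ℕ using hx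
        simp
      push_cast [e _ (Finset.sum_nonneg fun v _ => crossV_nonneg (v, d v)),
        e _ (Finset.sum_nonneg fun v _ => crossU_nonneg (v, d v))]
      rfl
  · rw [dif_neg h, if_neg h]

/-- The coefficients of the four Kasteleyn determinants in the partition function. -/
noncomputable def spinCoeff (s t : ℤˣ) : ℂ := if s = 1 ∧ t = 1 then -(1 / 2) else 1 / 2

/-- The partition function of a torus with an even number of rows is a combination of four
determinants. -/
theorem partitionFunction_eq (hk : Even k) (c : TorusEdge k ℓ → ℝ) :
    (partitionFunction c : ℂ) = ∑ s : ℤˣ, ∑ t : ℤˣ,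
      spinCoeff s t * (kasteleynTorus c ((s : ℤ) : ℂ) ((t : ℤ) : ℂ)).det := by
  have hne : ∀ s : ℤˣ, ((s : ℤ) : ℂ) ≠ 0 := fun s => by
    exact_mod_cast s.ne_zero
  simp_rw [det_kasteleynTorus _ _ _ (hne _) (hne _), Finset.mul_sum]
  rw [partitionFunction, Complex.ofReal_sum]
  refine Eq.trans ?_ ((Finset.sum_congr rfl fun s _ => Finset.sum_comm).trans Finset.sum_comm).symm
  refine Finset.sum_congr rfl fun d _ => ?_
  by_cases h : IsCoverFun d
  · simp only [if_pos h]
    obtain ⟨a, ha⟩ := Int.eq_ofNat_of_zero_le (Finset.sum_nonneg fun v (_ : v ∈ univ) =>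
      crossV_nonneg (v, d v))
    obtain ⟨b, hb⟩ := Int.eq_ofNat_of_zero_le (Finset.sum_nonneg fun v (_ : v ∈ univ) =>
      crossU_nonneg (v, d v))
    rw [ha, hb]
    simp only [Int.natAbs_natCast, zpow_natCast, ← mul_assoc, ← Finset.sum_mul]
    conv_lhs => rw [← one_mul ((∏ v, c (v, d v) : ℝ) : ℂ)]
    congr 1
    have hkb : ((-1 : ℂ)) ^ (k * b) = 1 := by rw [pow_mul, hk.neg_one_pow, one_pow]
    simp only [UnitsInt.univ, Finset.sum_insert (show (1 : ℤˣ) ∉ ({-1} : Finset ℤˣ) by decide),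
      Finset.sum_singleton, spinCoeff, pow_add, hkb]
    rcases Nat.even_or_odd a with ha' | ha' <;> rcases Nat.even_or_odd b with hb' | hb' <;>
      simp [ha'.neg_one_pow, hb'.neg_one_pow, pow_mul] <;> norm_num
  · simp [h]

/-- The weights that vanish on every edge that shares its white endpoint with some `e s` but is
different from it. -/
noncomputable def restrictWeight (c : TorusEdge k ℓ → ℝ) {p : ℕ} (e : Fin p → TorusEdge k ℓ)
    (f : TorusEdge k ℓ) : ℝ := by
  classical exact if ∃ s, f.1 = (e s).1 ∧ f ≠ e s then 0 else c f

/-- With restricted weights, only the covers that contain all the edges `e s` are counted. -/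
theorem partitionFunction_restrictWeight (c : TorusEdge k ℓ → ℝ) {p : ℕ} (e : Fin p → TorusEdge k ℓ) :
    partitionFunction (restrictWeight c e) = ∑ d : ZMod ℓ × ZMod k → Dir,
      if IsCoverFun d ∧ ∀ s, d (e s).1 = (e s).2 then ∏ v, c (v, d v) else 0 := by
  unfold partitionFunction
  refine Finset.sum_congr rfl fun d _ => ?_
  by_cases h : IsCoverFun d
  · by_cases h' : ∀ s, d (e s).1 = (e s).2
    · rw [if_pos h, if_pos ⟨h, h'⟩]
      refine Finset.prod_congr rfl fun v _ => ?_
      rw [restrictWeight, if_neg]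
      rintro ⟨s, rfl, hs⟩
      exact hs (Prod.ext rfl (h' s))
    · rw [if_pos h, if_neg (fun H => h' H.2)]
      push Not at h'
      obtain ⟨s, hs⟩ := h'
      refine Finset.prod_eq_zero (mem_univ (e s).1) ?_
      rw [restrictWeight, if_pos]
      exact ⟨s, rfl, fun H => hs (congrArg Prod.snd H)⟩
  · rw [if_neg h, if_neg (fun H => h H.1)]

/-- The entry of the Kasteleyn matrix contributed by a single edge. -/
noncomputable def edgeEntry (c : TorusEdge k ℓ → ℝ) (z w : ℂ) (e : TorusEdge k ℓ) : ℂ :=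
  (c e : ℂ) * e.2.sign * w ^ crossV e / z ^ crossU e

/-- Restricting the weights changes only the rows of the white endpoints, hence multiplies the
determinant by a small determinant. -/
theorem det_kasteleynTorus_restrictWeight (c : TorusEdge k ℓ → ℝ) (z w : ℂ)
    (hK : (kasteleynTorus c z w).det ≠ 0) {p : ℕ} (e : Fin p → TorusEdge k ℓ)
    (he : Function.Injective fun s => (e s).1) :
    (kasteleynTorus (restrictWeight c e) z w).det = (kasteleynTorus c z w).det *
      (Matrix.of fun s s' : Fin p => edgeEntry c z w (e s') *
        (kasteleynTorus c z w)⁻¹ (Edge.black (e s)) (Edge.white (e s'))).det := by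
  rw [det_eq_det_mul_det_of_rows (kasteleynTorus c z w) _ (isUnit_iff_ne_zero.mpr hK)
    (fun s => (e s).1) he]
  · congr 1
    have hL : ∀ s t : Fin p, (kasteleynTorus (restrictWeight c e) z w *
        (kasteleynTorus c z w)⁻¹) (e s).1 (e t).1 = edgeEntry c z w (e s) *
          (kasteleynTorus c z w)⁻¹ (Edge.black (e s)) (Edge.white (e t)) := by
      intro s t
      have hrow : ∀ b, kasteleynTorus (restrictWeight c e) z w (e s).1 b =
          if Edge.black (e s) = b then edgeEntry c z w (e s) else 0 := by
        intro b
        rw [kasteleynTorus, Matrix.of_apply, Finset.sum_eq_single (e s).2]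
        · have : restrictWeight c e ((e s).1, (e s).2) = c (e s) := by
            rw [restrictWeight, if_neg]
            rintro ⟨t, h1, h2⟩
            exact h2 (congrArg e (he h1))
          rw [this]
          rfl
        · intro d _ hd
          have : restrictWeight c e ((e s).1, d) = 0 := by
            rw [restrictWeight, if_pos]
            exact ⟨s, rfl, fun H => hd (congrArg Prod.snd H)⟩
          simp [this]
        · simp
      simp [Matrix.mul_apply, hrow, Edge.white]
    simp_rw [hL]
    have e1 := Matrix.det_mul_column (fun s => edgeEntry c z w (e s)) (Matrix.of fun s t : Fin p =>
      (kasteleynTorus c z w)⁻¹ (Edge.black (e s)) (Edge.white (e t)))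
    have e2 := Matrix.det_mul_row (fun s => edgeEntry c z w (e s)) (Matrix.of fun s t : Fin p =>
      (kasteleynTorus c z w)⁻¹ (Edge.black (e s)) (Edge.white (e t)))
    simp only [Matrix.of_apply] at e1 e2
    rw [e1, e2]
  · intro v hv
    ext b
    simp only [kasteleynTorus, Matrix.of_apply]
    refine Finset.sum_congr rfl fun d _ => ?_
    have : restrictWeight c e (v, d) = c (v, d) := by
      rw [restrictWeight, if_neg]
      rintro ⟨s, h1, -⟩
      exact hv ⟨s, h1.symm⟩
    rw [this]

end Determinant

/-! ### Periodicity and Bloch phases -/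

section Lift

variable {k ℓ : ℕ} [NeZero k] [NeZero ℓ]

theorem add_one_ediv_sub_ediv (n : ℕ) [NeZero n] (x : ℤ) :
    (x + 1) / (n : ℤ) - x / (n : ℤ) = if (x : ZMod n) = -1 then 1 else 0 := by
  have hn : (0 : ℤ) < n := by exact_mod_cast Nat.pos_of_ne_zero (NeZero.ne n)
  have h1 : ((x : ZMod n) = -1) ↔ (n : ℤ) ∣ x + 1 := by
    rw [← ZMod.intCast_zmod_eq_zero_iff_dvd, Int.cast_add, Int.cast_one]
    exact ⟨fun h => by rw [h, neg_add_cancel], fun h => eq_neg_of_add_eq_zero_left h⟩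
  rw [if_congr h1 rfl rfl]
  have e := Int.emod_add_mul_ediv x n
  have r0 := Int.emod_nonneg x hn.ne'
  have r1 := Int.emod_lt_of_pos x hn
  split_ifs with h
  · obtain ⟨q, hq⟩ := h
    rw [hq, Int.mul_ediv_cancel_left _ hn.ne']
    have : x = (n - 1) + n * (q - 1) := by linarith
    rw [this, Int.add_mul_ediv_left _ _ hn.ne', Int.ediv_eq_zero_of_lt (by omega) (by omega)]
    ring
  · have : x + 1 = (x % n + 1) + n * (x / n) := by linarith
    have h3 : x % n + 1 < n := by
      by_contra h4
      apply h
      rw [this, show x % (n : ℤ) + 1 = n by omega]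
      exact Dvd.intro (1 + x / n) (by ring)
    rw [this, Int.add_mul_ediv_left _ _ hn.ne', Int.ediv_eq_zero_of_lt (by omega) (by omega)]
    ring

omit [NeZero k] in
theorem crossV_proj (e : LatticeEdge) :
    crossV (proj k ℓ e) = (Edge.black e).1 / (ℓ : ℤ) - (Edge.white e).1 / (ℓ : ℤ) := by
  obtain ⟨x, d⟩ := e
  have := add_one_ediv_sub_ediv ℓ x.1
  cases d <;> simp [crossV, proj, Edge.black, Edge.white, Dir.shift, this]

omit [NeZero ℓ] in
theorem crossU_proj (e : LatticeEdge) :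
    crossU (proj k ℓ e) = (Edge.black e).2 / (k : ℤ) - (Edge.white e).2 / (k : ℤ) := by
  obtain ⟨x, d⟩ := e
  have := add_one_ediv_sub_ediv k x.2
  cases d <;> simp [crossU, proj, Edge.black, Edge.white, Dir.shift, this]

/-- The class on the torus of a vertex of the plane. -/
def vertexProj (k ℓ : ℕ) (x : ℤ × ℤ) : ZMod ℓ × ZMod k := ((x.1 : ZMod ℓ), (x.2 : ZMod k))

/-- The representative in the fundamental domain of a vertex of the torus. -/
def vertexRep (v : ZMod ℓ × ZMod k) : ℤ × ℤ := ((v.1.val : ℤ), (v.2.val : ℤ))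

omit [NeZero k] [NeZero ℓ] in
theorem black_proj (e : LatticeEdge) : Edge.black (proj k ℓ e) = vertexProj k ℓ (Edge.black e) := by
  obtain ⟨x, d⟩ := e
  cases d <;> simp [proj, Edge.black, Dir.shift, vertexProj]

theorem vertexProj_vertexRep (v : ZMod ℓ × ZMod k) : vertexProj k ℓ (vertexRep v) = v := by
  simp [vertexProj, vertexRep]

/-- The Bloch phase of the cell of a vertex: the cell `(m, n)` has phase `w ^ m / z ^ n`. -/
noncomputable def blochPhase (k ℓ : ℕ) (z w : ℂ) (x : ℤ × ℤ) : ℂ :=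
  w ^ (x.1 / (ℓ : ℤ)) / z ^ (x.2 / (k : ℤ))

omit [NeZero k] [NeZero ℓ] in
theorem blochPhase_ne_zero {z w : ℂ} (hz : z ≠ 0) (hw : w ≠ 0) (x : ℤ × ℤ) :
    blochPhase k ℓ z w x ≠ 0 := div_ne_zero (zpow_ne_zero _ hw) (zpow_ne_zero _ hz)

/-- The crossing factor of an edge is the quotient of the phases of its endpoints. -/
theorem cross_eq_blochPhase {z w : ℂ} (hz : z ≠ 0) (hw : w ≠ 0) (e : LatticeEdge) :
    w ^ crossV (proj k ℓ e) / z ^ crossU (proj k ℓ e) =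
      blochPhase k ℓ z w (Edge.black e) / blochPhase k ℓ z w (Edge.white e) := by
  rw [crossV_proj, crossU_proj, zpow_sub₀ hw, zpow_sub₀ hz, blochPhase, blochPhase]
  have := zpow_ne_zero ((Edge.white e).1 / (ℓ : ℤ)) hw
  have := zpow_ne_zero ((Edge.white e).2 / (k : ℤ)) hz
  have := zpow_ne_zero ((Edge.black e).2 / (k : ℤ)) hz
  field_simp

/-- The magnetically altered Kasteleyn matrix is the action of the Kasteleyn operator of the plane
on quasi-periodic functions. -/
theorem sum_mul_blochPhase (c : TorusEdge k ℓ → ℝ) {z w : ℂ} (hz : z ≠ 0) (hw : w ≠ 0)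
    (u : ZMod ℓ × ZMod k → ℂ) (x : ℤ × ℤ) :
    ∑ d : Dir, (c (proj k ℓ (x, d)) : ℂ) * d.sign *
      (blochPhase k ℓ z w (x + d.shift) * u (vertexProj k ℓ (x + d.shift))) =
      blochPhase k ℓ z w x * (kasteleynTorus c z w).mulVec u (vertexProj k ℓ x) := by
  rw [Matrix.mulVec, dotProduct]
  simp only [kasteleynTorus, Matrix.of_apply]
  simp_rw [Finset.sum_mul]
  rw [Finset.sum_comm, Finset.mul_sum]
  refine Finset.sum_congr rfl fun d _ => ?_
  have h1 : Edge.black ((vertexProj k ℓ x, d) : TorusEdge k ℓ) = vertexProj k ℓ (x + d.shift) :=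
    black_proj (x, d)
  rw [h1]
  simp only [ite_mul, zero_mul, Finset.sum_ite_eq, mem_univ, if_true]
  have h2 := cross_eq_blochPhase (k := k) (ℓ := ℓ) hz hw (x, d)
  have h3 : proj k ℓ (x, d) = (vertexProj k ℓ x, d) := rfl
  have h4 : blochPhase k ℓ z w x ≠ 0 := blochPhase_ne_zero hz hw x
  rw [h3] at h2 ⊢
  rw [mul_div_assoc, h2]
  simp only [Edge.black, Edge.white]
  field_simp

/-- Conjugating by a diagonal matrix does not change the determinant. -/
theorem det_gauge {R : Type*} [Field R] {p : ℕ} (γ : Fin p → R) (hγ : ∀ s, γ s ≠ 0)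
    (A B : Fin p → Fin p → R) (h : ∀ s s', A s s' = γ s' / γ s * B s s') :
    (Matrix.of A).det = (Matrix.of B).det := by
  have e1 := Matrix.det_mul_column (fun s => (γ s)⁻¹) (Matrix.of fun s s' => γ s' * B s s')
  have e2 := Matrix.det_mul_row γ (Matrix.of B)
  simp only [Matrix.of_apply] at e1 e2
  have : (Matrix.of A) = Matrix.of fun s s' => (γ s)⁻¹ * (γ s' * B s s') := by
    ext s s'; simp only [Matrix.of_apply, h]; ring
  rw [this, e1, e2, ← mul_assoc, ← Finset.prod_mul_distrib]
  simp [hγ]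

omit [NeZero k] [NeZero ℓ] in
theorem kasteleynPlane_edge (c : TorusEdge k ℓ → ℝ) (e : LatticeEdge) :
    kasteleynPlane c (Edge.white e) (Edge.black e) = c (proj k ℓ e) * e.2.sign := by
  rw [kasteleynPlane, Finset.sum_eq_single e.2]
  · rw [if_pos]
    · rfl
    · rfl
  · intro d _ hd
    rw [if_neg]
    obtain ⟨x, d'⟩ := e
    intro h
    simp only [Edge.black, Edge.white, add_right_inj] at h
    apply hd
    cases d <;> cases d' <;> simp_all [Dir.shift]
  · simp

end Lift

/-! ### Roots of unity -/

section RootsOfUnity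

/-- The points `exp (2 π i (j + φ) / M)`; for `φ = 0` and `φ = 1 / 2` they are the `M`-th roots of
`1` and of `-1`. -/
noncomputable def rootPoint (M : ℕ) (φ : ℝ) (j : ℕ) : ℂ :=
  Complex.exp (((2 * Real.pi * ((j + φ) / M) : ℝ) : ℂ) * Complex.I)

theorem rootPoint_ne_zero (M : ℕ) (φ : ℝ) (j : ℕ) : rootPoint M φ j ≠ 0 := Complex.exp_ne_zero _

theorem norm_rootPoint (M : ℕ) (φ : ℝ) (j : ℕ) : ‖rootPoint M φ j‖ = 1 :=
  Complex.norm_exp_ofReal_mul_I _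

/-- The shift of the angles that produces the `M`-th roots of the sign `s`. -/
noncomputable def spinAngle (s : ℤˣ) : ℝ := if s = 1 then 0 else 1 / 2

theorem rootPoint_pow {M : ℕ} (hM : M ≠ 0) (s : ℤˣ) (j : ℕ) :
    rootPoint M (spinAngle s) j ^ M = ((s : ℤ) : ℂ) := by
  rw [rootPoint, ← Complex.exp_nat_mul]
  have hM' : (M : ℂ) ≠ 0 := by exact_mod_cast hM
  rcases Int.units_eq_one_or s with rfl | rfl
  · rw [Complex.exp_eq_one_iff.mpr ⟨j, ?_⟩]
    · simp
    · simp [spinAngle]; field_simp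
  · have : (M : ℂ) * (((2 * Real.pi * ((j + spinAngle (-1)) / M) : ℝ) : ℂ) * Complex.I) =
        j * (2 * Real.pi * Complex.I) + Real.pi * Complex.I := by
      have : spinAngle (-1) = 1 / 2 := by rw [spinAngle, if_neg (by decide)]
      rw [this]; push_cast; field_simp
    rw [this, Complex.exp_add, Complex.exp_eq_one_iff.mpr ⟨j, by push_cast; rfl⟩, Complex.exp_pi_mul_I]
    simp

/-- Orthogonality of characters; the exponents are small enough that no nonzero one is a multiple of
`M`. -/
theorem sum_rootPoint_zpow {M : ℕ} (hM : M ≠ 0) (φ : ℝ) {n : ℤ} (hn : |n| < M) :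
    ∑ j ∈ range M, rootPoint M φ j ^ n = if n = 0 then (M : ℂ) else 0 := by
  have hM' : (M : ℂ) ≠ 0 := by exact_mod_cast hM
  split_ifs with h0
  · simp [h0]
  set η := Complex.exp (2 * Real.pi * Complex.I / M) with hη
  have hprim : IsPrimitiveRoot η M := Complex.isPrimitiveRoot_exp M hM
  have hr : η ^ n ≠ 1 := by
    rw [Ne, hprim.zpow_eq_one_iff_dvd]
    intro hd
    exact h0 (Int.eq_zero_of_abs_lt_dvd hd hn)
  have hterm : ∀ j, rootPoint M φ j ^ n = rootPoint M φ 0 ^ n * (η ^ n) ^ j := by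
    intro j
    rw [← zpow_natCast, ← zpow_mul, mul_comm n, zpow_mul, ← mul_zpow]
    congr 1
    rw [rootPoint, rootPoint, hη, zpow_natCast, ← Complex.exp_nat_mul, ← Complex.exp_add]
    congr 1
    push_cast
    field_simp
    ring
  rw [Finset.sum_congr rfl fun j _ => hterm j, ← Finset.mul_sum, geom_sum_eq hr, ← zpow_natCast, ← zpow_mul, mul_comm n, zpow_mul,
    zpow_natCast, hprim.pow_eq_one]
  simp

end RootsOfUnity

/-! ### Finite covers of the torus -/

section Cover

variable {k ℓ : ℕ} [NeZero k] [NeZero ℓ]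

/-- The projection to the torus of the edges of its `M × M`-fold cover. -/
def coverProj (M k ℓ : ℕ) (e : TorusEdge (M * k) (M * ℓ)) : TorusEdge k ℓ :=
  ((ZMod.castHom (Dvd.intro_left M rfl) (ZMod ℓ) e.1.1,
    ZMod.castHom (Dvd.intro_left M rfl) (ZMod k) e.1.2), e.2)

omit [NeZero k] [NeZero ℓ] in
theorem coverProj_proj (M : ℕ) (e : LatticeEdge) :
    coverProj M k ℓ (proj (M * k) (M * ℓ) e) = proj k ℓ e := by
  simp [coverProj, proj]

/-- The integrand of the inverse Kasteleyn matrix, as a function of the spectral parameters. -/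
noncomputable def greenIntegrand (c : TorusEdge k ℓ → ℝ) (b x : ℤ × ℤ) (z w : ℂ) : ℂ :=
  (kasteleynTorus c z w)⁻¹ (vertexProj k ℓ b) (vertexProj k ℓ x) *
    (blochPhase k ℓ z w b / blochPhase k ℓ z w x)

/-- The average of the integrand of the inverse Kasteleyn matrix over the pairs of `M`-th roots of
the signs `s` and `t`. -/
noncomputable def discreteGreen (c : TorusEdge k ℓ → ℝ) (M : ℕ) (s t : ℤˣ) (b x : ℤ × ℤ) : ℂ :=
  (M : ℂ)⁻¹ * ∑ i ∈ range M, (M : ℂ)⁻¹ * ∑ j ∈ range M,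
    greenIntegrand c b x (rootPoint M (spinAngle s) i) (rootPoint M (spinAngle t) j)

omit [NeZero k] [NeZero ℓ] in
theorem ediv_eq_add_mul_ediv (M n : ℕ) [NeZero n] [NeZero M] (x : ℤ) :
    x / (n : ℤ) = (x % ((M * n : ℕ) : ℤ)) / (n : ℤ) + M * (x / ((M * n : ℕ) : ℤ)) := by
  have hn : (n : ℤ) ≠ 0 := by exact_mod_cast NeZero.ne n
  conv_lhs => rw [← Int.emod_add_mul_ediv x ((M * n : ℕ) : ℤ)]
  rw [show ((M * n : ℕ) : ℤ) * (x / ((M * n : ℕ) : ℤ)) = n * (M * (x / ((M * n : ℕ) : ℤ))) by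
    push_cast; ring, Int.add_mul_ediv_left _ _ hn]

theorem val_intCast_emod (n : ℕ) [NeZero n] (x : ℤ) : (((x : ZMod n)).val : ℤ) = x % (n : ℤ) :=
  ZMod.val_intCast x

theorem blochPhase_rep (M : ℕ) [NeZero M] {z w : ℂ} (hz : z ≠ 0) (hw : w ≠ 0) (x : ℤ × ℤ) :
    blochPhase k ℓ z w x = blochPhase k ℓ z w (vertexRep (vertexProj (M * k) (M * ℓ) x)) *
      blochPhase (M * k) (M * ℓ) (z ^ M) (w ^ M) x := by
  simp only [blochPhase, vertexRep, vertexProj, val_intCast_emod]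
  rw [ediv_eq_add_mul_ediv M ℓ x.1, ediv_eq_add_mul_ediv M k x.2, zpow_add₀ hz, zpow_add₀ hw,
    zpow_mul, zpow_mul, zpow_natCast, zpow_natCast]
  ring

theorem vertexProj_vertexRep_vertexProj (M : ℕ) [NeZero M] (x : ℤ × ℤ) :
    vertexProj k ℓ (vertexRep (vertexProj (M * k) (M * ℓ) x)) = vertexProj k ℓ x := by
  have h : ∀ (n : ℕ) [NeZero n] (y : ℤ), (((((y : ZMod (M * n))).val : ℤ)) : ZMod n) = y := by
    intro n _ y
    rw [val_intCast_emod, ZMod.intCast_eq_intCast_iff]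
    exact (Int.mod_modEq _ _).of_dvd (by push_cast; exact Dvd.intro_left _ rfl)
  exact Prod.ext (h ℓ x.1) (h k x.2)

variable (M : ℕ) [NeZero M]

/-- Discrete Green functions are quasi-periodic with respect to the `M × M`-fold cover, with the signs
`s` and `t` as multipliers. -/
theorem discreteGreen_rep (c : TorusEdge k ℓ → ℝ) (s t : ℤˣ) (b x : ℤ × ℤ) :
    discreteGreen c M s t b x = discreteGreen c M s t (vertexRep (vertexProj (M * k) (M * ℓ) b))
        (vertexRep (vertexProj (M * k) (M * ℓ) x)) *
      (blochPhase (M * k) (M * ℓ) ((s : ℤ) : ℂ) ((t : ℤ) : ℂ) b /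
        blochPhase (M * k) (M * ℓ) ((s : ℤ) : ℂ) ((t : ℤ) : ℂ) x) := by
  simp only [discreteGreen, mul_assoc, Finset.sum_mul]
  congr 1
  refine Finset.sum_congr rfl fun i _ => ?_
  congr 1
  refine Finset.sum_congr rfl fun j _ => ?_
  have hz := rootPoint_ne_zero M (spinAngle s) i
  have hw := rootPoint_ne_zero M (spinAngle t) j
  rw [greenIntegrand, greenIntegrand, vertexProj_vertexRep_vertexProj,
    vertexProj_vertexRep_vertexProj, blochPhase_rep M hz hw b, blochPhase_rep M hz hw x,
    rootPoint_pow (NeZero.ne M), rootPoint_pow (NeZero.ne M)]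
  ring

theorem units_cast_ne_zero (s : ℤˣ) : ((s : ℤ) : ℂ) ≠ 0 := by exact_mod_cast s.ne_zero

theorem blochPhase_vertexRep (z w : ℂ) (v : ZMod ℓ × ZMod k) :
    blochPhase k ℓ z w (vertexRep v) = 1 := by
  have h1 : ((v.1.val : ℤ)) / (ℓ : ℤ) = 0 :=
    Int.ediv_eq_zero_of_lt (by positivity) (by exact_mod_cast v.1.val_lt)
  have h2 : ((v.2.val : ℤ)) / (k : ℤ) = 0 :=
    Int.ediv_eq_zero_of_lt (by positivity) (by exact_mod_cast v.2.val_lt)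
  rw [blochPhase, vertexRep, h1, h2]
  simp

/-- The Kasteleyn operator of the plane maps the integrand to a Bloch wave on the class of `x`. -/
theorem sum_mul_greenIntegrand (c : TorusEdge k ℓ → ℝ) {z w : ℂ} (hz : z ≠ 0) (hw : w ≠ 0)
    (hdet : (kasteleynTorus c z w).det ≠ 0) (v x : ℤ × ℤ) :
    ∑ d : Dir, (c (proj k ℓ (v, d)) : ℂ) * d.sign * greenIntegrand c (v + d.shift) x z w =
      if vertexProj k ℓ v = vertexProj k ℓ x then
        blochPhase k ℓ z w v / blochPhase k ℓ z w x else 0 := by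
  have h := sum_mul_blochPhase c hz hw (fun b => (kasteleynTorus c z w)⁻¹ b (vertexProj k ℓ x)) v
  have h1 : (kasteleynTorus c z w).mulVec
      (fun b => (kasteleynTorus c z w)⁻¹ b (vertexProj k ℓ x)) (vertexProj k ℓ v) =
      if vertexProj k ℓ v = vertexProj k ℓ x then 1 else 0 := by
    rw [← Matrix.one_apply, ← Matrix.mul_nonsing_inv _ (isUnit_iff_ne_zero.mpr hdet)]
    rfl
  rw [h1] at h
  simp only [greenIntegrand]
  have : ∀ d : Dir, (c (proj k ℓ (v, d)) : ℂ) * d.sign *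
      ((kasteleynTorus c z w)⁻¹ (vertexProj k ℓ (v + d.shift)) (vertexProj k ℓ x) *
        (blochPhase k ℓ z w (v + d.shift) / blochPhase k ℓ z w x)) =
      (c (proj k ℓ (v, d)) : ℂ) * d.sign * (blochPhase k ℓ z w (v + d.shift) *
        (kasteleynTorus c z w)⁻¹ (vertexProj k ℓ (v + d.shift)) (vertexProj k ℓ x)) *
          (blochPhase k ℓ z w x)⁻¹ := fun d => by ring
  simp_rw [this]
  rw [← Finset.sum_mul, h]
  split_ifs <;> ring

theorem abs_ediv_sub_ediv_lt {n : ℕ} [NeZero n] (a b : ZMod (M * n)) :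
    |(a.val : ℤ) / (n : ℤ) - (b.val : ℤ) / (n : ℤ)| < M := by
  have key : ∀ a : ZMod (M * n), 0 ≤ (a.val : ℤ) / (n : ℤ) ∧ (a.val : ℤ) / (n : ℤ) < M := by
    intro a
    have hn : (0 : ℤ) < n := by exact_mod_cast Nat.pos_of_ne_zero (NeZero.ne n)
    refine ⟨by positivity, Int.ediv_lt_of_lt_mul hn ?_⟩
    exact_mod_cast a.val_lt
  rw [abs_lt]
  have h1 := key a
  have h2 := key b
  omega

/-- Completeness of the Bloch waves on the `M × M`-fold cover. -/
theorem sum_rootPoint_blochPhase (s t : ℤˣ) (v w : ZMod (M * ℓ) × ZMod (M * k)) :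
    (M : ℂ)⁻¹ * ∑ i ∈ range M, (M : ℂ)⁻¹ * ∑ j ∈ range M,
      (if vertexProj k ℓ (vertexRep v) = vertexProj k ℓ (vertexRep w) then
        blochPhase k ℓ (rootPoint M (spinAngle s) i) (rootPoint M (spinAngle t) j) (vertexRep v) /
          blochPhase k ℓ (rootPoint M (spinAngle s) i) (rootPoint M (spinAngle t) j) (vertexRep w)
      else 0) = if v = w then 1 else 0 := by
  have hM : (M : ℂ) ≠ 0 := by exact_mod_cast NeZero.ne M
  by_cases hvw : vertexProj k ℓ (vertexRep v) = vertexProj k ℓ (vertexRep w)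
  · simp only [if_pos hvw]
    have hterm : ∀ i j, blochPhase k ℓ (rootPoint M (spinAngle s) i) (rootPoint M (spinAngle t) j)
        (vertexRep v) / blochPhase k ℓ (rootPoint M (spinAngle s) i)
          (rootPoint M (spinAngle t) j) (vertexRep w) =
        rootPoint M (spinAngle s) i ^ ((w.2.val : ℤ) / (k : ℤ) - (v.2.val : ℤ) / (k : ℤ)) *
        rootPoint M (spinAngle t) j ^ ((v.1.val : ℤ) / (ℓ : ℤ) - (w.1.val : ℤ) / (ℓ : ℤ)) := by
      intro i j
      rw [zpow_sub₀ (rootPoint_ne_zero _ _ _), zpow_sub₀ (rootPoint_ne_zero _ _ _)]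
      simp only [blochPhase, vertexRep]
      have h1 := zpow_ne_zero ((v.2.val : ℤ) / (k : ℤ)) (rootPoint_ne_zero M (spinAngle s) i)
      have h2 := zpow_ne_zero ((w.2.val : ℤ) / (k : ℤ)) (rootPoint_ne_zero M (spinAngle s) i)
      have h3 := zpow_ne_zero ((w.1.val : ℤ) / (ℓ : ℤ)) (rootPoint_ne_zero M (spinAngle t) j)
      field_simp
    simp_rw [hterm, ← Finset.mul_sum]
    rw [sum_rootPoint_zpow (NeZero.ne M) _ (abs_ediv_sub_ediv_lt M v.1 w.1),
      ← Finset.sum_mul, sum_rootPoint_zpow (NeZero.ne M) _ (abs_ediv_sub_ediv_lt M w.2 v.2)]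
    have hiff : v = w ↔ ((w.2.val : ℤ) / (k : ℤ) - (v.2.val : ℤ) / (k : ℤ) = 0 ∧
        (v.1.val : ℤ) / (ℓ : ℤ) - (w.1.val : ℤ) / (ℓ : ℤ) = 0) := by
      constructor
      · rintro rfl; simp
      · rintro ⟨h1, h2⟩
        simp only [vertexProj, vertexRep, Prod.mk.injEq] at hvw
        have h3 : ∀ (n : ℕ) [NeZero n] (a b : ZMod (M * n)), (((a.val : ℤ)) : ZMod n) =
            ((b.val : ℤ) : ZMod n) → (a.val : ℤ) / (n : ℤ) = (b.val : ℤ) / (n : ℤ) → a = b := by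
          intro n _ a b h4 h5
          rw [ZMod.intCast_eq_intCast_iff] at h4
          apply ZMod.val_injective
          have h6 := Int.emod_add_mul_ediv (a.val : ℤ) n
          have h7 := Int.emod_add_mul_ediv (b.val : ℤ) n
          rw [h5, h4] at h6
          have : (a.val : ℤ) = b.val := h6.symm.trans h7
          exact_mod_cast this
        exact Prod.ext (h3 ℓ _ _ hvw.1 (by omega)) (h3 k _ _ hvw.2 (by omega))
    rw [if_congr hiff rfl rfl]
    by_cases h1 : (w.2.val : ℤ) / (k : ℤ) - (v.2.val : ℤ) / (k : ℤ) = 0 <;>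
      by_cases h2 : (v.1.val : ℤ) / (ℓ : ℤ) - (w.1.val : ℤ) / (ℓ : ℤ) = 0 <;>
      simp only [h1, h2, if_true, if_false, and_self, and_true, and_false, mul_zero,
        zero_mul]
    field_simp
  · have hne : v ≠ w := fun h => hvw (by rw [h])
    simp [hvw, hne]

/-- The inverse Kasteleyn matrix of the `M × M`-fold cover of the torus, with periodic or
antiperiodic boundary conditions, is a discrete Fourier transform. -/
theorem inv_kasteleynTorus_cover (c : TorusEdge k ℓ → ℝ)
    (hdet : ∀ z w : ℂ, ‖z‖ = 1 → ‖w‖ = 1 → (kasteleynTorus c z w).det ≠ 0) (s t : ℤˣ) :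
    kasteleynTorus (c ∘ coverProj M k ℓ) ((s : ℤ) : ℂ) ((t : ℤ) : ℂ) *
      (Matrix.of fun b x => discreteGreen c M s t (vertexRep b) (vertexRep x)) = 1 := by
  ext v w
  have h := sum_mul_blochPhase (c ∘ coverProj M k ℓ) (units_cast_ne_zero s) (units_cast_ne_zero t)
    (fun b => discreteGreen c M s t (vertexRep b) (vertexRep w)) (vertexRep v)
  rw [blochPhase_vertexRep, vertexProj_vertexRep, one_mul] at h
  refine h.symm.trans ?_
  have h1 : ∀ b : ℤ × ℤ, blochPhase (M * k) (M * ℓ) ((s : ℤ) : ℂ) ((t : ℤ) : ℂ) b *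
      discreteGreen c M s t (vertexRep (vertexProj (M * k) (M * ℓ) b)) (vertexRep w) =
      discreteGreen c M s t b (vertexRep w) := by
    intro b
    rw [discreteGreen_rep M c s t b, vertexProj_vertexRep, blochPhase_vertexRep]
    ring
  simp_rw [h1, Function.comp, coverProj_proj]
  rw [Matrix.one_apply, ← sum_rootPoint_blochPhase (k := k) (ℓ := ℓ) M s t v w]
  simp_rw [discreteGreen, Finset.mul_sum]
  rw [Finset.sum_comm]
  refine Finset.sum_congr rfl fun i _ => ?_
  rw [Finset.sum_comm]
  refine Finset.sum_congr rfl fun j _ => ?_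
  rw [← sum_mul_greenIntegrand c (rootPoint_ne_zero M (spinAngle s) i)
    (rootPoint_ne_zero M (spinAngle t) j) (hdet _ _ (norm_rootPoint _ _ _) (norm_rootPoint _ _ _))]
  simp_rw [Finset.mul_sum]
  refine Finset.sum_congr rfl fun d _ => ?_
  ring

/-- The small determinants on the cover are those built from the discrete Green function. -/
theorem det_cover_eq (c : TorusEdge k ℓ → ℝ)
    (hdet : ∀ z w : ℂ, ‖z‖ = 1 → ‖w‖ = 1 → (kasteleynTorus c z w).det ≠ 0) (s t : ℤˣ)
    {p : ℕ} (e : Fin p → LatticeEdge) :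
    (Matrix.of fun i j : Fin p =>
      edgeEntry (c ∘ coverProj M k ℓ) ((s : ℤ) : ℂ) ((t : ℤ) : ℂ) (proj (M * k) (M * ℓ) (e j)) *
        (kasteleynTorus (c ∘ coverProj M k ℓ) ((s : ℤ) : ℂ) ((t : ℤ) : ℂ))⁻¹
          (Edge.black (proj (M * k) (M * ℓ) (e i))) (Edge.white (proj (M * k) (M * ℓ) (e j)))).det =
    (Matrix.of fun i j : Fin p => kasteleynPlane c (Edge.white (e j)) (Edge.black (e j)) *
      discreteGreen c M s t (Edge.black (e i)) (Edge.white (e j))).det := by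
  rw [Matrix.inv_eq_right_inv (inv_kasteleynTorus_cover M c hdet s t)]
  have hne := blochPhase_ne_zero (k := M * k) (ℓ := M * ℓ) (units_cast_ne_zero s)
    (units_cast_ne_zero t)
  refine det_gauge (fun i => blochPhase (M * k) (M * ℓ) ((s : ℤ) : ℂ) ((t : ℤ) : ℂ)
    (Edge.black (e i))) (fun i => hne _) _ _ ?_
  intro i j
  rw [discreteGreen_rep, black_proj, Matrix.of_apply, edgeEntry, kasteleynPlane_edge, mul_div_assoc,
    cross_eq_blochPhase (units_cast_ne_zero s) (units_cast_ne_zero t)]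
  have h1 := hne (Edge.black (e i))
  have h2 := hne (Edge.white (e j))
  have h3 : Edge.white (proj (M * k) (M * ℓ) (e j)) =
    vertexProj (M * k) (M * ℓ) (Edge.white (e j)) := rfl
  rw [h3, Function.comp, coverProj_proj]
  simp only [proj]
  field_simp

end Cover

/-! ### The inverse Kasteleyn matrix as a limit of Riemann sums -/

section Riemann

open MeasureTheory

theorem norm_riemann_sub_integral_le {g : ℝ → ℂ} (hg : Continuous g) {M : ℕ} (hM : M ≠ 0) {φ : ℝ}
    (hφ : φ ∈ Set.Icc (0 : ℝ) 1) {ε : ℝ}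
    (h : ∀ x ∈ Set.Icc (0 : ℝ) 1, ∀ y ∈ Set.Icc (0 : ℝ) 1, |x - y| ≤ 1 / M → ‖g x - g y‖ ≤ ε) :
    ‖(M : ℂ)⁻¹ * ∑ j ∈ range M, g ((j + φ) / M) - ∫ x in (0 : ℝ)..1, g x‖ ≤ ε := by
  have hM' : (0 : ℝ) < M := by exact_mod_cast Nat.pos_of_ne_zero hM
  have hMc : (M : ℂ) ≠ 0 := by exact_mod_cast hM
  have h1 : ∫ x in (0 : ℝ)..1, g x = ∑ j ∈ range M, ∫ x in ((j : ℝ) / M)..((j + 1 : ℕ) : ℝ) / M, g x := by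
    rw [intervalIntegral.sum_integral_adjacent_intervals (a := fun j : ℕ => (j : ℝ) / M)
      (fun j _ => hg.intervalIntegrable _ _)]
    simp [hM'.ne']
  have h2 : ∀ j ∈ range M, ‖(M : ℂ)⁻¹ * g ((j + φ) / M) -
      ∫ x in ((j : ℝ) / M)..((j + 1 : ℕ) : ℝ) / M, g x‖ ≤ ε / M := by
    intro j hj
    have hj' : (j : ℝ) + 1 ≤ M := by exact_mod_cast mem_range.mp hj
    have hj0 : (0 : ℝ) ≤ j := Nat.cast_nonneg j
    have hlen : ((j + 1 : ℕ) : ℝ) / M - (j : ℝ) / M = 1 / M := by push_cast; ring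
    have h3 : (M : ℂ)⁻¹ * g ((j + φ) / M) =
        ∫ x in ((j : ℝ) / M)..((j + 1 : ℕ) : ℝ) / M, g ((j + φ) / M) := by
      rw [intervalIntegral.integral_const, hlen, Complex.real_smul]
      push_cast; ring
    rw [h3, ← intervalIntegral.integral_sub (by simp) (hg.intervalIntegrable _ _)]
    have h4 := intervalIntegral.norm_integral_le_of_norm_le_const
      (f := fun x => g ((j + φ) / M) - g x) (C := ε) (a := (j : ℝ) / M)
      (b := ((j + 1 : ℕ) : ℝ) / M) ?_
    · refine h4.trans_eq ?_
      rw [hlen, abs_of_pos (by positivity)]; ring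
    · intro x hx
      rw [Set.uIoc_of_le (by push_cast; gcongr; linarith)] at hx
      have hx1 := hx.1
      have hx2 := hx.2
      push_cast at hx2
      rw [div_lt_iff₀ hM'] at hx1
      rw [le_div_iff₀ hM'] at hx2
      refine h _ ⟨?_, ?_⟩ _ ⟨?_, ?_⟩ ?_
      · have := hφ.1; positivity
      · rw [div_le_one hM']; linarith [hφ.2]
      · by_contra hneg
        push Not at hneg
        nlinarith
      · by_contra hneg
        push Not at hneg
        nlinarith
      · rw [le_div_iff₀ hM', ← abs_of_pos hM', ← abs_mul, sub_mul, abs_of_pos hM',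
          div_mul_cancel₀ _ hM'.ne', abs_le]
        constructor <;> linarith [hφ.1, hφ.2]
  rw [h1, Finset.mul_sum, ← Finset.sum_sub_distrib]
  refine (norm_sum_le _ _).trans ((Finset.sum_le_sum h2).trans_eq ?_)
  rw [Finset.sum_const, card_range, nsmul_eq_mul]
  field_simp

/-- Riemann sums over shifted square grids converge. -/
theorem tendsto_riemann_sum {F : ℝ → ℝ → ℂ} (hF : Continuous (Function.uncurry F)) {φ ψ : ℝ}
    (hφ : φ ∈ Set.Icc (0 : ℝ) 1) (hψ : ψ ∈ Set.Icc (0 : ℝ) 1) :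
    Filter.Tendsto (fun M : ℕ => (M : ℂ)⁻¹ * ∑ i ∈ range M, (M : ℂ)⁻¹ * ∑ j ∈ range M,
      F ((i + φ) / M) ((j + ψ) / M)) Filter.atTop
      (nhds (∫ x in (0 : ℝ)..1, ∫ y in (0 : ℝ)..1, F x y)) := by
  rw [Metric.tendsto_atTop]
  intro ε hε
  have hcpt : IsCompact (Set.Icc (0 : ℝ) 1 ×ˢ Set.Icc (0 : ℝ) 1) := isCompact_Icc.prod isCompact_Icc
  have huc := hcpt.uniformContinuousOn_of_continuous hF.continuousOn
  rw [Metric.uniformContinuousOn_iff] at huc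
  obtain ⟨δ, hδ, huc⟩ := huc (ε / 4) (by positivity)
  obtain ⟨N, hN⟩ := exists_nat_gt (1 / δ)
  refine ⟨N + 1, fun M hM => ?_⟩
  have hM0 : M ≠ 0 := by omega
  have hM' : (0 : ℝ) < M := by exact_mod_cast Nat.pos_of_ne_zero hM0
  have hMδ : 1 / (M : ℝ) < δ := by
    rw [div_lt_comm₀ hM' hδ]
    refine hN.trans ?_
    exact_mod_cast hM
  have hG : Continuous fun x => ∫ y in (0 : ℝ)..1, F x y :=
    intervalIntegral.continuous_parametric_intervalIntegral_of_continuous' hF 0 1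
  have hFx : ∀ x, Continuous (F x) := fun x => hF.comp (by fun_prop : Continuous fun y => (x, y))
  have hgrid : ∀ i ∈ range M, ((i : ℝ) + φ) / M ∈ Set.Icc (0 : ℝ) 1 := by
    intro i hi
    have hi' : (i : ℝ) + 1 ≤ M := by exact_mod_cast mem_range.mp hi
    have hi0 : (0 : ℝ) ≤ i := Nat.cast_nonneg i
    refine ⟨?_, ?_⟩
    · have := hφ.1; positivity
    · rw [div_le_one hM']; linarith [hφ.2]
  have a1 : ∀ i ∈ range M, ‖(M : ℂ)⁻¹ * ∑ j ∈ range M, F ((i + φ) / M) ((j + ψ) / M) -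
      ∫ y in (0 : ℝ)..1, F ((i + φ) / M) y‖ ≤ ε / 4 := by
    intro i hi
    refine norm_riemann_sub_integral_le (hFx _) hM0 hψ fun x hx y hy hxy => ?_
    rw [← dist_eq_norm]
    refine (huc (_, x) ⟨hgrid i hi, hx⟩ (_, y) ⟨hgrid i hi, hy⟩ ?_).le
    rw [Prod.dist_eq, dist_self, max_lt_iff]
    exact ⟨hδ, by rw [Real.dist_eq]; linarith⟩
  have a2 : ‖(M : ℂ)⁻¹ * ∑ i ∈ range M, (∫ y in (0 : ℝ)..1, F ((i + φ) / M) y) -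
      ∫ x in (0 : ℝ)..1, ∫ y in (0 : ℝ)..1, F x y‖ ≤ ε / 4 := by
    refine norm_riemann_sub_integral_le hG hM0 hφ fun x hx y hy hxy => ?_
    rw [← intervalIntegral.integral_sub ((hFx x).intervalIntegrable _ _)
      ((hFx y).intervalIntegrable _ _)]
    have := intervalIntegral.norm_integral_le_of_norm_le_const
      (f := fun t => F x t - F y t) (C := ε / 4) (a := 0) (b := 1) ?_
    · simpa using this
    · intro t ht
      rw [Set.uIoc_of_le zero_le_one] at ht
      rw [← dist_eq_norm]
      refine (huc (x, t) ⟨hx, ht.1.le, ht.2⟩ (y, t) ⟨hy, ht.1.le, ht.2⟩ ?_).le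
      rw [Prod.dist_eq, dist_self, max_lt_iff]
      exact ⟨by rw [Real.dist_eq]; linarith, hδ⟩
  have a3 : ‖(M : ℂ)⁻¹ * ∑ i ∈ range M, (M : ℂ)⁻¹ * ∑ j ∈ range M, F ((i + φ) / M) ((j + ψ) / M) -
      (M : ℂ)⁻¹ * ∑ i ∈ range M, (∫ y in (0 : ℝ)..1, F ((i + φ) / M) y)‖ ≤ ε / 4 := by
    rw [← mul_sub, ← Finset.sum_sub_distrib, norm_mul, norm_inv, Complex.norm_natCast]
    have := (norm_sum_le (range M) _).trans (Finset.sum_le_sum a1)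
    rw [Finset.sum_const, card_range, nsmul_eq_mul] at this
    rw [inv_mul_le_iff₀ hM']
    exact this
  rw [dist_eq_norm]
  have := norm_sub_le_norm_sub_add_norm_sub
    ((M : ℂ)⁻¹ * ∑ i ∈ range M, (M : ℂ)⁻¹ * ∑ j ∈ range M, F ((i + φ) / M) ((j + ψ) / M))
    ((M : ℂ)⁻¹ * ∑ i ∈ range M, (∫ y in (0 : ℝ)..1, F ((i + φ) / M) y))
    (∫ x in (0 : ℝ)..1, ∫ y in (0 : ℝ)..1, F x y)
  linarith

variable {k ℓ : ℕ} [NeZero k] [NeZero ℓ]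

theorem circleIntegral_div_self {f : ℂ → ℂ} {R : ℝ} (hR : R ≠ 0) :
    (∮ z in C(0, R), f z / z) =
      2 * Real.pi * Complex.I * ∫ u in (0 : ℝ)..1, f (circleMap 0 R (2 * Real.pi * u)) := by
  have h1 := intervalIntegral.integral_comp_mul_left (a := 0) (b := 1)
    (fun θ => f (circleMap 0 R θ)) (c := 2 * Real.pi) (by positivity)
  rw [h1, circleIntegral]
  simp only [mul_zero, mul_one, Complex.real_smul, deriv_circleMap, smul_eq_mul]
  rw [← intervalIntegral.integral_const_mul, ← intervalIntegral.integral_const_mul]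
  refine intervalIntegral.integral_congr fun θ _ => ?_
  have h2 : circleMap 0 R θ ≠ 0 := circleMap_ne_center hR
  have h3 : (Real.pi : ℂ) ≠ 0 := by exact_mod_cast Real.pi_ne_zero
  push_cast
  field_simp

/-- The inverse Kasteleyn matrix as the mean of its integrand over a torus. -/
theorem inverseKasteleyn_eq (c : TorusEdge k ℓ → ℝ) {r s : ℝ} (hr : r ≠ 0) (hs : s ≠ 0)
    (b x : ℤ × ℤ) : inverseKasteleyn c r s b x =
      ∫ u in (0 : ℝ)..1, ∫ v in (0 : ℝ)..1, greenIntegrand c b x (circleMap 0 r (2 * Real.pi * u))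
        (circleMap 0 s (2 * Real.pi * v)) := by
  unfold inverseKasteleyn
  have h1 : ∀ ζ ∈ Metric.sphere (0 : ℂ) |r|, (∮ ω in C(0, s), (kasteleynTorus c ζ ω)⁻¹
      ((b.1 : ZMod ℓ), (b.2 : ZMod k)) ((x.1 : ZMod ℓ), (x.2 : ZMod k)) *
        (ζ ^ (x.2 / (k : ℤ) - b.2 / (k : ℤ)) / ω ^ (x.1 / (ℓ : ℤ) - b.1 / (ℓ : ℤ))) / ω / ζ) =
      (2 * Real.pi * Complex.I * ∫ v in (0 : ℝ)..1,
        greenIntegrand c b x ζ (circleMap 0 s (2 * Real.pi * v))) / ζ := by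
    intro ζ hζ
    have hζ0 : ζ ≠ 0 := by
      rintro rfl
      simp at hζ
      exact hr (abs_eq_zero.mp hζ.symm)
    have h2 : ∀ ω ∈ Metric.sphere (0 : ℂ) |s|, (kasteleynTorus c ζ ω)⁻¹
      ((b.1 : ZMod ℓ), (b.2 : ZMod k)) ((x.1 : ZMod ℓ), (x.2 : ZMod k)) *
        (ζ ^ (x.2 / (k : ℤ) - b.2 / (k : ℤ)) / ω ^ (x.1 / (ℓ : ℤ) - b.1 / (ℓ : ℤ))) / ω / ζ =
        ζ⁻¹ * greenIntegrand c b x ζ ω / ω := by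
      intro ω hω
      have hω0 : ω ≠ 0 := by
        rintro rfl
        simp at hω
        exact hs (abs_eq_zero.mp hω.symm)
      rw [greenIntegrand, blochPhase, blochPhase, zpow_sub₀ hζ0, zpow_sub₀ hω0]
      have e1 := zpow_ne_zero (x.2 / (k : ℤ)) hζ0
      have e2 := zpow_ne_zero (b.2 / (k : ℤ)) hζ0
      have e3 := zpow_ne_zero (x.1 / (ℓ : ℤ)) hω0
      have e4 := zpow_ne_zero (b.1 / (ℓ : ℤ)) hω0
      simp only [vertexProj]
      field_simp
    have h3 : (∮ ω in C(0, s), (kasteleynTorus c ζ ω)⁻¹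
      ((b.1 : ZMod ℓ), (b.2 : ZMod k)) ((x.1 : ZMod ℓ), (x.2 : ZMod k)) *
        (ζ ^ (x.2 / (k : ℤ) - b.2 / (k : ℤ)) / ω ^ (x.1 / (ℓ : ℤ) - b.1 / (ℓ : ℤ))) / ω / ζ) =
        ∮ ω in C(0, s), ζ⁻¹ * greenIntegrand c b x ζ ω / ω :=
      intervalIntegral.integral_congr fun θ _ => by
        simp only
        rw [h2 _ (circleMap_mem_sphere' 0 s θ)]
    rw [h3, circleIntegral_div_self (f := fun ω => ζ⁻¹ * greenIntegrand c b x ζ ω) hs,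
      intervalIntegral.integral_const_mul]
    ring
  have h4 : (∮ ζ in C(0, r), ∮ ω in C(0, s), (kasteleynTorus c ζ ω)⁻¹
      ((b.1 : ZMod ℓ), (b.2 : ZMod k)) ((x.1 : ZMod ℓ), (x.2 : ZMod k)) *
        (ζ ^ (x.2 / (k : ℤ) - b.2 / (k : ℤ)) / ω ^ (x.1 / (ℓ : ℤ) - b.1 / (ℓ : ℤ))) / ω / ζ) =
      ∮ ζ in C(0, r), (2 * Real.pi * Complex.I * ∫ v in (0 : ℝ)..1,
        greenIntegrand c b x ζ (circleMap 0 s (2 * Real.pi * v))) / ζ :=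
    intervalIntegral.integral_congr fun θ _ => by
      simp only
      rw [h1 _ (circleMap_mem_sphere' 0 r θ)]
  rw [h4, circleIntegral_div_self (f := fun ζ => 2 * Real.pi * Complex.I * ∫ v in (0 : ℝ)..1,
    greenIntegrand c b x ζ (circleMap 0 s (2 * Real.pi * v))) hr,
    intervalIntegral.integral_const_mul]
  have h3 : (Real.pi : ℂ) ≠ 0 := by exact_mod_cast Real.pi_ne_zero
  field_simp

theorem continuousAt_matrix_inv {n : Type*} [Fintype n] [DecidableEq n] {A : Matrix n n ℂ}
    (hA : A.det ≠ 0) : ContinuousAt (fun B : Matrix n n ℂ => B⁻¹) A := by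
  simp only [Matrix.inv_def, Ring.inverse_eq_inv']
  exact (continuous_id.matrix_det.continuousAt.inv₀ hA).smul
    continuous_id.matrix_adjugate.continuousAt

omit [NeZero k] [NeZero ℓ] in
theorem continuousAt_kasteleynTorus {c : TorusEdge k ℓ → ℝ} {z w : ℂ} (hz : z ≠ 0) (hw : w ≠ 0) :
    ContinuousAt (fun q : (TorusEdge k ℓ → ℝ) × ℂ × ℂ => kasteleynTorus q.1 q.2.1 q.2.2)
      (c, z, w) := by
  refine continuousAt_pi.mpr fun v => continuousAt_pi.mpr fun b => ?_
  simp only [kasteleynTorus, Matrix.of_apply]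
  refine tendsto_finsetSum _ fun d _ => ?_
  split_ifs
  · refine ContinuousAt.div (ContinuousAt.mul (ContinuousAt.mul ?_ continuousAt_const) ?_) ?_
      (zpow_ne_zero _ hz)
    · exact (Complex.continuous_ofReal.comp
        ((continuous_apply (v, d)).comp continuous_fst)).continuousAt
    · exact ContinuousAt.zpow₀ (continuous_snd.comp continuous_snd).continuousAt _ (Or.inl hw)
    · exact ContinuousAt.zpow₀ (continuous_fst.comp continuous_snd).continuousAt _ (Or.inl hz)
  · exact continuousAt_const

theorem continuousAt_greenIntegrand {c : TorusEdge k ℓ → ℝ} {z w : ℂ} (hz : z ≠ 0) (hw : w ≠ 0)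
    (hdet : (kasteleynTorus c z w).det ≠ 0) (b x : ℤ × ℤ) :
    ContinuousAt (fun q : (TorusEdge k ℓ → ℝ) × ℂ × ℂ => greenIntegrand q.1 b x q.2.1 q.2.2)
      (c, z, w) := by
  have hphase : ∀ y : ℤ × ℤ, ContinuousAt (fun q : (TorusEdge k ℓ → ℝ) × ℂ × ℂ =>
      blochPhase k ℓ q.2.1 q.2.2 y) (c, z, w) := fun y =>
    ContinuousAt.div
      (ContinuousAt.zpow₀ (continuous_snd.comp continuous_snd).continuousAt _ (Or.inl hw))
      (ContinuousAt.zpow₀ (continuous_fst.comp continuous_snd).continuousAt _ (Or.inl hz))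
      (zpow_ne_zero _ hz)
  have hinv : ContinuousAt (fun q : (TorusEdge k ℓ → ℝ) × ℂ × ℂ =>
      (kasteleynTorus q.1 q.2.1 q.2.2)⁻¹) (c, z, w) :=
    ContinuousAt.comp (f := fun q : (TorusEdge k ℓ → ℝ) × ℂ × ℂ => kasteleynTorus q.1 q.2.1 q.2.2)
      (continuousAt_matrix_inv hdet) (continuousAt_kasteleynTorus hz hw)
  have hentry := continuousAt_pi.mp (continuousAt_pi.mp hinv (vertexProj k ℓ b)) (vertexProj k ℓ x)
  exact hentry.mul ((hphase b).div (hphase x) (blochPhase_ne_zero hz hw x))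

theorem circleMap_one_ne_zero (θ : ℝ) : circleMap 0 1 θ ≠ 0 := circleMap_ne_center one_ne_zero

theorem norm_circleMap_one (θ : ℝ) : ‖circleMap 0 1 θ‖ = 1 := by simp

theorem spinAngle_mem (s : ℤˣ) : spinAngle s ∈ Set.Icc (0 : ℝ) 1 := by
  unfold spinAngle; split_ifs <;> norm_num

theorem continuous_greenIntegrand_circleMap {c : TorusEdge k ℓ → ℝ}
    (hdet : ∀ z w : ℂ, ‖z‖ = 1 → ‖w‖ = 1 → (kasteleynTorus c z w).det ≠ 0) (b x : ℤ × ℤ) :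
    Continuous (Function.uncurry fun u v : ℝ => greenIntegrand c b x
      (circleMap 0 1 (2 * Real.pi * u)) (circleMap 0 1 (2 * Real.pi * v))) := by
  refine continuous_iff_continuousAt.mpr fun q => ?_
  have hq : Continuous fun q : ℝ × ℝ => (c, circleMap 0 1 (2 * Real.pi * q.1),
      circleMap 0 1 (2 * Real.pi * q.2)) := by
    have := continuous_circleMap 0 1
    fun_prop
  exact ContinuousAt.comp (f := fun q : ℝ × ℝ => (c, circleMap 0 1 (2 * Real.pi * q.1),
      circleMap 0 1 (2 * Real.pi * q.2)))
    (continuousAt_greenIntegrand (circleMap_one_ne_zero _) (circleMap_one_ne_zero _)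
      (hdet _ _ (norm_circleMap_one _) (norm_circleMap_one _)) b x) hq.continuousAt

/-- The discrete Green functions converge to the inverse Kasteleyn matrix of the plane, whatever
the boundary conditions. -/
theorem tendsto_discreteGreen (c : TorusEdge k ℓ → ℝ)
    (hdet : ∀ z w : ℂ, ‖z‖ = 1 → ‖w‖ = 1 → (kasteleynTorus c z w).det ≠ 0) (s t : ℤˣ)
    (b x : ℤ × ℤ) : Filter.Tendsto (fun M : ℕ => discreteGreen c M s t b x) Filter.atTop
      (nhds (inverseKasteleyn c 1 1 b x)) := by
  rw [inverseKasteleyn_eq c one_ne_zero one_ne_zero]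
  refine (tendsto_riemann_sum (continuous_greenIntegrand_circleMap hdet b x)
    (spinAngle_mem s) (spinAngle_mem t)).congr fun M => ?_
  have : ∀ (φ : ℝ) (j : ℕ), circleMap 0 1 (2 * Real.pi * ((j + φ) / M)) = rootPoint M φ j := by
    intro φ j
    simp [circleMap, rootPoint]
  simp only [discreteGreen, this]

end Riemann

/-! ### Limits of random configurations -/

section Configurations

open MeasureTheory

theorem existsUnique_white_iff {X Y : Type} [AddMonoidWithOne X] [AddMonoidWithOne Y]
    (D : Set (Edge X Y)) (v : X × Y) :
    (∃! e : Edge X Y, e ∈ D ∧ Edge.white e = v) ↔ ∃! d : Dir, ((v, d) : Edge X Y) ∈ D := by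
  constructor
  · rintro ⟨⟨x, d⟩, ⟨h1, h2⟩, h3⟩
    obtain rfl : x = v := h2
    exact ⟨d, h1, fun d' hd' => congrArg Prod.snd (h3 (x, d') ⟨hd', rfl⟩)⟩
  · rintro ⟨d, h1, h2⟩
    refine ⟨(v, d), ⟨h1, rfl⟩, ?_⟩
    rintro ⟨x, d'⟩ ⟨h3, h4⟩
    obtain rfl : x = v := h4
    rw [h2 d' h3]

theorem existsUnique_black_iff {X Y : Type} [AddGroupWithOne X] [AddGroupWithOne Y]
    (D : Set (Edge X Y)) (v : X × Y) :
    (∃! e : Edge X Y, e ∈ D ∧ Edge.black e = v) ↔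
      ∃! d : Dir, ((v - d.shift, d) : Edge X Y) ∈ D := by
  have key : ∀ (x : X × Y) (d : Dir), Edge.black ((x, d) : Edge X Y) = v ↔ x = v - d.shift := by
    intro x d
    rw [eq_sub_iff_add_eq]
    rfl
  constructor
  · rintro ⟨⟨x, d⟩, ⟨h1, h2⟩, h3⟩
    rw [key] at h2
    subst h2
    exact ⟨d, h1, fun d' hd' => congrArg Prod.snd (h3 (v - d'.shift, d') ⟨hd', (key _ _).mpr rfl⟩)⟩
  · rintro ⟨d, h1, h2⟩
    refine ⟨(v - d.shift, d), ⟨h1, (key _ _).mpr rfl⟩, ?_⟩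
    rintro ⟨x, d'⟩ ⟨h3, h4⟩
    rw [key] at h4
    subst h4
    rw [h2 d' h3]

/-- The edges occupied in a configuration of the plane. -/
def occupied (x : LatticeEdge → Bool) : Set LatticeEdge := {e | x e = true}

theorem measurable_occupied : Measurable occupied := by
  rw [measurable_set_iff]
  intro e
  exact (measurable_from_top (f := fun b : Bool => b = true)).comp (measurable_pi_apply e)

theorem measurableSet_mem (e : LatticeEdge) : MeasurableSet {D : Set LatticeEdge | e ∈ D} :=
  measurableSet_setOfPred.mpr (measurable_set_mem e)

theorem measurableSet_existsUnique_dir (f : Dir → LatticeEdge) :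
    MeasurableSet {D : Set LatticeEdge | ∃! d : Dir, f d ∈ D} := by
  have : {D : Set LatticeEdge | ∃! d : Dir, f d ∈ D} =
      ⋃ d : Dir, ({D | f d ∈ D} ∩ ⋂ d' : Dir, ({D | f d' ∉ D} ∪ {_D | d' = d})) := by
    ext D
    simp only [ExistsUnique, Set.mem_ofPred_eq, Set.mem_iUnion, Set.mem_inter_iff, Set.mem_iInter,
      Set.mem_union]
    refine exists_congr fun d => and_congr_right fun _ => forall_congr' fun d' => ?_
    tauto
  rw [this]
  refine MeasurableSet.iUnion fun d => (measurableSet_mem _).inter (MeasurableSet.iInter fun d' => ?_)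
  exact (measurableSet_mem (f d')).compl.union (MeasurableSet.const _)

instance : Countable Dir := Finite.to_countable

theorem measurableSet_isDimerCover (E : Set LatticeEdge) :
    MeasurableSet {D : Set LatticeEdge | IsDimerCover E D} := by
  have : {D : Set LatticeEdge | IsDimerCover E D} =
      (⋂ e : LatticeEdge, ({D | e ∉ D} ∪ {_D | e ∈ E})) ∩
      ((⋂ v : ℤ × ℤ, {D | ∃! d : Dir, ((v, d) : LatticeEdge) ∈ D}) ∩
        ⋂ v : ℤ × ℤ, {D | ∃! d : Dir, ((v - d.shift, d) : LatticeEdge) ∈ D}) := by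
    ext D
    simp only [IsDimerCover, existsUnique_white_iff, existsUnique_black_iff, Set.mem_ofPred_eq,
      Set.mem_inter_iff, Set.mem_iInter, Set.mem_union]
    refine and_congr_left fun _ => forall_congr' fun e => ?_
    tauto
  rw [this]
  refine (MeasurableSet.iInter fun e => ?_).inter ((MeasurableSet.iInter fun v => ?_).inter
    (MeasurableSet.iInter fun v => ?_))
  · exact (measurableSet_mem e).compl.union (MeasurableSet.const _)
  · exact measurableSet_existsUnique_dir fun d => (v, d)
  · exact measurableSet_existsUnique_dir fun d => (v - d.shift, d)

/-- A limit of laws of random configurations, along which the occupation probabilities converge and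
which see only dimer covers with edges in `E`, defines a measure on dimer covers. -/
theorem exists_measure_of_tendsto (E : Set LatticeEdge)
    (P : ℕ → ProbabilityMeasure (LatticeEdge → Bool))
    (hP : ∀ n, ∀ᵐ x ∂(P n : Measure (LatticeEdge → Bool)), IsDimerCover E (occupied x))
    (ρ : ∀ p : ℕ, (Fin p → LatticeEdge) → ℂ)
    (hρ : ∀ (p : ℕ) (e : Fin p → LatticeEdge), Function.Injective e → Filter.Tendsto
      (fun n => (((P n : Measure (LatticeEdge → Bool)).real {x | ∀ s, x (e s) = true} : ℝ) : ℂ))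
      Filter.atTop (nhds (ρ p e))) :
    ∃ Q : Measure (DimerCover E), IsProbabilityMeasure Q ∧
      ∀ (p : ℕ) (e : Fin p → LatticeEdge), Function.Injective e →
        ((Q.real (covered e) : ℝ) : ℂ) = ρ p e := by
  -- The laws are probability measures on a compact space, so they have a limit along an ultrafilter.
  -- Cylinder events are clopen, so their probabilities pass to the limit.
  set U : Ultrafilter ℕ := Filter.hyperfilter ℕ
  have hU : (U : Filter ℕ) ≤ Filter.atTop := Nat.hyperfilter_le_atTop
  set L := (U.map P).lim
  have hL : Filter.Tendsto P U (nhds L) := (U.map P).le_nhds_lim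
  have hclopen : ∀ A : Set (LatticeEdge → Bool), IsClopen A → Filter.Tendsto
      (fun n => (P n : Measure (LatticeEdge → Bool)).real A) U
      (nhds ((L : Measure (LatticeEdge → Bool)).real A)) := by
    intro A hA
    have := ProbabilityMeasure.tendsto_measure_of_isClopen_of_tendsto hL hA
    exact (NNReal.continuous_coe.tendsto _).comp this
  -- Being a dimer cover is a countable conjunction of clopen conditions, one for each edge and each
  -- vertex.
  have hone : ∀ A : Set (LatticeEdge → Bool), IsClopen A →
      (∀ x, IsDimerCover E (occupied x) → x ∈ A) →
      ∀ᵐ x ∂(L : Measure (LatticeEdge → Bool)), x ∈ A := by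
    intro A hA hx
    have h1 : ∀ n, (P n : Measure (LatticeEdge → Bool)).real A = 1 := by
      intro n
      rw [measureReal_def, (mem_ae_iff_prob_eq_one hA.1.measurableSet).mp, ENNReal.toReal_one]
      filter_upwards [hP n] with x h using hx x h
    have h2 := hclopen A hA
    simp_rw [h1] at h2
    have h3 := tendsto_nhds_unique h2 tendsto_const_nhds
    refine (mem_ae_iff_prob_eq_one hA.1.measurableSet).mpr ?_
    rw [← ENNReal.toReal_eq_one_iff]
    exact h3
  have hcover : ∀ᵐ x ∂(L : Measure (LatticeEdge → Bool)), IsDimerCover E (occupied x) := by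
    have hdisc : ∀ (f : Dir → LatticeEdge) (S : Set (Dir → Bool)),
        IsClopen {x : LatticeEdge → Bool | (fun d => x (f d)) ∈ S} := by
      intro f S
      exact (isClopen_discrete S).preimage (by fun_prop : Continuous fun x : LatticeEdge → Bool =>
        (fun d : Dir => x (f d)))
    have h1 : ∀ᵐ x ∂(L : Measure (LatticeEdge → Bool)), ∀ e : LatticeEdge,
        e ∉ E → x e = false := by
      rw [ae_all_iff]
      intro e
      by_cases he : e ∈ E
      · simp [he]
      · refine (hone {x | x e = false} ?_ ?_).mono fun x hx _ => hx
        · exact hdisc (fun _ => e) {y | y Dir.west = false}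
        · intro x hx
          by_contra h
          exact he (hx.1 (by simpa [occupied] using h))
    have h2 : ∀ᵐ x ∂(L : Measure (LatticeEdge → Bool)), ∀ v : ℤ × ℤ,
        ∃! d : Dir, ((v, d) : LatticeEdge) ∈ occupied x := by
      rw [ae_all_iff]
      intro v
      refine hone {x | ∃! d : Dir, ((v, d) : LatticeEdge) ∈ occupied x} ?_ ?_
      · exact hdisc (fun d => (v, d)) {y | ∃! d : Dir, y d = true}
      · intro x hx
        exact (existsUnique_white_iff _ v).mp (hx.2.1 v)
    have h3 : ∀ᵐ x ∂(L : Measure (LatticeEdge → Bool)), ∀ v : ℤ × ℤ,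
        ∃! d : Dir, ((v - d.shift, d) : LatticeEdge) ∈ occupied x := by
      rw [ae_all_iff]
      intro v
      refine hone {x | ∃! d : Dir, ((v - d.shift, d) : LatticeEdge) ∈ occupied x} ?_ ?_
      · exact hdisc (fun d => (v - d.shift, d)) {y | ∃! d : Dir, y d = true}
      · intro x hx
        exact (existsUnique_black_iff _ v).mp (hx.2.2 v)
    filter_upwards [h1, h2, h3] with x h1 h2 h3
    refine ⟨fun e he => ?_, fun v => (existsUnique_white_iff _ v).mpr (h2 v),
      fun v => (existsUnique_black_iff _ v).mpr (h3 v)⟩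
    by_contra hE
    have := h1 e hE
    simp [occupied, this] at he
  set Q' : Measure (Set LatticeEdge) := (L : Measure (LatticeEdge → Bool)).map occupied
  have hQ'prob : IsProbabilityMeasure Q' :=
    Measure.isProbabilityMeasure_map measurable_occupied.aemeasurable
  have hQ' : ∀ᵐ D ∂Q', IsDimerCover E D :=
    (ae_map_iff measurable_occupied.aemeasurable (measurableSet_isDimerCover E)).mpr hcover
  have hemb : MeasurableEmbedding (Subtype.val : DimerCover E → Set LatticeEdge) :=
    MeasurableEmbedding.subtype_coe (measurableSet_isDimerCover E)
  have hQ : ∀ S : Set (Set LatticeEdge), (Q'.comap (Subtype.val : DimerCover E → Set LatticeEdge))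
      (Subtype.val ⁻¹' S) = Q' S := by
    intro S
    rw [hemb.comap_apply]
    refine (congrArg Q' (Subtype.image_preimage_coe {D : Set LatticeEdge | IsDimerCover E D} S)).trans ?_
    refine measure_congr ?_
    filter_upwards [hQ'] with D hD
    exact propext ⟨fun h => h.2, fun h => ⟨hD, h⟩⟩
  refine ⟨Q'.comap Subtype.val, ⟨?_⟩, fun p e he => ?_⟩
  · have := hQ Set.univ
    rw [Set.preimage_univ] at this
    rw [this, measure_univ]
  · have h1 : (covered e : Set (DimerCover E)) =
        Subtype.val ⁻¹' {D : Set LatticeEdge | ∀ s, e s ∈ D} := rfl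
    have hmeas : MeasurableSet {D : Set LatticeEdge | ∀ s, e s ∈ D} := by
      have : {D : Set LatticeEdge | ∀ s, e s ∈ D} = ⋂ s, {D | e s ∈ D} := by ext; simp
      rw [this]
      exact MeasurableSet.iInter fun s => measurableSet_mem _
    rw [measureReal_def, h1, hQ, Measure.map_apply measurable_occupied hmeas]
    have hcl : IsClopen {x : LatticeEdge → Bool | ∀ s, x (e s) = true} :=
      (isClopen_discrete {y : Fin p → Bool | ∀ s, y s = true}).preimage
        (by fun_prop : Continuous fun x : LatticeEdge → Bool => (fun s : Fin p => x (e s)))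
    have h2 := (Complex.continuous_ofReal.tendsto _).comp (hclopen _ hcl)
    exact tendsto_nhds_unique h2 ((hρ p e he).mono_left hU)

end Configurations

/-! ### Determinantal measures on the plane -/

section TorusLaw

open MeasureTheory

variable {k ℓ : ℕ} [NeZero k] [NeZero ℓ]

/-- The periodic configuration of the plane given by a choice of edges on the torus. -/
noncomputable def periodicConfig (d : ZMod ℓ × ZMod k → Dir) (e : LatticeEdge) : Bool :=
  decide (d (vertexProj k ℓ (Edge.white e)) = e.2)

omit [NeZero k] [NeZero ℓ] in
theorem isDimerCover_periodicConfig {d : ZMod ℓ × ZMod k → Dir} (hd : IsCoverFun d)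
    {E : Set LatticeEdge} (hE : ∀ e, d (vertexProj k ℓ (Edge.white e)) = e.2 → e ∈ E) :
    IsDimerCover E (occupied (periodicConfig d)) := by
  have hmem : ∀ (x : ℤ × ℤ) (δ : Dir), (x, δ) ∈ occupied (periodicConfig d) ↔
      d (vertexProj k ℓ x) = δ := fun x δ => decide_eq_true_iff
  refine ⟨fun e he => hE e ((hmem e.1 e.2).mp he), fun v => ?_, fun v => ?_⟩
  · rw [existsUnique_white_iff]
    simp only [hmem]
    exact ⟨_, rfl, fun _ h => h.symm⟩
  · rw [existsUnique_black_iff]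
    simp only [hmem]
    have hsub : ∀ δ : Dir, vertexProj k ℓ (v - δ.shift) = vertexProj k ℓ v - δ.shift := by
      intro δ
      cases δ <;> simp [vertexProj, Dir.shift]
    simp only [hsub]
    obtain ⟨u, hu⟩ := hd.2 (vertexProj k ℓ v)
    simp only at hu
    refine ⟨d u, ?_, fun δ hδ => ?_⟩
    · simp only
      rw [← hu, add_sub_cancel_right]
    · have h1 : vertexProj k ℓ v - δ.shift = u := by
        apply hd.1
        simp only
        rw [hδ, hu, sub_add_cancel]
      rw [← hδ, h1]

theorem norm_det_le_partitionFunction {c : TorusEdge k ℓ → ℝ} (hc : ∀ e, 0 ≤ c e) {z w : ℂ}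
    (hz : ‖z‖ = 1) (hw : ‖w‖ = 1) : ‖(kasteleynTorus c z w).det‖ ≤ partitionFunction c := by
  have hz0 : z ≠ 0 := fun h => by simp [h] at hz
  have hw0 : w ≠ 0 := fun h => by simp [h] at hw
  rw [det_kasteleynTorus c z w hz0 hw0, partitionFunction]
  refine (norm_sum_le _ _).trans (Finset.sum_le_sum fun d _ => ?_)
  split_ifs
  · simp only [norm_mul, norm_pow, norm_neg, norm_one, one_pow, one_mul, norm_div, norm_zpow, hz,
      hw, one_zpow, div_one, Complex.norm_real, Real.norm_eq_abs]
    rw [abs_of_nonneg (Finset.prod_nonneg fun v _ => hc _)]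
  · simp

/-- The probability of a dimer cover under the Boltzmann measure of the torus. -/
noncomputable def torusProb (c : TorusEdge k ℓ → ℝ) (d : ZMod ℓ × ZMod k → Dir) : ℝ :=
  (if IsCoverFun d then ∏ v, c (v, d v) else 0) / partitionFunction c

/-- The law of the periodic configuration of a random dimer cover of the torus. -/
noncomputable def torusLaw (c : TorusEdge k ℓ → ℝ) : Measure (LatticeEdge → Bool) :=
  ∑ d : ZMod ℓ × ZMod k → Dir, ENNReal.ofReal (torusProb c d) • Measure.dirac (periodicConfig d)

theorem torusProb_nonneg {c : TorusEdge k ℓ → ℝ} (hc : ∀ e, 0 ≤ c e) (d : ZMod ℓ × ZMod k → Dir) :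
    0 ≤ torusProb c d := by
  have h : ∀ d : ZMod ℓ × ZMod k → Dir, 0 ≤ (if IsCoverFun d then ∏ v, c (v, d v) else 0) := by
    intro d
    split_ifs
    · exact Finset.prod_nonneg fun v _ => hc _
    · exact le_rfl
  exact div_nonneg (h d) (Finset.sum_nonneg fun d _ => h d)

theorem torusLaw_apply (c : TorusEdge k ℓ → ℝ) {A : Set (LatticeEdge → Bool)}
    (hA : MeasurableSet A) [DecidablePred (· ∈ A)] : torusLaw c A =
      ∑ d : ZMod ℓ × ZMod k → Dir, if periodicConfig d ∈ A then ENNReal.ofReal (torusProb c d)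
        else 0 := by
  simp only [torusLaw, Measure.coe_finsetSum, Finset.sum_apply, Measure.smul_apply,
    Measure.dirac_apply' _ hA, smul_eq_mul]
  refine Finset.sum_congr rfl fun d _ => ?_
  by_cases h : periodicConfig d ∈ A <;> simp [h]

theorem torusLaw_real {c : TorusEdge k ℓ → ℝ} (hc : ∀ e, 0 ≤ c e) {A : Set (LatticeEdge → Bool)}
    (hA : MeasurableSet A) [DecidablePred (· ∈ A)] : (torusLaw c).real A =
      ∑ d : ZMod ℓ × ZMod k → Dir, if periodicConfig d ∈ A then torusProb c d else 0 := by
  rw [measureReal_def, torusLaw_apply c hA, ENNReal.toReal_sum]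
  · refine Finset.sum_congr rfl fun d _ => ?_
    split_ifs
    · rw [ENNReal.toReal_ofReal (torusProb_nonneg hc d)]
    · rfl
  · intro d _
    split_ifs <;> simp

theorem sum_torusProb {c : TorusEdge k ℓ → ℝ} (hZ : partitionFunction c ≠ 0) :
    ∑ d, torusProb c d = 1 := by
  simp only [torusProb]
  rw [← Finset.sum_div]
  exact div_self hZ

theorem isProbabilityMeasure_torusLaw {c : TorusEdge k ℓ → ℝ} (hc : ∀ e, 0 ≤ c e)
    (hZ : partitionFunction c ≠ 0) : IsProbabilityMeasure (torusLaw c) := by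
  constructor
  classical
  rw [torusLaw_apply c MeasurableSet.univ]
  simp only [Set.mem_univ, if_true]
  rw [← ENNReal.ofReal_sum_of_nonneg fun d _ => torusProb_nonneg hc d, sum_torusProb hZ,
    ENNReal.ofReal_one]

theorem ae_torusLaw {c : TorusEdge k ℓ → ℝ} {E : Set LatticeEdge}
    (hE : ∀ e : LatticeEdge, e ∉ E → c (proj k ℓ e) = 0) :
    ∀ᵐ x ∂(torusLaw c), IsDimerCover E (occupied x) := by
  classical
  rw [ae_iff]
  refine (torusLaw_apply c ((measurable_occupied (measurableSet_isDimerCover E)).compl)).trans ?_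
  refine Finset.sum_eq_zero fun d _ => ?_
  split_ifs with h
  · rw [ENNReal.ofReal_eq_zero]
    refine le_of_eq ?_
    rw [torusProb]
    by_cases hd : IsCoverFun d
    · have h1 : ∃ e : LatticeEdge, d (vertexProj k ℓ (Edge.white e)) = e.2 ∧ e ∉ E := by
        by_contra hcon
        push Not at hcon
        exact h (isDimerCover_periodicConfig hd hcon)
      obtain ⟨e, he, heE⟩ := h1
      rw [if_pos hd, Finset.prod_eq_zero (mem_univ (vertexProj k ℓ (Edge.white e))), zero_div]
      rw [he]
      exact hE e heE
    · rw [if_neg hd, zero_div]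
  · rfl

/-- The determinant that gives the correlations of a tuple of edges of the plane, for the Kasteleyn
matrix `K` and its inverse `G`. -/
noncomputable def edgeDet (K G : ℤ × ℤ → ℤ × ℤ → ℂ) {p : ℕ} (e : Fin p → LatticeEdge) : ℂ :=
  (Matrix.of fun s s' : Fin p => K (Edge.white (e s')) (Edge.black (e s')) *
    G (Edge.black (e s)) (Edge.white (e s'))).det

theorem edgeDet_eq_zero_of_white_eq (K G : ℤ × ℤ → ℤ × ℤ → ℂ) {p : ℕ} (e : Fin p → LatticeEdge)
    {s t : Fin p} (hst : s ≠ t) (h : Edge.white (e s) = Edge.white (e t)) : edgeDet K G e = 0 := by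
  have := Matrix.det_mul_row (fun s' => K (Edge.white (e s')) (Edge.black (e s')))
    (Matrix.of fun s s' : Fin p => G (Edge.black (e s)) (Edge.white (e s')))
  simp only [Matrix.of_apply] at this
  rw [edgeDet, this, Matrix.det_zero_of_column_eq hst, mul_zero]
  intro i
  simp [h]

variable (c : TorusEdge k ℓ → ℝ)

/-- The periodic Kasteleyn matrix of a cover is invertible, so the cover has dimer covers of positive
weight. -/
theorem partitionFunction_cover_ne_zero (M : ℕ) [NeZero M] (hc : ∀ e, 0 ≤ c e)
    (hdet : ∀ z w : ℂ, ‖z‖ = 1 → ‖w‖ = 1 → (kasteleynTorus c z w).det ≠ 0) :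
    partitionFunction (c ∘ coverProj M k ℓ) ≠ 0 := by
  intro hZ
  have h1 := inv_kasteleynTorus_cover M c hdet 1 1
  have h2 : (kasteleynTorus (c ∘ coverProj M k ℓ) ((1 : ℤˣ) : ℤ) ((1 : ℤˣ) : ℤ)).det = 0 := by
    have := norm_det_le_partitionFunction (c := c ∘ coverProj M k ℓ) (fun e => hc _)
      (z := ((1 : ℤˣ) : ℤ)) (w := ((1 : ℤˣ) : ℤ)) (by simp) (by simp)
    rw [hZ] at this
    exact norm_le_zero_iff.mp this
  have h3 := congrArg Matrix.det h1
  rw [Matrix.det_mul, h2, zero_mul, Matrix.det_one] at h3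
  exact zero_ne_one h3

/-- The correlations of the dimers of a large torus are a combination with bounded coefficients of
four small determinants. -/
theorem torusLaw_real_eq (M : ℕ) [NeZero M] (hM : Even M) (hc : ∀ e, 0 ≤ c e)
    (hdet : ∀ z w : ℂ, ‖z‖ = 1 → ‖w‖ = 1 → (kasteleynTorus c z w).det ≠ 0)
    {p : ℕ} (e : Fin p → LatticeEdge)
    (he : Function.Injective fun s => vertexProj (M * k) (M * ℓ) (Edge.white (e s))) :
    (((torusLaw (c ∘ coverProj M k ℓ)).real {x | ∀ s, x (e s) = true} : ℝ) : ℂ) =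
      ∑ s : ℤˣ, ∑ t : ℤˣ, spinCoeff s t *
        ((kasteleynTorus (c ∘ coverProj M k ℓ) ((s : ℤ) : ℂ) ((t : ℤ) : ℂ)).det /
          partitionFunction (c ∘ coverProj M k ℓ)) *
        edgeDet (kasteleynPlane c) (discreteGreen c M s t) e := by
  classical
  have hmeas : MeasurableSet {x : LatticeEdge → Bool | ∀ s, x (e s) = true} :=
    ((isClopen_discrete {y : Fin p → Bool | ∀ s, y s = true}).preimage
      (by fun_prop : Continuous fun x : LatticeEdge → Bool => (fun s : Fin p => x (e s)))).1.measurableSet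
  rw [torusLaw_real (c := c ∘ coverProj M k ℓ) (fun e => hc _) hmeas]
  have h1 : (∑ d : ZMod (M * ℓ) × ZMod (M * k) → Dir, if periodicConfig d ∈
      {x : LatticeEdge → Bool | ∀ s, x (e s) = true} then torusProb (c ∘ coverProj M k ℓ) d else 0) =
      partitionFunction (restrictWeight (c ∘ coverProj M k ℓ)
        (fun s => proj (M * k) (M * ℓ) (e s))) / partitionFunction (c ∘ coverProj M k ℓ) := by
    rw [partitionFunction_restrictWeight, Finset.sum_div]
    refine Finset.sum_congr rfl fun d _ => ?_
    have h2 : periodicConfig d ∈ {x : LatticeEdge → Bool | ∀ s, x (e s) = true} ↔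
        ∀ s, d (proj (M * k) (M * ℓ) (e s)).1 = (proj (M * k) (M * ℓ) (e s)).2 := by
      simp only [Set.mem_ofPred_eq, periodicConfig, decide_eq_true_eq]
      rfl
    rw [if_congr h2 rfl rfl, torusProb]
    by_cases h3 : IsCoverFun d <;>
      by_cases h4 : ∀ s, d (proj (M * k) (M * ℓ) (e s)).1 = (proj (M * k) (M * ℓ) (e s)).2
    · rw [if_pos h4, if_pos h3, if_pos ⟨h3, h4⟩]
    · rw [if_neg h4, if_neg (fun h => h4 h.2), zero_div]
    · rw [if_pos h4, if_neg h3, if_neg (fun h => h3 h.1)]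
    · rw [if_neg h4, if_neg (fun h => h4 h.2), zero_div]
  rw [h1, Complex.ofReal_div, partitionFunction_eq (hM.mul_right k), Finset.sum_div]
  refine Finset.sum_congr rfl fun s _ => ?_
  rw [Finset.sum_div]
  refine Finset.sum_congr rfl fun t _ => ?_
  have hK : (kasteleynTorus (c ∘ coverProj M k ℓ) ((s : ℤ) : ℂ) ((t : ℤ) : ℂ)).det ≠ 0 := by
    intro h0
    have h3 := congrArg Matrix.det (inv_kasteleynTorus_cover M c hdet s t)
    rw [Matrix.det_mul, h0, zero_mul, Matrix.det_one] at h3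
    exact zero_ne_one h3
  rw [det_kasteleynTorus_restrictWeight _ _ _ hK _ he, det_cover_eq M c hdet, edgeDet]
  ring

theorem eventually_injective_vertexProj {p : ℕ} (x : Fin p → ℤ × ℤ) (hx : Function.Injective x) :
    ∀ᶠ M : ℕ in Filter.atTop, Function.Injective fun s => vertexProj (M * k) (M * ℓ) (x s) := by
  have h : ∀ s t : Fin p, ∀ᶠ M : ℕ in Filter.atTop,
      vertexProj (M * k) (M * ℓ) (x s) = vertexProj (M * k) (M * ℓ) (x t) → s = t := by
    intro s t
    filter_upwards [Filter.eventually_gt_atTop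
      ((x t).1 - (x s).1).natAbs, Filter.eventually_gt_atTop ((x t).2 - (x s).2).natAbs] with M h1 h2 h3
    apply hx
    simp only [vertexProj, Prod.mk.injEq] at h3
    have key : ∀ (n : ℕ) [NeZero n] (a b : ℤ), (b - a).natAbs < M →
        (a : ZMod (M * n)) = (b : ZMod (M * n)) → a = b := by
      intro n _ a b hlt hab
      rw [ZMod.intCast_eq_intCast_iff_dvd_sub] at hab
      have : b - a = 0 := by
        refine Int.eq_zero_of_abs_lt_dvd hab ?_
        rw [Int.abs_eq_natAbs]
        have := Nat.le_mul_of_pos_right M (Nat.pos_of_ne_zero (NeZero.ne n))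
        exact_mod_cast hlt.trans_le this
      omega
    exact Prod.ext (key ℓ _ _ h1 h3.1) (key k _ _ h2 h3.2)
  have h' := Filter.eventually_all.mpr fun s => Filter.eventually_all.mpr fun t => h s t
  filter_upwards [h'] with M hM s t hst using hM s t hst

theorem tendsto_edgeDet {ι : Type*} {l : Filter ι} (K : ℤ × ℤ → ℤ × ℤ → ℂ)
    {G : ι → ℤ × ℤ → ℤ × ℤ → ℂ} {G₀ : ℤ × ℤ → ℤ × ℤ → ℂ}
    (h : ∀ b x, Filter.Tendsto (fun i => G i b x) l (nhds (G₀ b x))) {p : ℕ}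
    (e : Fin p → LatticeEdge) :
    Filter.Tendsto (fun i => edgeDet K (G i) e) l (nhds (edgeDet K G₀ e)) := by
  have hdet : Continuous fun A : Matrix (Fin p) (Fin p) ℂ => A.det := continuous_id.matrix_det
  refine (hdet.tendsto _).comp ?_
  refine tendsto_pi_nhds.mpr fun s => tendsto_pi_nhds.mpr fun s' => ?_
  exact (h _ _).const_mul _

/-- **Existence of the determinantal dimer measure.**  If the Kasteleyn determinant of a
nonnegative weight function has no zeros on the unit torus, then the small determinants are the
correlations of a measure on dimer covers of the plane. -/
theorem exists_isDeterminantal (hc : ∀ e, 0 ≤ c e)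
    (hdet : ∀ z w : ℂ, ‖z‖ = 1 → ‖w‖ = 1 → (kasteleynTorus c z w).det ≠ 0) (E : Set LatticeEdge)
    (hE : ∀ e : LatticeEdge, e ∉ E → c (proj k ℓ e) = 0) :
    ∃ Q : Measure (DimerCover E), IsProbabilityMeasure Q ∧
      ∀ (p : ℕ) (e : Fin p → LatticeEdge), Function.Injective e → ((Q.real (covered e) : ℝ) : ℂ) =
        edgeDet (kasteleynPlane c) (inverseKasteleyn c 1 1) e := by
  -- The periods are multiplied by even numbers, for which the partition function is given by
  -- `partitionFunction_eq`.
  let m : ℕ → ℕ := fun n => 2 * (n + 1)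
  have hm : Filter.Tendsto m Filter.atTop Filter.atTop :=
    Filter.tendsto_atTop_mono (fun n => by simp only [m, id]; omega) Filter.tendsto_id
  have hm0 : ∀ n, NeZero (m n) := fun n => ⟨by simp [m]⟩
  have hZ : ∀ n, partitionFunction (c ∘ coverProj (m n) k ℓ) ≠ 0 := fun n =>
    partitionFunction_cover_ne_zero c (m n) hc hdet
  let P : ℕ → ProbabilityMeasure (LatticeEdge → Bool) := fun n =>
    ⟨torusLaw (c ∘ coverProj (m n) k ℓ), isProbabilityMeasure_torusLaw (fun e => hc _) (hZ n)⟩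
  have hEn : ∀ n, ∀ᵐ x ∂(P n : Measure (LatticeEdge → Bool)), IsDimerCover E (occupied x) := by
    intro n
    refine ae_torusLaw fun e he => ?_
    rw [Function.comp, coverProj_proj]
    exact hE e he
  refine exists_measure_of_tendsto E P hEn
    (fun p e => edgeDet (kasteleynPlane c) (inverseKasteleyn c 1 1) e) ?_
  intro p e he
  by_cases hw : Function.Injective fun s => Edge.white (e s)
  -- The four coefficients are bounded and add up to one, and the four small determinants have the
  -- same limit. The coefficients themselves need not converge.
  · have hlim : Filter.Tendsto (fun n => ∑ s : ℤˣ, ∑ t : ℤˣ, spinCoeff s t *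
        ((kasteleynTorus (c ∘ coverProj (m n) k ℓ) ((s : ℤ) : ℂ) ((t : ℤ) : ℂ)).det /
          partitionFunction (c ∘ coverProj (m n) k ℓ)) *
        (edgeDet (kasteleynPlane c) (discreteGreen c (m n) s t) e -
          edgeDet (kasteleynPlane c) (inverseKasteleyn c 1 1) e)) Filter.atTop
        (nhds (∑ s : ℤˣ, ∑ t : ℤˣ, 0)) := by
      refine tendsto_finsetSum _ fun s _ => tendsto_finsetSum _ fun t _ => ?_
      have h1 := ((tendsto_edgeDet (kasteleynPlane c) (tendsto_discreteGreen c hdet s t) e).comp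
        hm).sub_const (edgeDet (kasteleynPlane c) (inverseKasteleyn c 1 1) e)
      rw [sub_self] at h1
      refine Filter.Tendsto.zero_mul_isBoundedUnder_le h1 ?_ |>.congr fun n => mul_comm _ _
      refine Filter.isBoundedUnder_of ⟨1, fun n => ?_⟩
      have h2 := norm_det_le_partitionFunction (c := c ∘ coverProj (m n) k ℓ) (fun e => hc _)
        (z := ((s : ℤ) : ℂ)) (w := ((t : ℤ) : ℂ))
        (by rcases Int.units_eq_one_or s with rfl | rfl <;> simp)
        (by rcases Int.units_eq_one_or t with rfl | rfl <;> simp)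
      have h3 : 0 < partitionFunction (c ∘ coverProj (m n) k ℓ) :=
        lt_of_le_of_ne ((norm_nonneg _).trans h2) (hZ n).symm
      have h4 : ‖spinCoeff s t‖ ≤ 1 := by
        unfold spinCoeff
        split_ifs <;> norm_num
      simp only [Function.comp, norm_mul, norm_div, Complex.norm_real, Real.norm_eq_abs,
        abs_of_pos h3]
      refine mul_le_one₀ h4 (by positivity) ((div_le_one h3).mpr h2)
    simp only [Finset.sum_const_zero] at hlim
    have hlim' := hlim.add_const (edgeDet (kasteleynPlane c) (inverseKasteleyn c 1 1) e)
    rw [zero_add] at hlim'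
    refine hlim'.congr' ?_
    filter_upwards [hm.eventually (eventually_injective_vertexProj (k := k) (ℓ := ℓ)
      (fun s => Edge.white (e s)) hw)] with n hn
    have h5 : ∑ s : ℤˣ, ∑ t : ℤˣ, spinCoeff s t *
        ((kasteleynTorus (c ∘ coverProj (m n) k ℓ) ((s : ℤ) : ℂ) ((t : ℤ) : ℂ)).det /
          partitionFunction (c ∘ coverProj (m n) k ℓ)) = 1 := by
      have h6 := partitionFunction_eq (k := m n * k) (ℓ := m n * ℓ)
        ((even_two_mul (n + 1)).mul_right k) (c ∘ coverProj (m n) k ℓ)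
      have h7 : (partitionFunction (c ∘ coverProj (m n) k ℓ) : ℂ) ≠ 0 :=
        Complex.ofReal_ne_zero.mpr (hZ n)
      have h8 := div_self h7
      nth_rewrite 1 [h6] at h8
      rw [← h8, Finset.sum_div]
      refine Finset.sum_congr rfl fun s _ => ?_
      rw [Finset.sum_div]
      exact Finset.sum_congr rfl fun t _ => by ring
    have h9 := torusLaw_real_eq c (m n) (even_two_mul (n + 1)) hc hdet e hn
    rw [show ((P n : Measure (LatticeEdge → Bool)).real {x | ∀ s, x (e s) = true}) =
      (torusLaw (c ∘ coverProj (m n) k ℓ)).real {x | ∀ s, x (e s) = true} from rfl, h9]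
    simp only [mul_sub, Finset.sum_sub_distrib]
    simp only [← Finset.sum_mul]
    rw [h5]
    ring
  -- Distinct edges with a common white vertex are never covered together.
  · have : ∃ s t, s ≠ t ∧ Edge.white (e s) = Edge.white (e t) := by
      simp only [Function.Injective] at hw
      push Not at hw
      obtain ⟨s, t, h1, h2⟩ := hw
      exact ⟨s, t, h2, h1⟩
    obtain ⟨s, t, hst, hwst⟩ := this
    rw [edgeDet_eq_zero_of_white_eq _ _ e hst hwst]
    refine tendsto_const_nhds.congr fun n => ?_
    have h0 : (P n : Measure (LatticeEdge → Bool)) {x | ∀ s, x (e s) = true} = 0 := by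
      refine measure_mono_null ?_ (ae_iff.mp (hEn n))
      intro x hx hcov
      have h1 := (existsUnique_white_iff _ (Edge.white (e s))).mp (hcov.2.1 (Edge.white (e s)))
      have h2 : (e s).2 = (e t).2 := by
        refine h1.unique (hx s) ?_
        rw [hwst]
        exact hx t
      exact hst (he (Prod.ext hwst h2))
    simp [measureReal_def, h0]

end TorusLaw

/-! ### Uniqueness -/

section Uniqueness

open MeasureTheory

theorem measurableSet_covered {E : Set LatticeEdge} {p : ℕ} (e : Fin p → LatticeEdge) :
    MeasurableSet (covered e : Set (DimerCover E)) := by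
  have : (covered e : Set (DimerCover E)) = Subtype.val ⁻¹' ⋂ s, {D : Set LatticeEdge | e s ∈ D} := by
    ext D; simp [covered]
  rw [this]
  exact measurable_subtype_coe (MeasurableSet.iInter fun s => measurableSet_mem _)

theorem covered_eq_empty {E : Set LatticeEdge} {p : ℕ} {e : Fin p → LatticeEdge} {s : Fin p}
    (hs : e s ∉ E) : (covered e : Set (DimerCover E)) = ∅ :=
  Set.eq_empty_of_forall_notMem fun D hD => hs (D.2.1 (hD s))

/-- A measure on dimer covers is determined by its correlations, since the events they are the
probabilities of form a π-system; edges outside `E` are never covered. -/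
theorem measure_ext_of_covered {E : Set LatticeEdge} {P Q : Measure (DimerCover E)}
    [IsProbabilityMeasure P] [IsProbabilityMeasure Q]
    (h : ∀ (p : ℕ) (e : Fin p → LatticeEdge), Function.Injective e → (∀ s, e s ∈ E) →
      P.real (covered e) = Q.real (covered e)) : P = Q := by
  let C : Set (Set (DimerCover E)) :=
    Set.range fun S : Finset LatticeEdge => {D : DimerCover E | ∀ e ∈ S, e ∈ D.1}
  have hcov : ∀ S : Finset LatticeEdge, {D : DimerCover E | ∀ e ∈ S, e ∈ D.1} =
      covered (fun i : Fin #S => (S.equivFin.symm i : LatticeEdge)) := by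
    intro S
    ext D
    constructor
    · intro hD i
      exact hD _ (S.equivFin.symm i).2
    · intro hD e he
      have := hD (S.equivFin ⟨e, he⟩)
      simpa using this
  refine ext_of_generate_finite C ?_ ?_ ?_ (by simp)
  · refine le_antisymm ?_ ?_
    · have : @Measurable _ _ (MeasurableSpace.generateFrom C) _
          (Subtype.val : DimerCover E → Set LatticeEdge) := by
        refine @measurable_set_iff _ _ (MeasurableSpace.generateFrom C) _ |>.mpr fun e => ?_
        refine @measurableSet_setOfPred _ (MeasurableSpace.generateFrom C) _ |>.mp ?_
        refine MeasurableSpace.measurableSet_generateFrom ⟨{e}, ?_⟩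
        simp
      exact measurable_iff_comap_le.mp this
    · refine MeasurableSpace.generateFrom_le ?_
      rintro _ ⟨S, rfl⟩
      simp only
      rw [hcov]
      exact measurableSet_covered _
  · classical
    rintro _ ⟨S, rfl⟩ _ ⟨T, rfl⟩ -
    refine ⟨S ∪ T, ?_⟩
    ext D
    simp only [Set.mem_ofPred_eq, Set.mem_inter_iff, Finset.mem_union]
    exact ⟨fun hD => ⟨fun e he => hD e (Or.inl he), fun e he => hD e (Or.inr he)⟩,
      fun hD e he => he.elim (hD.1 e) (hD.2 e)⟩
  · rintro _ ⟨S, rfl⟩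
    simp only
    rw [hcov]
    by_cases hS : ∀ i : Fin #S, (S.equivFin.symm i : LatticeEdge) ∈ E
    · have := h _ (fun i : Fin #S => (S.equivFin.symm i : LatticeEdge))
        (Subtype.val_injective.comp S.equivFin.symm.injective) hS
      rw [measureReal_def, measureReal_def,
        ENNReal.toReal_eq_toReal_iff' (measure_ne_top _ _) (measure_ne_top _ _)] at this
      exact this
    · push Not at hS
      obtain ⟨i, hi⟩ := hS
      rw [covered_eq_empty hi, measure_empty, measure_empty]

end Uniqueness

/-! ### Gauge invariance -/

section Gauge

variable {k ℓ : ℕ} [NeZero k] [NeZero ℓ]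

omit [NeZero k] [NeZero ℓ] in
theorem kasteleynTorus_gauge {c c' : TorusEdge k ℓ → ℝ} {F G : ZMod ℓ × ZMod k → ℝ} {r s : ℝ}
    (hr : r ≠ 0) (hs : s ≠ 0)
    (hc : ∀ e, c e * (s ^ crossV e / r ^ crossU e) = c' e * (F (Edge.white e) * G (Edge.black e)))
    (z w : ℂ) (v b : ZMod ℓ × ZMod k) :
    kasteleynTorus c (r * z) (s * w) v b = F v * kasteleynTorus c' z w v b * G b := by
  simp only [kasteleynTorus, Matrix.of_apply]
  rw [Finset.mul_sum, Finset.sum_mul]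
  refine Finset.sum_congr rfl fun d _ => ?_
  split_ifs with h
  · have h1 := congrArg (Complex.ofReal) (hc (v, d))
    rw [h] at h1
    push_cast at h1
    rw [mul_zpow, mul_zpow]
    have hr' : (r : ℂ) ≠ 0 := by exact_mod_cast hr
    have hs' : (s : ℂ) ≠ 0 := by exact_mod_cast hs
    calc _ = ((c (v, d) : ℂ) * ((s : ℂ) ^ crossV ((v, d) : TorusEdge k ℓ) /
          (r : ℂ) ^ crossU ((v, d) : TorusEdge k ℓ))) * d.sign *
          w ^ crossV ((v, d) : TorusEdge k ℓ) / z ^ crossU ((v, d) : TorusEdge k ℓ) := by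
            simp only [div_eq_mul_inv, mul_inv]; ring
      _ = _ := by rw [h1]; simp only [Edge.white]; ring
  · simp

theorem inverseKasteleyn_gauge {c c' : TorusEdge k ℓ → ℝ} {F G : ZMod ℓ × ZMod k → ℝ} {r s : ℝ}
    (hr : r ≠ 0) (hs : s ≠ 0) (hF : ∀ v, F v ≠ 0) (hG : ∀ v, G v ≠ 0)
    (hc : ∀ e, c e * (s ^ crossV e / r ^ crossU e) = c' e * (F (Edge.white e) * G (Edge.black e)))
    (b x : ℤ × ℤ) : inverseKasteleyn c r s b x =
      (blochPhase k ℓ r s b / G (vertexProj k ℓ b)) *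
        (inverseKasteleyn c' 1 1 b x / (blochPhase k ℓ r s x * F (vertexProj k ℓ x))) := by
  have hr' : (r : ℂ) ≠ 0 := by exact_mod_cast hr
  have hs' : (s : ℂ) ≠ 0 := by exact_mod_cast hs
  have hint : ∀ z w : ℂ, greenIntegrand c b x (r * z) (s * w) =
      (blochPhase k ℓ r s b / G (vertexProj k ℓ b) /
        (blochPhase k ℓ r s x * F (vertexProj k ℓ x))) * greenIntegrand c' b x z w := by
    intro z w
    have hmat : kasteleynTorus c (r * z) (s * w) =
        Matrix.diagonal (fun v => (F v : ℂ)) * kasteleynTorus c' z w *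
          Matrix.diagonal (fun v => (G v : ℂ)) := by
      ext v b
      rw [Matrix.mul_diagonal, Matrix.diagonal_mul, kasteleynTorus_gauge hr hs hc]
    have hinvd : ∀ H : ZMod ℓ × ZMod k → ℝ, (∀ v, H v ≠ 0) →
        (Matrix.diagonal (fun v => (H v : ℂ)))⁻¹ = Matrix.diagonal (fun v => (H v : ℂ)⁻¹) := by
      intro H hH
      refine Matrix.inv_eq_right_inv ?_
      rw [Matrix.diagonal_mul_diagonal, ← Matrix.diagonal_one]
      congr 1
      ext v
      exact mul_inv_cancel₀ (by exact_mod_cast hH v)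
    have hphase : ∀ y, blochPhase k ℓ (r * z) (s * w) y =
        blochPhase k ℓ r s y * blochPhase k ℓ z w y := by
      intro y
      simp only [blochPhase, mul_zpow]
      rw [div_mul_div_comm]
    rw [greenIntegrand, greenIntegrand, hmat, Matrix.mul_inv_rev, Matrix.mul_inv_rev, hinvd F hF,
      hinvd G hG, Matrix.diagonal_mul, Matrix.mul_diagonal, hphase, hphase]
    simp only [div_eq_mul_inv, mul_inv]
    ring
  rw [inverseKasteleyn_eq c hr hs, inverseKasteleyn_eq c' one_ne_zero one_ne_zero]
  have hcm : ∀ (R θ : ℝ), circleMap 0 R θ = R * circleMap 0 1 θ := by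
    intro R θ; simp [circleMap]
  simp_rw [hcm r, hcm s, hint, intervalIntegral.integral_const_mul]
  simp only [div_eq_mul_inv, mul_inv]
  ring

/-- Gauge invariance of the small determinants: multiplying the rows and columns of the Kasteleyn
matrix by functions of the vertices, and rescaling the spectral parameters, only conjugates the
small matrices by diagonal matrices. -/
theorem edgeDet_gauge {c c' : TorusEdge k ℓ → ℝ} {F G : ZMod ℓ × ZMod k → ℝ} {r s : ℝ}
    (hr : r ≠ 0) (hs : s ≠ 0) (hF : ∀ v, F v ≠ 0) (hG : ∀ v, G v ≠ 0)
    (hc : ∀ e, c e * (s ^ crossV e / r ^ crossU e) = c' e * (F (Edge.white e) * G (Edge.black e)))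
    {p : ℕ} (e : Fin p → LatticeEdge) :
    edgeDet (kasteleynPlane c) (inverseKasteleyn c r s) e =
      edgeDet (kasteleynPlane c') (inverseKasteleyn c' 1 1) e := by
  have hr' : (r : ℂ) ≠ 0 := by exact_mod_cast hr
  have hs' : (s : ℂ) ≠ 0 := by exact_mod_cast hs
  have hne := blochPhase_ne_zero (k := k) (ℓ := ℓ) hr' hs'
  have hF' : ∀ v, (F v : ℂ) ≠ 0 := fun v => by exact_mod_cast hF v
  have hG' : ∀ v, (G v : ℂ) ≠ 0 := fun v => by exact_mod_cast hG v
  refine det_gauge (fun i => G (vertexProj k ℓ (Edge.black (e i))) /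
    blochPhase k ℓ r s (Edge.black (e i))) (fun i => div_ne_zero (hG' _) (hne _)) _ _ ?_
  intro i j
  rw [inverseKasteleyn_gauge hr hs hF hG hc, kasteleynPlane_edge, kasteleynPlane_edge]
  have h1 := congrArg Complex.ofReal (hc (proj k ℓ (e j)))
  push_cast at h1
  rw [cross_eq_blochPhase hr' hs', black_proj] at h1
  have h2 : Edge.white (proj k ℓ (e j)) = vertexProj k ℓ (Edge.white (e j)) := rfl
  rw [h2] at h1
  have e1 := hne (Edge.black (e i))
  have e2 := hne (Edge.black (e j))
  have e3 := hne (Edge.white (e j))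
  have e4 := hF' (vertexProj k ℓ (Edge.white (e j)))
  have e5 := hG' (vertexProj k ℓ (Edge.black (e j)))
  have e6 := hG' (vertexProj k ℓ (Edge.black (e i)))
  have h3 : (c (proj k ℓ (e j)) : ℂ) = c' (proj k ℓ (e j)) *
      (F (vertexProj k ℓ (Edge.white (e j))) * G (vertexProj k ℓ (Edge.black (e j)))) *
      (blochPhase k ℓ r s (Edge.white (e j)) / blochPhase k ℓ r s (Edge.black (e j))) := by
    rw [← h1]
    field_simp
  rw [h3]
  field_simp

end Gauge

/-! ### Duality for the assignment problem -/

section Duality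

variable {V : Type*} [Fintype V] [DecidableEq V]

/-- If no permutation has negative cost, then no closed walk has: by Birkhoff's theorem the
transition frequencies of a closed walk, completed by loops, are a mean of permutations. -/
theorem closed_walk_nonneg {B : V → V → ℝ} (hB : ∀ σ : Equiv.Perm V, 0 ≤ ∑ u, B u (σ u))
    (hB0 : ∀ u, B u u = 0) {N : ℕ} (x : ℕ → V) (hx : x N = x 0) :
    0 ≤ ∑ i ∈ range N, B (x i) (x (i + 1)) := by
  rcases Nat.eq_zero_or_pos N with rfl | hN
  · simp
  have hN' : (0 : ℝ) < N := by exact_mod_cast hN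
  let r : V → ℝ := fun u => ∑ i ∈ range N, if x i = u then 1 else 0
  let Y : Matrix V V ℝ := Matrix.of fun u v =>
    (∑ i ∈ range N, if x i = u ∧ x (i + 1) = v then 1 else 0) + if u = v then N - r u else 0
  have hr : ∀ u, r u ≤ N := by
    intro u
    calc r u ≤ ∑ i ∈ range N, (1 : ℝ) := Finset.sum_le_sum fun i _ => by split_ifs <;> norm_num
      _ = N := by simp
  have hr' : ∀ v, (∑ i ∈ range N, if x (i + 1) = v then (1 : ℝ) else 0) = r v := by
    intro v
    have h1 := Finset.sum_range_succ (fun i => if x i = v then (1 : ℝ) else 0) N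
    have h2 := Finset.sum_range_succ' (fun i => if x i = v then (1 : ℝ) else 0) N
    rw [h1, hx] at h2
    exact (add_right_cancel h2).symm
  have hY : (N : ℝ)⁻¹ • Y ∈ doublyStochastic ℝ V := by
    rw [mem_doublyStochastic_iff_sum]
    refine ⟨fun u v => ?_, fun u => ?_, fun v => ?_⟩
    · simp only [Matrix.smul_apply, Y, Matrix.of_apply, smul_eq_mul]
      refine mul_nonneg (by positivity) (add_nonneg (Finset.sum_nonneg fun i _ => ?_) ?_)
      · split_ifs <;> norm_num
      · split_ifs
        · linarith [hr u]
        · exact le_rfl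
    · simp only [Matrix.smul_apply, Y, Matrix.of_apply, smul_eq_mul]
      rw [← Finset.mul_sum, Finset.sum_add_distrib, Finset.sum_comm]
      have : ∀ i, (∑ v, if x i = u ∧ x (i + 1) = v then (1 : ℝ) else 0) = if x i = u then 1 else 0 := by
        intro i
        by_cases h : x i = u <;> simp [h]
      simp_rw [this]
      rw [Finset.sum_ite_eq]
      simp only [mem_univ, if_true]
      change (N : ℝ)⁻¹ * (r u + (N - r u)) = 1
      field_simp
      ring
    · simp only [Matrix.smul_apply, Y, Matrix.of_apply, smul_eq_mul]
      rw [← Finset.mul_sum, Finset.sum_add_distrib, Finset.sum_comm]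
      have : ∀ i, (∑ u, if x i = u ∧ x (i + 1) = v then (1 : ℝ) else 0) =
          if x (i + 1) = v then 1 else 0 := by
        intro i
        by_cases h : x (i + 1) = v <;> simp [h]
      simp_rw [this]
      rw [hr', Finset.sum_ite_eq']
      simp only [mem_univ, if_true]
      field_simp
      ring
  obtain ⟨w, hw0, -, hw⟩ := exists_eq_sum_perm_of_mem_doublyStochastic hY
  have h1 : ∑ u, ∑ v, ((N : ℝ)⁻¹ • Y) u v * B u v = ∑ σ, w σ * ∑ u, B u (σ u) := by
    rw [← hw]
    simp only [Matrix.sum_apply, Matrix.smul_apply, smul_eq_mul, Finset.sum_mul]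
    simp_rw [Finset.sum_comm (s := univ (α := V)) (t := univ (α := Equiv.Perm V))]
    refine Finset.sum_congr rfl fun σ _ => ?_
    rw [Finset.mul_sum]
    refine Finset.sum_congr rfl fun u _ => ?_
    simp [Equiv.Perm.permMatrix, PEquiv.toMatrix_apply]
  have h2 : ∑ u, ∑ v, ((N : ℝ)⁻¹ • Y) u v * B u v =
      (N : ℝ)⁻¹ * ∑ i ∈ range N, B (x i) (x (i + 1)) := by
    simp only [Matrix.smul_apply, Y, Matrix.of_apply, smul_eq_mul, mul_assoc, ← Finset.mul_sum]
    congr 1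
    have h3 : ∀ u v, ((∑ i ∈ range N, if x i = u ∧ x (i + 1) = v then (1 : ℝ) else 0) +
        if u = v then N - r u else 0) * B u v =
        ∑ i ∈ range N, if x i = u then (if x (i + 1) = v then B u v else 0) else 0 := by
      intro u v
      have : (if u = v then N - r u else 0) * B u v = 0 := by
        split_ifs with h
        · rw [h, hB0, mul_zero]
        · rw [zero_mul]
      rw [add_mul, this, add_zero, Finset.sum_mul]
      refine Finset.sum_congr rfl fun i _ => ?_
      by_cases h1 : x i = u <;> by_cases h2 : x (i + 1) = v <;> simp [h1, h2]
    simp_rw [h3]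
    have h4 : ∀ u, (∑ v, ∑ i ∈ range N,
        if x i = u then (if x (i + 1) = v then B u v else 0) else 0) =
        ∑ i ∈ range N, if x i = u then B u (x (i + 1)) else 0 := by
      intro u
      rw [Finset.sum_comm]
      refine Finset.sum_congr rfl fun i _ => ?_
      by_cases h1 : x i = u <;> simp [h1]
    simp_rw [h4]
    rw [Finset.sum_comm]
    refine Finset.sum_congr rfl fun i _ => ?_
    simp
  have h3 : 0 ≤ (N : ℝ)⁻¹ * ∑ i ∈ range N, B (x i) (x (i + 1)) := by
    rw [← h2, h1]
    exact Finset.sum_nonneg fun σ _ => mul_nonneg (hw0 σ) (hB σ)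
  exact (mul_nonneg_iff_of_pos_left (by positivity)).mp h3

/-- The lengths of shortest walks from a base point form a potential; they are finite because there
are no negative closed walks. -/
theorem exists_walk_potential [Nonempty V] {B : V → V → ℝ}
    (hB : ∀ σ : Equiv.Perm V, 0 ≤ ∑ u, B u (σ u)) (hB0 : ∀ u, B u u = 0) :
    ∃ d : V → ℝ, ∀ u v, d v ≤ d u + B u v := by
  obtain ⟨o⟩ := ‹Nonempty V›
  let W : V → Set ℝ := fun v => {t | ∃ (N : ℕ) (x : ℕ → V), x 0 = o ∧ x N = v ∧
    t = ∑ i ∈ range N, B (x i) (x (i + 1))}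
  have hext : ∀ u v t, t ∈ W u → t + B u v ∈ W v := by
    rintro u v t ⟨N, x, h0, hN, rfl⟩
    refine ⟨N + 1, fun i => if i ≤ N then x i else v, by simp [h0], by simp, ?_⟩
    rw [Finset.sum_range_succ]
    congr 1
    · refine Finset.sum_congr rfl fun i hi => ?_
      have := mem_range.mp hi
      beta_reduce
      rw [if_pos (by omega), if_pos (by omega)]
    · simp [hN]
  have hne : ∀ v, (W v).Nonempty := fun v =>
    ⟨0 + B o v, hext o v 0 ⟨0, fun _ => o, rfl, rfl, by simp⟩⟩
  have hbdd : ∀ v, BddBelow (W v) := by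
    intro v
    refine ⟨-B v o, fun t ht => ?_⟩
    obtain ⟨N, x, h0, hN, h⟩ := hext v o t ht
    have := closed_walk_nonneg hB hB0 x (hN.trans h0.symm)
    linarith
  refine ⟨fun v => sInf (W v), fun u v => ?_⟩
  rw [← sub_le_iff_le_add]
  refine le_csInf (hne u) fun t ht => ?_
  rw [sub_le_iff_le_add]
  exact csInf_le (hbdd v) (hext u v t ht)

/-- Duality for the assignment problem: relative to an optimal permutation `σ₀`, the costs of moving
one assignment to the place of another have no negative cycles, and shortest walks give the dual
solution. -/
theorem assignment_duality [Nonempty V] {A : V → V → ℝ} {m : ℝ}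
    (hA : ∀ σ : Equiv.Perm V, ∑ u, A u (σ u) ≤ m) {σ₀ : Equiv.Perm V}
    (h₀ : ∑ u, A u (σ₀ u) = m) :
    ∃ f g : V → ℝ, (∀ u v, A u v ≤ f u + g v) ∧ ∑ u, f u + ∑ v, g v = m := by
  obtain ⟨d, hd⟩ := exists_walk_potential (B := fun u v => A u (σ₀ u) - A u (σ₀ v))
    (fun τ => by
      rw [Finset.sum_sub_distrib, h₀]
      exact sub_nonneg.mpr (hA (τ.trans σ₀))) (fun u => sub_self _)
  refine ⟨fun u => A u (σ₀ u) + d u, fun v => -d (σ₀.symm v), fun u v => ?_, ?_⟩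
  · have := hd u (σ₀.symm v)
    rw [Equiv.apply_symm_apply] at this
    linarith
  · rw [Finset.sum_add_distrib, h₀, Finset.sum_neg_distrib, Equiv.sum_comp σ₀.symm d]
    ring

end Duality

/-! ### Potentials for dimer covers of the torus -/

section Potentials

variable {k ℓ : ℕ} [NeZero k] [NeZero ℓ]

/-- Duality for dimer covers of the torus of maximal weight. Parallel edges are merged into the
heaviest one. -/
theorem dimer_duality {h : TorusEdge k ℓ → ℝ} {m : ℝ}
    (hm : ∀ d : ZMod ℓ × ZMod k → Dir, IsCoverFun d → ∑ v, h (v, d v) ≤ m)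
    {d₀ : ZMod ℓ × ZMod k → Dir} (hd₀ : IsCoverFun d₀) (h₀ : ∑ v, h (v, d₀ v) = m) :
    ∃ f g : ZMod ℓ × ZMod k → ℝ, (∀ e : TorusEdge k ℓ, h e ≤ f (Edge.white e) + g (Edge.black e)) ∧
      ∑ v, f v + ∑ v, g v = m := by
  classical
  obtain ⟨H, hH⟩ : ∃ H : ℝ, ∀ e, |h e| ≤ H :=
    ⟨∑ e, |h e|, fun e => Finset.single_le_sum (f := fun e => |h e|) (fun e _ => abs_nonneg _)
      (mem_univ e)⟩
  have hH0 : 0 ≤ H := (abs_nonneg _).trans (hH ((0, 0), Dir.west))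
  let V := ZMod ℓ × ZMod k
  let T : V → V → Finset Dir := fun v b => univ.filter fun d => v + d.shift = b
  -- Pairs that are not joined by an edge get a weight so low that they are never used.
  let A : V → V → ℝ := fun v b => if hT : (T v b).Nonempty then (T v b).sup' hT fun d => h (v, d)
    else -(Fintype.card V * H + |m|)
  have hle : ∀ (v : V) (d : Dir), h (v, d) ≤ A v (v + d.shift) := by
    intro v d
    have hd : d ∈ T v (v + d.shift) := by simp [T]
    simp only [A]
    rw [dif_pos ⟨d, hd⟩]
    exact Finset.le_sup' (fun d => h (v, d)) hd
  have hAH : ∀ v b, A v b ≤ H := by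
    intro v b
    simp only [A]
    split_ifs
    · exact Finset.sup'_le _ _ fun d _ => (le_abs_self _).trans (hH _)
    · have : (0 : ℝ) ≤ Fintype.card V * H := by positivity
      linarith [abs_nonneg m]
  have hAm : ∀ σ : Equiv.Perm V, ∑ v, A v (σ v) ≤ m := by
    intro σ
    by_cases hσ : ∀ v, (T v (σ v)).Nonempty
    · have hex : ∀ v, ∃ d ∈ T v (σ v), A v (σ v) = h (v, d) := by
        intro v
        obtain ⟨d, hd, hd'⟩ := Finset.exists_mem_eq_sup' (hσ v) fun d => h (v, d)
        refine ⟨d, hd, ?_⟩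
        simp only [A]
        rw [dif_pos (hσ v), hd']
      choose d hd hd' using hex
      have hd'' : ∀ v, v + (d v).shift = σ v := fun v => by simpa [T] using hd v
      rw [Finset.sum_congr rfl fun v _ => hd' v]
      refine hm d ?_
      rw [IsCoverFun, funext hd'']
      exact σ.bijective
    · push Not at hσ
      obtain ⟨v, hv⟩ := hσ
      have hAv : A v (σ v) = -(Fintype.card V * H + |m|) := by
        simp only [A]
        rw [dif_neg]
        rw [hv]
        exact Finset.not_nonempty_empty
      rw [← Finset.add_sum_erase _ _ (mem_univ v), hAv]
      have h1 : ∑ u ∈ univ.erase v, A u (σ u) ≤ Fintype.card V * H := by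
        refine (Finset.sum_le_sum fun u _ => hAH u (σ u)).trans ?_
        rw [Finset.sum_const, nsmul_eq_mul]
        gcongr
        exact Finset.card_le_univ _
      linarith [neg_abs_le m]
  have hA0 : ∑ v, A v (hd₀.perm v) = m :=
    le_antisymm (hAm _) (h₀ ▸ Finset.sum_le_sum fun v _ => hle v (d₀ v))
  obtain ⟨f, g, hfg, hsum⟩ := assignment_duality hAm hA0
  exact ⟨f, g, fun e => (hle e.1 e.2).trans (hfg _ _), hsum⟩

/-- Duality with strict complementarity: the edges on which an optimal potential is tight can be
taken to be exactly those of the optimal dimer covers. -/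
theorem exists_strict_potential {h : TorusEdge k ℓ → ℝ} {m : ℝ}
    (hm : ∀ d : ZMod ℓ × ZMod k → Dir, IsCoverFun d → ∑ v, h (v, d v) ≤ m)
    {d₀ : ZMod ℓ × ZMod k → Dir} (hd₀ : IsCoverFun d₀) (h₀ : ∑ v, h (v, d₀ v) = m) :
    ∃ f g : ZMod ℓ × ZMod k → ℝ, (∀ e : TorusEdge k ℓ, h e ≤ f (Edge.white e) + g (Edge.black e)) ∧
      ∑ v, f v + ∑ v, g v = m ∧ ∀ e : TorusEdge k ℓ, h e = f (Edge.white e) + g (Edge.black e) ↔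
        ∃ d : ZMod ℓ × ZMod k → Dir, IsCoverFun d ∧ ∑ v, h (v, d v) = m ∧ d e.1 = e.2 := by
  classical
  have hedge : ∀ e₀ : TorusEdge k ℓ, ∃ f g : ZMod ℓ × ZMod k → ℝ,
      (∀ e : TorusEdge k ℓ, h e ≤ f (Edge.white e) + g (Edge.black e)) ∧
      ∑ v, f v + ∑ v, g v = m ∧
      ((¬ ∃ d : ZMod ℓ × ZMod k → Dir, IsCoverFun d ∧ ∑ v, h (v, d v) = m ∧ d e₀.1 = e₀.2) →
        h e₀ < f (Edge.white e₀) + g (Edge.black e₀)) := by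
    intro e₀
    by_cases he₀ : ∃ d : ZMod ℓ × ZMod k → Dir, IsCoverFun d ∧ ∑ v, h (v, d v) = m ∧ d e₀.1 = e₀.2
    · obtain ⟨f, g, h1, h2⟩ := dimer_duality hm hd₀ h₀
      exact ⟨f, g, h1, h2, fun h3 => absurd he₀ h3⟩
    -- Raising the weight of a non-optimal edge a little changes no optimum, so an optimal potential
    -- for the raised weights is strict on that edge.
    let S : Finset (ZMod ℓ × ZMod k → Dir) := univ.filter fun d => IsCoverFun d ∧ d e₀.1 = e₀.2
    obtain ⟨δ, hδ, hδS⟩ : ∃ δ : ℝ, 0 < δ ∧ ∀ d ∈ S, ∑ v, h (v, d v) + δ ≤ m := by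
      rcases S.eq_empty_or_nonempty with hS | hS
      · exact ⟨1, one_pos, by simp [hS]⟩
      · obtain ⟨d, hd, hmax⟩ := S.exists_max_image (fun d => ∑ v, h (v, d v)) hS
        have hd' := (mem_filter.mp hd).2
        refine ⟨m - ∑ v, h (v, d v), ?_, fun d' hd' => ?_⟩
        · refine sub_pos.mpr (lt_of_le_of_ne (hm d hd'.1) fun heq => he₀ ⟨d, hd'.1, heq, hd'.2⟩)
        · linarith [hmax d' hd']
    have hsum : ∀ d : ZMod ℓ × ZMod k → Dir,
        ∑ v, (h (v, d v) + if (v, d v) = e₀ then δ else 0) =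
          ∑ v, h (v, d v) + if d e₀.1 = e₀.2 then δ else 0 := by
      intro d
      rw [Finset.sum_add_distrib]
      congr 1
      rw [Finset.sum_eq_single e₀.1]
      · refine if_congr ⟨fun h => congrArg Prod.snd h, fun h => Prod.ext rfl h⟩ rfl rfl
      · intro v _ hv
        rw [if_neg]
        exact fun h => hv (congrArg Prod.fst h)
      · simp
    obtain ⟨f, g, h1, h2⟩ := dimer_duality (h := fun e => h e + if e = e₀ then δ else 0) (m := m)
      (fun d hd => by
        rw [hsum]
        split_ifs with h3
        · exact hδS d (mem_filter.mpr ⟨mem_univ _, hd, h3⟩)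
        · rw [add_zero]; exact hm d hd) hd₀
      (by rw [hsum, if_neg (fun h3 => he₀ ⟨d₀, hd₀, h₀, h3⟩), add_zero, h₀])
    refine ⟨f, g, fun e => ?_, h2, fun _ => ?_⟩
    · refine le_trans ?_ (h1 e)
      split_ifs <;> linarith
    · have := h1 e₀
      rw [if_pos rfl] at this
      linarith
  choose f g hfg hsum hstrict using hedge
  -- The mean over all `e₀` of these potentials is strict wherever one of them is.
  have hcard : (0 : ℝ) < Fintype.card (TorusEdge k ℓ) := by
    have : Nonempty (TorusEdge k ℓ) := ⟨((0, 0), Dir.west)⟩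
    exact_mod_cast Fintype.card_pos
  set c : ℝ := ((Fintype.card (TorusEdge k ℓ) : ℕ) : ℝ)
  let F : ZMod ℓ × ZMod k → ℝ := fun v => c⁻¹ * ∑ e₀, f e₀ v
  let G : ZMod ℓ × ZMod k → ℝ := fun v => c⁻¹ * ∑ e₀, g e₀ v
  have hslack : ∀ e : TorusEdge k ℓ, F (Edge.white e) + G (Edge.black e) - h e =
      c⁻¹ * ∑ e₀, (f e₀ (Edge.white e) + g e₀ (Edge.black e) - h e) := by
    intro e
    rw [Finset.sum_sub_distrib, Finset.sum_add_distrib, Finset.sum_const, card_univ, nsmul_eq_mul]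
    simp only [F, G]
    change _ = c⁻¹ * (_ - c * h e)
    field_simp
  have hFG : ∀ e : TorusEdge k ℓ, h e ≤ F (Edge.white e) + G (Edge.black e) := by
    intro e
    rw [← sub_nonneg, hslack]
    exact mul_nonneg (by positivity) (Finset.sum_nonneg fun e₀ _ => sub_nonneg.mpr (hfg e₀ e))
  have hFGsum : ∑ v, F v + ∑ v, G v = m := by
    simp only [F, G]
    rw [← Finset.mul_sum, ← Finset.mul_sum, Finset.sum_comm, Finset.sum_comm (f := fun v e₀ => g e₀ v),
      ← mul_add, ← Finset.sum_add_distrib, Finset.sum_congr rfl fun e₀ _ => hsum e₀, Finset.sum_const,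
      card_univ, nsmul_eq_mul]
    exact inv_mul_cancel_left₀ hcard.ne' m
  refine ⟨F, G, hFG, hFGsum, fun e => ⟨fun he => ?_, ?_⟩⟩
  · by_contra hne
    have h1 : 0 < F (Edge.white e) + G (Edge.black e) - h e := by
      rw [hslack]
      refine mul_pos (by positivity) (Finset.sum_pos' (fun e₀ _ => sub_nonneg.mpr (hfg e₀ e))
        ⟨e, mem_univ e, sub_pos.mpr (hstrict e hne)⟩)
    linarith
  · rintro ⟨d, hd, hdm, hde⟩
    have h1 : ∑ v, (F v + G (v + (d v).shift) - h (v, d v)) = 0 := by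
      rw [Finset.sum_sub_distrib, Finset.sum_add_distrib, hdm,
        Function.Bijective.sum_comp hd G, hFGsum, sub_self]
    have h2 := (Finset.sum_eq_zero_iff_of_nonneg fun v _ => sub_nonneg.mpr (hFG (v, d v))).mp h1 e.1
      (mem_univ _)
    rw [hde] at h2
    exact (sub_eq_zero.mp h2).symm

end Potentials

/-! ### Slopes, energies and the tropical curve -/

section TorusCovers

variable {k ℓ : ℕ} [NeZero k] [NeZero ℓ]

/-- The set of edges chosen by `d`. -/
def coverFinset (d : ZMod ℓ × ZMod k → Dir) : Finset (TorusEdge k ℓ) :=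
  univ.image fun v => (v, d v)

theorem mem_coverFinset {d : ZMod ℓ × ZMod k → Dir} {e : TorusEdge k ℓ} :
    e ∈ coverFinset d ↔ d e.1 = e.2 := by
  simp only [coverFinset, mem_image, mem_univ, true_and]
  exact ⟨fun ⟨v, h⟩ => by rw [← h], fun h => ⟨e.1, by rw [h]⟩⟩

theorem sum_coverFinset {M : Type*} [AddCommMonoid M] (d : ZMod ℓ × ZMod k → Dir)
    (F : TorusEdge k ℓ → M) : ∑ e ∈ coverFinset d, F e = ∑ v, F (v, d v) :=
  Finset.sum_image fun _ _ _ _ h => congrArg Prod.fst h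

theorem mem_torusCovers_iff {D : Finset (TorusEdge k ℓ)} :
    D ∈ torusCovers k ℓ ↔ ∃ d : ZMod ℓ × ZMod k → Dir, IsCoverFun d ∧ coverFinset d = D := by
  simp only [torusCovers, Set.mem_ofPred_eq, IsDimerCover, existsUnique_white_iff,
    existsUnique_black_iff]
  simp only [mem_coe]
  constructor
  · rintro ⟨-, hw, hb⟩
    choose d hd hd' using hw
    simp only at hd hd'
    have hmem : ∀ v δ, (v, δ) ∈ D ↔ d v = δ :=
      fun v δ => ⟨fun h => (hd' v δ h).symm, fun h => h ▸ hd v⟩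
    refine ⟨d, ⟨fun v v' h => ?_, fun b => ?_⟩, ?_⟩
    · have h' : v + (d v).shift = v' + (d v').shift := h
      have h1 := (hb (v + (d v).shift)).unique (y₁ := d v) (y₂ := d v')
        (by rw [add_sub_cancel_right]; exact hd v)
        (by rw [h', add_sub_cancel_right]; exact hd v')
      rw [h1] at h'
      exact add_right_cancel h'
    · obtain ⟨δ, h1, -⟩ := hb b
      refine ⟨b - δ.shift, ?_⟩
      simp only
      rw [(hmem _ _).mp h1, sub_add_cancel]
    · ext ⟨v, δ⟩
      rw [mem_coverFinset, hmem]
  · rintro ⟨d, hd, rfl⟩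
    simp only [mem_coverFinset]
    refine ⟨Set.subset_univ _, fun v => ⟨d v, rfl, fun _ h => h.symm⟩, fun b => ?_⟩
    obtain ⟨u, hu⟩ := hd.2 b
    simp only at hu
    refine ⟨d u, ?_, fun δ hδ => ?_⟩
    · simp only
      rw [← hu, add_sub_cancel_right]
    · have h1 : b - δ.shift = u := hd.1 (by simp only; rw [hδ, hu, sub_add_cancel])
      rw [← hδ, h1]

theorem finite_slopes : (slopes k ℓ).Finite := (Set.toFinite _).image _

theorem energy_le_surfaceTension (ν : TorusEdge k ℓ → ℝ) {D : Finset (TorusEdge k ℓ)}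
    (hD : D ∈ torusCovers k ℓ) : energy ν D ≤ surfaceTension ν (slope D) :=
  le_csSup ((Set.toFinite _).image _).bddAbove ⟨D, ⟨hD, rfl⟩, rfl⟩

theorem exists_isMaximizer (ν : TorusEdge k ℓ → ℝ) {μ : ℤ × ℤ} (hμ : μ ∈ slopes k ℓ) :
    ∃ D, IsMaximizer ν μ D := by
  obtain ⟨D, hD, hs⟩ := hμ
  have hne : (energy ν '' {D | D ∈ torusCovers k ℓ ∧ slope D = μ}).Nonempty :=
    ⟨_, D, ⟨hD, hs⟩, rfl⟩
  obtain ⟨D', ⟨h1, h2⟩, h3⟩ := hne.csSup_mem ((Set.toFinite _).image _)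
  exact ⟨D', h1, h2, h3⟩

theorem tropicalMonomial_le_tropicalPolynomial (ν : TorusEdge k ℓ → ℝ) {m : ℤ × ℤ}
    (hm : m ∈ slopes k ℓ) (q : ℝ × ℝ) : tropicalMonomial ν m q ≤ tropicalPolynomial ν q :=
  le_csSup (finite_slopes.image _).bddAbove ⟨m, hm, rfl⟩

/-- The component of the complement of the tropical curve with slope `μ` consists of the points at
which the monomial of `μ` strictly dominates all others. -/
theorem mem_componentInterior_iff (ν : TorusEdge k ℓ → ℝ) {μ : ℤ × ℤ} (hμ : μ ∈ slopes k ℓ)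
    (q : ℝ × ℝ) : q ∈ componentInterior ν μ ↔
      ∀ m ∈ slopes k ℓ, m ≠ μ → tropicalMonomial ν m q < tropicalMonomial ν μ q := by
  constructor
  · rintro ⟨h1, h2⟩ m hm hne
    rw [h2]
    refine lt_of_le_of_ne (tropicalMonomial_le_tropicalPolynomial ν hm q) fun h => h1 ?_
    exact ⟨m, hm, μ, hμ, hne, h, h2⟩
  · intro h
    have h2 : tropicalMonomial ν μ q = tropicalPolynomial ν q := by
      refine le_antisymm (tropicalMonomial_le_tropicalPolynomial ν hμ q)
        (csSup_le ⟨_, μ, hμ, rfl⟩ ?_)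
      rintro _ ⟨m, hm, rfl⟩
      by_cases hne : m = μ
      · rw [hne]
      · exact (h m hm hne).le
    refine ⟨?_, h2⟩
    rintro ⟨m, hm, m', hm', hne, e1, e2⟩
    rcases eq_or_ne m μ with rfl | h3
    · exact (h m' hm' hne.symm).ne (e2.trans h2.symm)
    · exact (h m hm h3).ne (e1.trans h2.symm)

end TorusCovers

/-! ### Strict concavity and the component of a slope -/

section Concavity

variable {k ℓ : ℕ} [NeZero k] [NeZero ℓ]

/-- The point of the graph of the surface tension over a slope. -/
noncomputable def graphPoint (ν : TorusEdge k ℓ → ℝ) (m : ℤ × ℤ) : ℝ × ℝ × ℝ :=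
  ((m.1 : ℝ), (m.2 : ℝ), surfaceTension ν m)

omit [NeZero k] [NeZero ℓ] in
/-- Strict concavity, for families of nonnegative weights over an arbitrary finite type. -/
theorem StrictlyConcaveAt.sum_lt {ν : TorusEdge k ℓ → ℝ} {μ : ℤ × ℤ}
    (h : StrictlyConcaveAt ν μ) {ι : Type} [Fintype ι] {t : ι → ℝ} {m : ι → ℤ × ℤ}
    (ht : ∀ i, 0 ≤ t i) (hm : ∀ i, m i ∈ slopes k ℓ ∧ m i ≠ μ) (h1 : ∑ i, t i = 1)
    (hx : ∑ i, t i * ((m i).1 : ℝ) = μ.1) (hy : ∑ i, t i * ((m i).2 : ℝ) = μ.2) :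
    ∑ i, t i * surfaceTension ν (m i) < surfaceTension ν μ := by
  classical
  -- a weight equal to one would give `m i = μ`
  have hone : ∀ i, t i ≠ 1 := by
    intro i hi
    have hz : ∀ j ∈ univ, j ≠ i → t j = 0 := by
      intro j _ hj
      have h2 := Finset.add_sum_erase univ t (mem_univ i)
      rw [h1, hi] at h2
      have h3 : ∑ j ∈ univ.erase i, t j = 0 := by linarith
      exact (Finset.sum_eq_zero_iff_of_nonneg fun j _ => ht j).mp h3 j
        (mem_erase.mpr ⟨hj, mem_univ j⟩)
    rw [Finset.sum_eq_single_of_mem i (mem_univ i) fun j hj hji => by rw [hz j hj hji, zero_mul],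
      hi, one_mul] at hx hy
    exact (hm i).2 (Prod.ext (by exact_mod_cast hx) (by exact_mod_cast hy))
  -- zero weights are discarded, and the others are indexed by `Fin n`
  let S := {i // t i ≠ 0}
  have key : ∀ F : ι → ℝ, ∑ j : Fin (Fintype.card S),
      t ((Fintype.equivFin S).symm j).1 * F ((Fintype.equivFin S).symm j).1 =
        ∑ i, t i * F i := by
    intro F
    rw [Equiv.sum_comp (Fintype.equivFin S).symm (fun i : S => t i.1 * F i.1)]
    rw [← Finset.sum_filter_of_ne (p := fun i => t i ≠ 0) fun i _ h h' => h (by rw [h', zero_mul])]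
    exact (Finset.sum_subtype _ (fun i => by simp) fun i => t i * F i).symm
  have := h (Fintype.card S) (fun j => t ((Fintype.equivFin S).symm j).1)
    (fun j => m ((Fintype.equivFin S).symm j).1)
    (fun j => ⟨lt_of_le_of_ne (ht _) ((Fintype.equivFin S).symm j).2.symm,
      lt_of_le_of_ne ?_ (hone _)⟩) (fun j => hm _) ?_ (by rw [key fun i => ((m i).1 : ℝ), hx])
    (by rw [key fun i => ((m i).2 : ℝ), hy])
  · rwa [key fun i => surfaceTension ν (m i)] at this
  · rw [← h1]
    exact Finset.single_le_sum (fun i _ => ht i) (mem_univ _)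
  · simpa [h1] using key fun _ => 1

/-- Strict concavity at `μ` makes the component with slope `μ` nonempty: separate the point of the
graph over `μ` from the convex hull of the other points. -/
theorem StrictlyConcaveAt.nonempty_componentInterior {ν : TorusEdge k ℓ → ℝ} {μ : ℤ × ℤ}
    (h : StrictlyConcaveAt ν μ) (hμ : μ ∈ slopes k ℓ) : (componentInterior ν μ).Nonempty := by
  set s₀ : Set (ℝ × ℝ × ℝ) := graphPoint ν '' (slopes k ℓ \ {μ})
  have hs₀ : s₀.Finite := (finite_slopes.subset Set.sdiff_subset).image _
  set T : Set (ℝ × ℝ × ℝ) := {(μ.1 : ℝ)} ×ˢ {(μ.2 : ℝ)} ×ˢ Set.Ici (surfaceTension ν μ)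
  have hdisj : Disjoint (convexHull ℝ s₀) T := by
    rw [Set.disjoint_left]
    rintro ⟨a, b, c⟩ hx ⟨ha, hb, hc⟩
    obtain ⟨ι, _, t, z, ht, ht1, hz, hsum⟩ := mem_convexHull_iff_exists_fintype.mp hx
    choose m hm hmz using hz
    simp only [Set.mem_singleton_iff, Set.mem_Ici] at ha hb hc
    have e1 := congrArg Prod.fst hsum
    have e2 := congrArg (fun x => x.2.1) hsum
    have e3 := congrArg (fun x => x.2.2) hsum
    simp only [Prod.fst_sum, Prod.snd_sum, ← hmz, graphPoint, Prod.smul_fst, Prod.smul_snd,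
      smul_eq_mul] at e1 e2 e3
    have := h.sum_lt ht (fun i => ⟨(hm i).1, (hm i).2⟩) ht1 (e1.trans ha) (e2.trans hb)
    linarith
  obtain ⟨L, u, v, hu, huv, hv⟩ := geometric_hahn_banach_compact_closed (convex_convexHull ℝ s₀)
    (hs₀.isCompact_convexHull ℝ)
    ((convex_singleton _).prod ((convex_singleton _).prod (convex_Ici _)))
    (isClosed_singleton.prod (isClosed_singleton.prod isClosed_Ici)) hdisj
  obtain ⟨p₁, p₂, lam, hL⟩ : ∃ p₁ p₂ lam : ℝ, ∀ a b c : ℝ,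
      L (a, b, c) = a * p₁ + b * p₂ + c * lam := by
    refine ⟨L (1, 0, 0), L (0, 1, 0), L (0, 0, 1), fun a b c => ?_⟩
    have : ((a, b, c) : ℝ × ℝ × ℝ) = a • (1, 0, 0) + b • (0, 1, 0) + c • (0, 0, 1) := by simp
    rw [this, map_add, map_add, map_smul, map_smul, map_smul]
    simp
  -- the functional is bounded below on the vertical ray over `μ`
  have hlam : 0 ≤ lam := by
    by_contra! hneg
    have h1 := hv ((μ.1 : ℝ), (μ.2 : ℝ), surfaceTension ν μ +
      max 0 ((v - (μ.1 * p₁ + μ.2 * p₂ + surfaceTension ν μ * lam)) / lam)) ⟨rfl, rfl, by simp⟩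
    rw [hL] at h1
    have h2 := le_max_right 0 ((v - (μ.1 * p₁ + μ.2 * p₂ + surfaceTension ν μ * lam)) / lam)
    rw [div_le_iff_of_neg hneg] at h2
    linarith
  have hsep : ∀ m ∈ slopes k ℓ, m ≠ μ → L (graphPoint ν m) < L (graphPoint ν μ) := by
    intro m hm hne
    have h1 := hu _ (subset_convexHull ℝ s₀ ⟨m, ⟨hm, hne⟩, rfl⟩)
    have h2 := hv (graphPoint ν μ) ⟨rfl, rfl, Set.mem_Ici.mpr le_rfl⟩
    linarith
  -- the separating functional may be vertical, so its last coefficient is increased slightly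
  have hev : ∀ᶠ η in nhdsWithin (0 : ℝ) (Set.Ioi 0), ∀ m ∈ slopes k ℓ \ {μ},
      L (graphPoint ν m) + η * surfaceTension ν m <
        L (graphPoint ν μ) + η * surfaceTension ν μ := by
    refine (Set.Finite.eventually_all (finite_slopes.subset Set.sdiff_subset)).mpr fun m hm => ?_
    refine Filter.Eventually.filter_mono nhdsWithin_le_nhds ?_
    refine ContinuousAt.eventually_lt (by fun_prop) (by fun_prop) ?_
    simpa using hsep m hm.1 hm.2
  obtain ⟨η, hη, hη0⟩ := (hev.and self_mem_nhdsWithin).exists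
  have hpos : 0 < lam + η := add_pos_of_nonneg_of_pos hlam hη0
  refine ⟨(p₁ / (lam + η), p₂ / (lam + η)),
    (mem_componentInterior_iff ν hμ _).mpr fun m hm hne => ?_⟩
  have h1 := hη m ⟨hm, hne⟩
  have h2 : ∀ m : ℤ × ℤ, tropicalMonomial ν m
      (p₁ / (lam + η), p₂ / (lam + η)) =
        (L (graphPoint ν m) + η * surfaceTension ν m) / (lam + η) := by
    intro m
    rw [graphPoint, hL, tropicalMonomial]
    field_simp
    ring
  rw [h2, h2]
  exact div_lt_div_of_pos_right h1 hpos

end Concavity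

/-! ### Tight edges -/

section TightEdges

variable {k ℓ : ℕ} [NeZero k] [NeZero ℓ]

/-- The logarithmic edge weights in the magnetic field `q`. -/
noncomputable def fieldWeight (ν : TorusEdge k ℓ → ℝ) (q : ℝ × ℝ) (e : TorusEdge k ℓ) : ℝ :=
  Real.log (ν e) - crossU e * q.1 + crossV e * q.2

theorem sum_fieldWeight (ν : TorusEdge k ℓ → ℝ) (q : ℝ × ℝ) (d : ZMod ℓ × ZMod k → Dir) :
    ∑ v, fieldWeight ν q (v, d v) = energy ν (coverFinset d) +
      (slope (coverFinset d)).1 * q.1 + (slope (coverFinset d)).2 * q.2 := by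
  simp only [fieldWeight, energy, slope, sum_coverFinset, Finset.sum_add_distrib,
    Finset.sum_sub_distrib, ← Finset.sum_mul]
  push_cast
  rw [Finset.sum_neg_distrib]
  ring

/-- In the component with slope `μ`, the potentials of linear programming duality are tight exactly
on the edges of the maximizers with slope `μ`. -/
theorem exists_potential_tight_iff {ν : TorusEdge k ℓ → ℝ} {μ : ℤ × ℤ} (hμ : μ ∈ slopes k ℓ)
    {q : ℝ × ℝ} (hq : q ∈ componentInterior ν μ) :
    ∃ f g : ZMod ℓ × ZMod k → ℝ,
      (∀ e, fieldWeight ν q e ≤ f (Edge.white e) + g (Edge.black e)) ∧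
      (∀ e, fieldWeight ν q e = f (Edge.white e) + g (Edge.black e) ↔ e ∈ maximizerEdges ν μ) ∧
      ∀ d, IsCoverFun d → (∀ v, (v, d v) ∈ maximizerEdges ν μ) → slope (coverFinset d) = μ := by
  rw [mem_componentInterior_iff ν hμ] at hq
  have hle : ∀ d : ZMod ℓ × ZMod k → Dir, IsCoverFun d →
      ∑ v, fieldWeight ν q (v, d v) ≤ tropicalMonomial ν (slope (coverFinset d)) q := by
    intro d hd
    rw [sum_fieldWeight, tropicalMonomial]
    linarith [energy_le_surfaceTension ν (mem_torusCovers_iff.mpr ⟨d, hd, rfl⟩)]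
  have hslope : ∀ d : ZMod ℓ × ZMod k → Dir, IsCoverFun d → slope (coverFinset d) ∈ slopes k ℓ :=
    fun d hd => ⟨_, mem_torusCovers_iff.mpr ⟨d, hd, rfl⟩, rfl⟩
  have hm : ∀ d : ZMod ℓ × ZMod k → Dir, IsCoverFun d →
      ∑ v, fieldWeight ν q (v, d v) ≤ tropicalMonomial ν μ q := by
    intro d hd
    refine (hle d hd).trans ?_
    by_cases h : slope (coverFinset d) = μ
    · rw [h]
    · exact (hq _ (hslope d hd) h).le
  have heq : ∀ d : ZMod ℓ × ZMod k → Dir, IsCoverFun d →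
      (∑ v, fieldWeight ν q (v, d v) = tropicalMonomial ν μ q ↔
        IsMaximizer ν μ (coverFinset d)) := by
    intro d hd
    constructor
    · intro h
      have h1 : slope (coverFinset d) = μ := by
        by_contra hne
        have := hq _ (hslope d hd) hne
        linarith [hle d hd]
      refine ⟨mem_torusCovers_iff.mpr ⟨d, hd, rfl⟩, h1, ?_⟩
      rw [sum_fieldWeight, tropicalMonomial, h1] at h
      linarith
    · rintro ⟨-, h1, h2⟩
      rw [sum_fieldWeight, h1, h2, tropicalMonomial]
      ring
  obtain ⟨D₀, hD₀⟩ := exists_isMaximizer ν hμ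
  obtain ⟨d₀, hd₀, rfl⟩ := mem_torusCovers_iff.mp hD₀.1
  obtain ⟨f, g, h1, h2, h3⟩ := exists_strict_potential hm hd₀ ((heq d₀ hd₀).mpr hD₀)
  have h4 : ∀ e, fieldWeight ν q e = f (Edge.white e) + g (Edge.black e) ↔
      e ∈ maximizerEdges ν μ := by
    intro e
    rw [h3]
    constructor
    · rintro ⟨d, hd, hdm, he⟩
      exact ⟨_, (heq d hd).mp hdm, mem_coverFinset.mpr he⟩
    · rintro ⟨D, hD, he⟩
      obtain ⟨d, hd, rfl⟩ := mem_torusCovers_iff.mp hD.1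
      exact ⟨d, hd, (heq d hd).mpr hD, mem_coverFinset.mp he⟩
  refine ⟨f, g, h1, h4, fun d hd hdm => ?_⟩
  refine ((heq d hd).mp ?_).2.1
  rw [← h2, Finset.sum_congr rfl fun v _ => (h4 (v, d v)).mpr (hdm v), Finset.sum_add_distrib]
  congr 1
  exact Equiv.sum_comp hd.perm g

/-- All covers by edges of maximizers have the same slope, hence contribute to the Kasteleyn
determinant with the same phase. -/
theorem det_kasteleynTorus_uniformWeight_ne_zero {ν : TorusEdge k ℓ → ℝ} {μ : ℤ × ℤ}
    (hμ : μ ∈ slopes k ℓ) (hne : (componentInterior ν μ).Nonempty) {z w : ℂ} (hz : z ≠ 0)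
    (hw : w ≠ 0) : (kasteleynTorus (uniformWeight (maximizerEdges ν μ)) z w).det ≠ 0 := by
  classical
  obtain ⟨q, hq⟩ := hne
  obtain ⟨-, -, -, -, hslope⟩ := exists_potential_tight_iff hμ hq
  set c := uniformWeight (maximizerEdges ν μ)
  have hc0 : ∀ e, 0 ≤ c e := fun e => Set.indicator_nonneg (fun _ _ => zero_le_one) e
  have hprod : ∀ d : ZMod ℓ × ZMod k → Dir, ∏ v, c (v, d v) ≠ 0 →
      ∀ v, (v, d v) ∈ maximizerEdges ν μ := by
    intro d h v
    by_contra hv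
    exact h (Finset.prod_eq_zero (mem_univ v) (Set.indicator_of_notMem hv _))
  have hterm : ∀ d : ZMod ℓ × ZMod k → Dir, (if IsCoverFun d then
      (-1) ^ ((∑ v, crossV (v, d v)).natAbs + (∑ v, crossU (v, d v)).natAbs +
        (∑ v, crossV (v, d v)).natAbs * (∑ v, crossU (v, d v)).natAbs +
          k * (∑ v, crossU (v, d v)).natAbs) *
      (w ^ (∑ v, crossV (v, d v)) / z ^ (∑ v, crossU (v, d v))) *
      ((∏ v, c (v, d v) : ℝ) : ℂ) else 0) =
      ((-1) ^ (μ.2.natAbs + (-μ.1).natAbs + μ.2.natAbs * (-μ.1).natAbs + k * (-μ.1).natAbs) *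
        (w ^ μ.2 / z ^ (-μ.1))) *
        (((if IsCoverFun d then ∏ v, c (v, d v) else 0 : ℝ)) : ℂ) := by
    intro d
    by_cases hd : IsCoverFun d
    · rw [if_pos hd, if_pos hd]
      by_cases hp : ∏ v, c (v, d v) = 0
      · rw [hp]; simp
      · have h1 := hslope d hd (hprod d hp)
        simp only [slope, sum_coverFinset, Finset.sum_neg_distrib] at h1
        rw [← h1]
        simp only [neg_neg]
    · rw [if_neg hd, if_neg hd]; simp
  rw [det_kasteleynTorus c z w hz hw, Finset.sum_congr rfl fun d _ => hterm d, ← Finset.mul_sum,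
    ← Complex.ofReal_sum]
  refine mul_ne_zero (mul_ne_zero (pow_ne_zero _ (by norm_num))
    (div_ne_zero (zpow_ne_zero _ hw) (zpow_ne_zero _ hz))) ?_
  rw [Complex.ofReal_ne_zero]
  refine (Finset.sum_pos' (fun d _ => ?_) ?_).ne'
  · split_ifs
    · exact Finset.prod_nonneg fun v _ => hc0 _
    · exact le_rfl
  · obtain ⟨D, hD⟩ := exists_isMaximizer ν hμ
    obtain ⟨d, hd, rfl⟩ := mem_torusCovers_iff.mp hD.1
    refine ⟨d, mem_univ d, ?_⟩
    rw [if_pos hd]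
    refine Finset.prod_pos fun v _ => ?_
    rw [show c (v, d v) = 1 from
      Set.indicator_of_mem (s := maximizerEdges ν μ) ⟨_, hD, mem_coverFinset.mpr rfl⟩ _]
    exact one_pos

end TightEdges

/-! ### Lipschitz bounds for determinants -/

section Lipschitz

open Asymptotics Filter Topology

/-- The difference of products is small when the differences of the factors are. -/
theorem isBigO_mul_sub_mul {α : Type*} {l : Filter α} {f g : α → ℂ} {r : α → ℝ} {f₀ g₀ : ℂ}
    (hr : Tendsto r l (𝓝 0)) (hf : (fun a => f a - f₀) =O[l] r) (hg : (fun a => g a - g₀) =O[l] r) :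
    (fun a => f a * g a - f₀ * g₀) =O[l] r := by
  have hg1 : g =O[l] (fun _ => (1 : ℝ)) := by
    have : Tendsto g l (𝓝 g₀) := tendsto_sub_nhds_zero_iff.mp (hg.trans_tendsto hr)
    exact this.isBigO_one ℝ
  have h1 : (fun a => (f a - f₀) * g a) =O[l] r := by simpa using hf.mul hg1
  have h2 : (fun a => f₀ * (g a - g₀)) =O[l] r := hg.const_mul_left f₀
  refine (h1.add h2).congr_left fun a => by ring

theorem isBigO_prod_sub_prod {α ι : Type*} {l : Filter α} {f : ι → α → ℂ} {r : α → ℝ} {f₀ : ι → ℂ}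
    (hr : Tendsto r l (𝓝 0)) (s : Finset ι) (hf : ∀ i, (fun a => f i a - f₀ i) =O[l] r) :
    (fun a => ∏ i ∈ s, f i a - ∏ i ∈ s, f₀ i) =O[l] r := by
  classical
  induction s using Finset.induction_on with
  | empty => simpa using isBigO_zero r l
  | insert i s hi ih =>
    simp only [Finset.prod_insert hi]
    exact isBigO_mul_sub_mul hr (hf i) ih

theorem isBigO_det_sub_det {α : Type*} {l : Filter α} {p : ℕ} {A : α → Matrix (Fin p) (Fin p) ℂ}
    {A₀ : Matrix (Fin p) (Fin p) ℂ} {r : α → ℝ} (hr : Tendsto r l (𝓝 0))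
    (hA : ∀ i j, (fun a => A a i j - A₀ i j) =O[l] r) :
    (fun a => (A a).det - A₀.det) =O[l] r := by
  simp only [Matrix.det_apply, ← Finset.sum_sub_distrib, ← smul_sub]
  refine IsBigO.fun_sum fun σ _ => ?_
  have h := isBigO_prod_sub_prod hr univ fun i => hA (σ i) i
  rcases Int.units_eq_one_or (Equiv.Perm.sign σ) with hσ | hσ
  · simpa only [hσ, one_smul] using h
  · simpa only [hσ, Units.neg_smul, one_smul] using h.neg_left

end Lipschitz

/-! ### Lipschitz dependence on the weights -/

section InverseLipschitz

open Asymptotics Filter Topology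

variable {k ℓ : ℕ} [NeZero k] [NeZero ℓ]

/-- Invertibility on the unit torus is an open condition on the weights, as the torus is compact. -/
theorem eventually_det_kasteleynTorus_ne_zero {c₀ : TorusEdge k ℓ → ℝ}
    (hdet : ∀ z w : ℂ, ‖z‖ = 1 → ‖w‖ = 1 → (kasteleynTorus c₀ z w).det ≠ 0) :
    ∀ᶠ c in 𝓝 c₀, ∀ z w : ℂ, ‖z‖ = 1 → ‖w‖ = 1 → (kasteleynTorus c z w).det ≠ 0 := by
  have h := IsCompact.eventually_forall_of_forall_eventually
    (x₀ := c₀) (K := Metric.sphere (0 : ℂ) 1 ×ˢ Metric.sphere (0 : ℂ) 1)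
    ((isCompact_sphere 0 1).prod (isCompact_sphere 0 1))
    (P := fun c y => (kasteleynTorus c y.1 y.2).det ≠ 0) ?_
  · filter_upwards [h] with c hc z w hz hw
    exact hc (z, w) ⟨by simpa using hz, by simpa using hw⟩
  · rintro ⟨z, w⟩ ⟨hz, hw⟩
    simp only [mem_sphere_zero_iff_norm] at hz hw
    have hz0 : z ≠ 0 := fun h => by simp [h] at hz
    have hw0 : w ≠ 0 := fun h => by simp [h] at hw
    exact (continuous_id.matrix_det.continuousAt.comp
      (continuousAt_kasteleynTorus (c := c₀) hz0 hw0)).eventually_ne (hdet z w hz hw)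

/-- Near an invertible weight function, the inverse matrices on the unit torus are uniformly
bounded. -/
theorem exists_bound_inv_kasteleynTorus {c₀ : TorusEdge k ℓ → ℝ}
    (hdet : ∀ z w : ℂ, ‖z‖ = 1 → ‖w‖ = 1 → (kasteleynTorus c₀ z w).det ≠ 0) :
    ∃ C : ℝ, ∀ᶠ c in 𝓝 c₀, ∀ z w : ℂ, ‖z‖ = 1 → ‖w‖ = 1 →
      ∀ u v, ‖(kasteleynTorus c z w)⁻¹ u v‖ ≤ C := by
  obtain ⟨η, hη, hball⟩ := Metric.nhds_basis_closedBall.eventually_iff.mp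
    (eventually_det_kasteleynTorus_ne_zero hdet)
  set S : Set ((TorusEdge k ℓ → ℝ) × ℂ × ℂ) :=
    Metric.closedBall c₀ η ×ˢ Metric.sphere (0 : ℂ) 1 ×ˢ Metric.sphere (0 : ℂ) 1
  have hS : IsCompact S :=
    (isCompact_closedBall c₀ η).prod ((isCompact_sphere 0 1).prod (isCompact_sphere 0 1))
  have hcont : ∀ u v, ContinuousOn (fun q : (TorusEdge k ℓ → ℝ) × ℂ × ℂ =>
      (kasteleynTorus q.1 q.2.1 q.2.2)⁻¹ u v) S := by
    rintro u v ⟨c, z, w⟩ ⟨hc, hz, hw⟩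
    simp only [mem_sphere_zero_iff_norm] at hz hw
    have hz0 : z ≠ 0 := fun h => by simp [h] at hz
    have hw0 : w ≠ 0 := fun h => by simp [h] at hw
    have hinv : ContinuousAt (fun q : (TorusEdge k ℓ → ℝ) × ℂ × ℂ =>
        (kasteleynTorus q.1 q.2.1 q.2.2)⁻¹) (c, z, w) :=
      ContinuousAt.comp (f := fun q : (TorusEdge k ℓ → ℝ) × ℂ × ℂ => kasteleynTorus q.1 q.2.1 q.2.2)
        (continuousAt_matrix_inv (hball hc z w hz hw)) (continuousAt_kasteleynTorus hz0 hw0)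
    exact (continuousAt_pi.mp (continuousAt_pi.mp hinv u) v).continuousWithinAt
  choose C hC using fun u v => hS.exists_bound_of_continuousOn (hcont u v)
  refine ⟨∑ u, ∑ v, |C u v|, Metric.nhds_basis_closedBall.eventually_iff.mpr ⟨η, hη, fun c hc z w hz hw u v => ?_⟩⟩
  calc _ ≤ C u v := hC u v (c, z, w) ⟨hc, by simpa using hz, by simpa using hw⟩
    _ ≤ |C u v| := le_abs_self _
    _ ≤ ∑ v, |C u v| := Finset.single_le_sum (fun v _ => abs_nonneg (C u v)) (mem_univ v)
    _ ≤ _ := Finset.single_le_sum (f := fun u => ∑ v, |C u v|)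
      (fun u _ => Finset.sum_nonneg fun v _ => abs_nonneg (C u v)) (mem_univ u)

theorem norm_kasteleynTorus_sub_le (c c' : TorusEdge k ℓ → ℝ) {z w : ℂ} (hz : ‖z‖ = 1)
    (hw : ‖w‖ = 1) (u v : ZMod ℓ × ZMod k) :
    ‖kasteleynTorus c z w u v - kasteleynTorus c' z w u v‖ ≤ Fintype.card Dir * ‖c - c'‖ := by
  simp only [kasteleynTorus, Matrix.of_apply, ← Finset.sum_sub_distrib]
  refine (norm_sum_le _ _).trans ((Finset.sum_le_sum (g := fun _ => ‖c - c'‖) fun d _ => ?_).trans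
    (by simp))
  split_ifs
  · have hsign : ‖d.sign‖ = 1 := by cases d <;> simp [Dir.sign]
    have : (c (u, d) : ℂ) * d.sign * w ^ crossV ((u, d) : TorusEdge k ℓ) /
        z ^ crossU ((u, d) : TorusEdge k ℓ) - (c' (u, d) : ℂ) * d.sign *
        w ^ crossV ((u, d) : TorusEdge k ℓ) / z ^ crossU ((u, d) : TorusEdge k ℓ) =
        (((c - c') (u, d) : ℝ) : ℂ) * (d.sign * w ^ crossV ((u, d) : TorusEdge k ℓ) /
          z ^ crossU ((u, d) : TorusEdge k ℓ)) := by
      rw [Pi.sub_apply]; push_cast; ring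
    rw [this, norm_mul, norm_div, norm_mul, norm_zpow, norm_zpow, hz, hw, hsign, Complex.norm_real]
    simpa using norm_le_pi_norm (c - c') (u, d)
  · simp

omit [NeZero k] [NeZero ℓ] in
theorem norm_blochPhase {z w : ℂ} (hz : ‖z‖ = 1) (hw : ‖w‖ = 1) (x : ℤ × ℤ) :
    ‖blochPhase k ℓ z w x‖ = 1 := by
  simp [blochPhase, hz, hw]

theorem norm_sum_le_card_mul {ι : Type*} [Fintype ι] {F : ι → ℂ} {M : ℝ} (h : ∀ i, ‖F i‖ ≤ M) :
    ‖∑ i, F i‖ ≤ Fintype.card ι * M :=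
  (norm_sum_le_of_le univ fun i _ => h i).trans_eq (by simp)

theorem norm_integral_integral_sub_le {F G : ℝ → ℝ → ℂ} (hF : Continuous (Function.uncurry F))
    (hG : Continuous (Function.uncurry G)) {M : ℝ} (hM : ∀ u v, ‖F u v - G u v‖ ≤ M) :
    ‖(∫ u in (0 : ℝ)..1, ∫ v in (0 : ℝ)..1, F u v) - ∫ u in (0 : ℝ)..1, ∫ v in (0 : ℝ)..1, G u v‖ ≤
      M := by
  have hF' : ∀ u, Continuous (F u) := fun u => hF.comp (by fun_prop : Continuous fun v => (u, v))
  have hG' : ∀ u, Continuous (G u) := fun u => hG.comp (by fun_prop : Continuous fun v => (u, v))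
  have hFi := intervalIntegral.continuous_parametric_intervalIntegral_of_continuous'
    (μ := MeasureTheory.volume) hF 0 1
  have hGi := intervalIntegral.continuous_parametric_intervalIntegral_of_continuous'
    (μ := MeasureTheory.volume) hG 0 1
  rw [← intervalIntegral.integral_sub (hFi.intervalIntegrable _ _) (hGi.intervalIntegrable _ _)]
  refine (intervalIntegral.norm_integral_le_of_norm_le_const (C := M) fun u _ => ?_).trans_eq
    (by rw [sub_zero, abs_one, mul_one])
  rw [← intervalIntegral.integral_sub ((hF' u).intervalIntegrable _ _)
    ((hG' u).intervalIntegrable _ _)]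
  exact (intervalIntegral.norm_integral_le_of_norm_le_const (C := M) fun v _ => hM u v).trans_eq
    (by rw [sub_zero, abs_one, mul_one])

/-- On the unit torus, the integrand of the inverse Kasteleyn matrix is Lipschitz in the weights:
by `A⁻¹ - B⁻¹ = A⁻¹ (B - A) B⁻¹` this follows from bounds on the inverse matrices. -/
theorem norm_greenIntegrand_sub_le {c c₀ : TorusEdge k ℓ → ℝ} {z w : ℂ} (hz : ‖z‖ = 1)
    (hw : ‖w‖ = 1) (h : (kasteleynTorus c z w).det ≠ 0) (h₀ : (kasteleynTorus c₀ z w).det ≠ 0)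
    {C : ℝ} (hC : ∀ u v, ‖(kasteleynTorus c z w)⁻¹ u v‖ ≤ C)
    (hC₀ : ∀ u v, ‖(kasteleynTorus c₀ z w)⁻¹ u v‖ ≤ C) (b x : ℤ × ℤ) :
    ‖greenIntegrand c b x z w - greenIntegrand c₀ b x z w‖ ≤
      Fintype.card (ZMod ℓ × ZMod k) * (C * (Fintype.card (ZMod ℓ × ZMod k) *
        (Fintype.card Dir * ‖c - c₀‖ * C))) := by
  have hC0 : 0 ≤ C := (norm_nonneg _).trans (hC 0 0)
  have hinv : (kasteleynTorus c z w)⁻¹ - (kasteleynTorus c₀ z w)⁻¹ = (kasteleynTorus c z w)⁻¹ *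
      ((kasteleynTorus c₀ z w - kasteleynTorus c z w) * (kasteleynTorus c₀ z w)⁻¹) := by
    rw [Matrix.sub_mul, Matrix.mul_sub, Matrix.mul_nonsing_inv _ (isUnit_iff_ne_zero.mpr h₀),
      mul_one, ← Matrix.mul_assoc, Matrix.nonsing_inv_mul _ (isUnit_iff_ne_zero.mpr h), one_mul]
  rw [greenIntegrand, greenIntegrand, ← sub_mul, ← Matrix.sub_apply, hinv, norm_mul, norm_div,
    norm_blochPhase hz hw, norm_blochPhase hz hw, div_one, mul_one, Matrix.mul_apply]
  refine norm_sum_le_card_mul fun i => ?_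
  rw [norm_mul]
  refine mul_le_mul (hC _ _) ?_ (norm_nonneg _) hC0
  rw [Matrix.mul_apply]
  refine norm_sum_le_card_mul fun j => ?_
  rw [norm_mul, Matrix.sub_apply, norm_sub_rev]
  exact mul_le_mul (norm_kasteleynTorus_sub_le c c₀ hz hw _ _) (hC₀ _ _) (norm_nonneg _)
    (by positivity)

/-- The inverse Kasteleyn matrix of the plane is Lipschitz in the weights at an invertible weight
function. -/
theorem isBigO_inverseKasteleyn_sub {c₀ : TorusEdge k ℓ → ℝ}
    (hdet : ∀ z w : ℂ, ‖z‖ = 1 → ‖w‖ = 1 → (kasteleynTorus c₀ z w).det ≠ 0) (b x : ℤ × ℤ) :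
    (fun c => inverseKasteleyn c 1 1 b x - inverseKasteleyn c₀ 1 1 b x) =O[𝓝 c₀]
      fun c => ‖c - c₀‖ := by
  obtain ⟨C, hC⟩ := exists_bound_inv_kasteleynTorus hdet
  refine IsBigO.of_bound (Fintype.card (ZMod ℓ × ZMod k) * (C * (Fintype.card (ZMod ℓ × ZMod k) *
    (Fintype.card Dir * C)))) ?_
  filter_upwards [hC, eventually_det_kasteleynTorus_ne_zero hdet] with c hc hcdet
  rw [inverseKasteleyn_eq c one_ne_zero one_ne_zero, inverseKasteleyn_eq c₀ one_ne_zero one_ne_zero,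
    norm_norm]
  refine (norm_integral_integral_sub_le (continuous_greenIntegrand_circleMap hcdet b x)
    (continuous_greenIntegrand_circleMap hdet b x) fun u v =>
      norm_greenIntegrand_sub_le (norm_circleMap_one _) (norm_circleMap_one _)
        (hcdet _ _ (norm_circleMap_one _) (norm_circleMap_one _))
        (hdet _ _ (norm_circleMap_one _) (norm_circleMap_one _))
        (hc _ _ (norm_circleMap_one _) (norm_circleMap_one _))
        (hC.self_of_nhds _ _ (norm_circleMap_one _) (norm_circleMap_one _)) b x).trans_eq ?_
  ring

/-- The correlations are Lipschitz in the weights at an invertible weight function. -/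
theorem isBigO_edgeDet_sub {c₀ : TorusEdge k ℓ → ℝ}
    (hdet : ∀ z w : ℂ, ‖z‖ = 1 → ‖w‖ = 1 → (kasteleynTorus c₀ z w).det ≠ 0) {p : ℕ}
    (e : Fin p → LatticeEdge) :
    (fun c => edgeDet (kasteleynPlane c) (inverseKasteleyn c 1 1) e -
      edgeDet (kasteleynPlane c₀) (inverseKasteleyn c₀ 1 1) e) =O[𝓝 c₀] fun c => ‖c - c₀‖ := by
  have hr : Tendsto (fun c : TorusEdge k ℓ → ℝ => ‖c - c₀‖) (𝓝 c₀) (𝓝 0) :=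
    tendsto_norm_sub_self c₀
  refine isBigO_det_sub_det hr fun i j => ?_
  simp only [Matrix.of_apply]
  refine isBigO_mul_sub_mul hr ?_ (isBigO_inverseKasteleyn_sub hdet _ _)
  simp only [kasteleynPlane_edge, ← sub_mul]
  refine IsBigO.of_bound 1 (Eventually.of_forall fun c => ?_)
  have hsign : ‖(e j).2.sign‖ = 1 := by cases (e j).2 <;> simp [Dir.sign]
  rw [norm_mul, hsign, mul_one, ← Complex.ofReal_sub, Complex.norm_real, one_mul, norm_norm]
  exact norm_le_pi_norm (c - c₀) _

end InverseLipschitz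

/-! ### The Boltzmann weights at low temperature -/

section LowTemperature

open Asymptotics Filter Topology

variable {k ℓ : ℕ} [NeZero k] [NeZero ℓ]

/-- The Boltzmann weights at inverse temperature `β`, in the gauge given by potentials. -/
noncomputable def gaugedWeight (ν : TorusEdge k ℓ → ℝ) (q : ℝ × ℝ) (f g : ZMod ℓ × ZMod k → ℝ)
    (β : ℝ) (e : TorusEdge k ℓ) : ℝ :=
  Real.exp (-(β * (f (Edge.white e) + g (Edge.black e) - fieldWeight ν q e)))

omit [NeZero k] [NeZero ℓ] in
theorem boltzmannWeight_eq_gaugedWeight {ν : TorusEdge k ℓ → ℝ} (hν : ∀ e, 0 < ν e) (q : ℝ × ℝ)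
    (f g : ZMod ℓ × ZMod k → ℝ) (β : ℝ) (e : TorusEdge k ℓ) :
    boltzmannWeight ν β e * (Real.exp (β * q.2) ^ crossV e / Real.exp (β * q.1) ^ crossU e) =
      gaugedWeight ν q f g β e *
        (Real.exp (β * f (Edge.white e)) * Real.exp (β * g (Edge.black e))) := by
  rw [boltzmannWeight, Real.rpow_def_of_pos (hν e), ← Real.rpow_intCast,
    ← Real.rpow_intCast, ← Real.exp_mul, ← Real.exp_mul,
    ← Real.exp_sub, ← Real.exp_add, gaugedWeight, ← Real.exp_add, ← Real.exp_add, fieldWeight]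
  congr 1
  ring

/-- In a gauge that is tight exactly on `S`, the Boltzmann weights converge exponentially fast to
the indicator function of `S`. -/
theorem exists_isBigO_gaugedWeight_sub {ν : TorusEdge k ℓ → ℝ} {q : ℝ × ℝ}
    {f g : ZMod ℓ × ZMod k → ℝ} {S : Set (TorusEdge k ℓ)}
    (hle : ∀ e, fieldWeight ν q e ≤ f (Edge.white e) + g (Edge.black e))
    (htight : ∀ e, fieldWeight ν q e = f (Edge.white e) + g (Edge.black e) ↔ e ∈ S) :
    ∃ ε : ℝ, 0 < ε ∧ (fun β => ‖gaugedWeight ν q f g β - uniformWeight S‖) =O[atTop]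
      fun β => Real.exp (-(ε * β)) := by
  have hev : ∀ᶠ ε in 𝓝[>] (0 : ℝ), ∀ e, e ∉ S →
      ε ≤ f (Edge.white e) + g (Edge.black e) - fieldWeight ν q e := by
    refine eventually_all.mpr fun e => ?_
    by_cases he : e ∈ S
    · exact Eventually.of_forall fun _ h => absurd he h
    · have : 0 < f (Edge.white e) + g (Edge.black e) - fieldWeight ν q e :=
        sub_pos.mpr (lt_of_le_of_ne (hle e) fun h => he ((htight e).mp h))
      filter_upwards [nhdsWithin_le_nhds (Iic_mem_nhds this)] with ε hε _ using hε
  obtain ⟨ε, hε, hε0⟩ := (hev.and self_mem_nhdsWithin).exists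
  refine ⟨ε, hε0, IsBigO.norm_left (isBigO_pi.mpr fun e => ?_)⟩
  refine IsBigO.of_bound 1 ?_
  filter_upwards [eventually_ge_atTop 0] with β hβ
  rw [one_mul, Real.norm_of_nonneg (Real.exp_pos _).le, Pi.sub_apply, uniformWeight]
  by_cases he : e ∈ S
  · rw [Set.indicator_of_mem he, gaugedWeight, (htight e).mpr he]
    simpa using (Real.exp_pos _).le
  · rw [Set.indicator_of_notMem he, sub_zero, gaugedWeight, Real.norm_of_nonneg (Real.exp_pos _).le,
      Real.exp_le_exp, neg_le_neg_iff, mul_comm]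
    exact mul_le_mul_of_nonneg_left (hε e he) hβ

end LowTemperature

/-! ### The zero-temperature limit -/

section Limit

open Asymptotics Filter Topology MeasureTheory

variable {k ℓ : ℕ} [NeZero k] [NeZero ℓ]

/-- The event that some edges are covered depends on the set of these edges only, so that repeated
edges can be dropped. -/
theorem exists_injective_covered_eq {p : ℕ} (e : Fin p → LatticeEdge) :
    ∃ (n : ℕ) (e' : Fin n → LatticeEdge), Function.Injective e' ∧
      ∀ E : Set LatticeEdge, (covered e : Set (DimerCover E)) = covered e' := by
  refine ⟨#(univ.image e), fun i => ((univ.image e).equivFin.symm i : LatticeEdge),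
    Subtype.val_injective.comp (univ.image e).equivFin.symm.injective, fun E => ?_⟩
  ext D
  constructor
  · intro hD i
    obtain ⟨s, -, hs⟩ := mem_image.mp ((univ.image e).equivFin.symm i).2
    simp only
    rw [← hs]
    exact hD s
  · intro hD s
    have := hD ((univ.image e).equivFin ⟨e s, mem_image_of_mem e (mem_univ s)⟩)
    simpa using this

/-- Determinantal measures are unique. -/
theorem IsDeterminantal.unique {E : Set LatticeEdge} {K G : ℤ × ℤ → ℤ × ℤ → ℂ}
    {P Q : Measure (DimerCover E)} (hP : IsDeterminantal E K G P) (hQ : IsDeterminantal E K G Q) :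
    P = Q := by
  have := hP.1
  have := hQ.1
  refine measure_ext_of_covered fun p e he hE => ?_
  exact_mod_cast (hP.2 p e he hE).trans (hQ.2 p e he hE).symm

/-- In a gauge the Gibbs measure is determinantal on the unit torus. -/
theorem isGibbsMeasure_iff_gaugedWeight {ν : TorusEdge k ℓ → ℝ} (hν : ∀ e, 0 < ν e) (q : ℝ × ℝ)
    (f g : ZMod ℓ × ZMod k → ℝ) (β : ℝ) (P : Measure (DimerCover Set.univ)) :
    IsGibbsMeasure ν β q P ↔ IsDeterminantal Set.univ (kasteleynPlane (gaugedWeight ν q f g β))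
      (inverseKasteleyn (gaugedWeight ν q f g β) 1 1) P := by
  have h : ∀ (p : ℕ) (e : Fin p → LatticeEdge), edgeDet (kasteleynPlane (boltzmannWeight ν β))
      (inverseKasteleyn (boltzmannWeight ν β) (Real.exp (β * q.1)) (Real.exp (β * q.2))) e =
      edgeDet (kasteleynPlane (gaugedWeight ν q f g β))
        (inverseKasteleyn (gaugedWeight ν q f g β) 1 1) e := fun p e =>
    edgeDet_gauge (F := fun v => Real.exp (β * f v)) (G := fun v => Real.exp (β * g v))
      (Real.exp_ne_zero _) (Real.exp_ne_zero _) (fun _ => Real.exp_ne_zero _)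
      (fun _ => Real.exp_ne_zero _) (boltzmannWeight_eq_gaugedWeight hν q f g β) e
  refine and_congr_right fun _ => forall_congr' fun p => forall_congr' fun e =>
    forall_congr' fun _ => forall_congr' fun _ => ?_
  exact ⟨fun h' => h'.trans (h p e), fun h' => h'.trans (h p e).symm⟩

end Limit

end TropicalDimer

theorem mainTheorem4 (k ℓ : ℕ) [NeZero k] [NeZero ℓ] (ν : TorusEdge k ℓ → ℝ) (hν : ∀ e, 0 < ν e)
    (μ : ℤ × ℤ) (hμ : μ ∈ slopes k ℓ) (hconc : StrictlyConcaveAt ν μ) :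
    ∃ Pμ : MeasureTheory.Measure (DimerCover (liftedMaximizerEdges ν μ)),
      IsZeroTemperatureMeasure ν μ Pμ ∧
      (∀ Q, IsZeroTemperatureMeasure ν μ Q → Q = Pμ) ∧
      ∀ q ∈ componentInterior ν μ,
        ∃ Pβ : ℝ → MeasureTheory.Measure (DimerCover Set.univ),
          (∀ᶠ β in Filter.atTop,
            IsGibbsMeasure ν β q (Pβ β) ∧ ∀ Q, IsGibbsMeasure ν β q Q → Q = Pβ β) ∧
          ∀ (p : ℕ) (e : Fin p → LatticeEdge), ∃ ε : ℝ, 0 < ε ∧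
            Asymptotics.IsBigO Filter.atTop
              (fun β : ℝ => (Pβ β).real (covered e) - Pμ.real (covered e))
              (fun β : ℝ => Real.exp (-(ε * β))) := by
  classical
  set c₀ := uniformWeight (maximizerEdges ν μ) with hc₀_def
  have hdet : ∀ z w : ℂ, ‖z‖ = 1 → ‖w‖ = 1 → (kasteleynTorus c₀ z w).det ≠ 0 := fun z w hz hw =>
    det_kasteleynTorus_uniformWeight_ne_zero hμ (hconc.nonempty_componentInterior hμ)
      (fun h => by simp [h] at hz) (fun h => by simp [h] at hw)
  obtain ⟨Pμ, hPμ, hPμe⟩ := exists_isDeterminantal c₀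
    (fun e => Set.indicator_nonneg (fun _ _ => zero_le_one) e) hdet (liftedMaximizerEdges ν μ)
    (fun e he => Set.indicator_of_notMem (s := maximizerEdges ν μ) he _)
  have hzero : IsZeroTemperatureMeasure ν μ Pμ := ⟨hPμ, fun p e he _ => hPμe p e he⟩
  refine ⟨Pμ, hzero, fun Q hQ => hQ.unique hzero, fun q hq => ?_⟩
  obtain ⟨f, g, hle, htight, -⟩ := exists_potential_tight_iff hμ hq
  obtain ⟨ε, hε, hO⟩ := exists_isBigO_gaugedWeight_sub hle htight
  have hexp : Filter.Tendsto (fun β : ℝ => Real.exp (-(ε * β))) Filter.atTop (nhds 0) :=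
    Real.tendsto_exp_neg_atTop_nhds_zero.comp (Filter.tendsto_id.const_mul_atTop hε)
  have hlim : Filter.Tendsto (gaugedWeight ν q f g) Filter.atTop (nhds c₀) :=
    tendsto_iff_norm_sub_tendsto_zero.mpr (hO.trans_tendsto hexp)
  -- For small `β` the determinant may vanish somewhere on the torus; only large `β` matter, so any
  -- measure will do there.
  have hex : ∀ β, ∃ P : MeasureTheory.Measure (DimerCover Set.univ),
      (∀ z w : ℂ, ‖z‖ = 1 → ‖w‖ = 1 →
        (kasteleynTorus (gaugedWeight ν q f g β) z w).det ≠ 0) →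
      MeasureTheory.IsProbabilityMeasure P ∧
        ∀ (p : ℕ) (e : Fin p → LatticeEdge), Function.Injective e →
          ((P.real (covered e) : ℝ) : ℂ) = edgeDet (kasteleynPlane (gaugedWeight ν q f g β))
            (inverseKasteleyn (gaugedWeight ν q f g β) 1 1) e := by
    intro β
    by_cases h : ∀ z w : ℂ, ‖z‖ = 1 → ‖w‖ = 1 →
        (kasteleynTorus (gaugedWeight ν q f g β) z w).det ≠ 0
    · obtain ⟨P, hP⟩ := exists_isDeterminantal (gaugedWeight ν q f g β)
        (fun e => (Real.exp_pos _).le) h Set.univ (fun e he => absurd (Set.mem_univ e) he)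
      exact ⟨P, fun _ => hP⟩
    · exact ⟨0, fun h' => absurd h' h⟩
  choose Pβ hPβ using hex
  have hev := hlim.eventually (eventually_det_kasteleynTorus_ne_zero hdet)
  refine ⟨Pβ, ?_, fun p e => ⟨ε, hε, ?_⟩⟩
  · filter_upwards [hev] with β hβ
    have h := hPβ β hβ
    have hgibbs : IsGibbsMeasure ν β q (Pβ β) :=
      (isGibbsMeasure_iff_gaugedWeight hν q f g β _).mpr ⟨h.1, fun p e he _ => h.2 p e he⟩
    exact ⟨hgibbs, fun Q hQ => hQ.unique hgibbs⟩
  · obtain ⟨n, e', he', hcov⟩ := exists_injective_covered_eq e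
    rw [hcov, hcov]
    have h := ((isBigO_edgeDet_sub hdet e').comp_tendsto hlim).trans hO
    rw [← Asymptotics.isBigO_norm_left] at h ⊢
    refine h.congr' ?_ Filter.EventuallyEq.rfl
    filter_upwards [hev] with β hβ
    simp only [Function.comp]
    rw [← (hPβ β hβ).2 n e' he', ← hPμe n e' he', ← Complex.ofReal_sub, Complex.norm_real]
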